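/- All graphs are finite and simple. For a graph $G$ and $C\subseteq V(G)$ let $N(C)$ be the set of vertices outside $C$ with a neighbour in $C$, and $N[C]=C\cup N(C)$. A \emph{separation} of $G$ is a pair $(X,Y)$ with $X\cup Y=V(G)$ and no edge between $X\setminus Y$ and $Y\setminus X$; its \emph{order} is $|X\cap Y|$. A set $A\subseteq V(G)$ is \emph{$(q,k)$-unbreakable} if every separation $(X,Y)$ of order at most $k$ satisfies $|(X\setminus Y)\cap A|\le q$ or $|(Y\setminus X)\cap A|\le q$. An \emph{$X$–$Y$ separator} is a set $W\subseteq V(G)$ (possibly meeting $X$ or $Y$) such that no component of $G\setminus W$ meets both $X$ and $Y$; let $R_{G\setminus W}(X\setminus W)$ be the set of vertices reachable from $X\setminus W$ in $G\setminus W$. An inclusionwise minimal $X$–$Y$ separator $W$ is \emph{important} if there is no $X$–$Y$ separator $W'$ with $|W'|\le|W|$ and $R_{G\setminus W}(X\setminus W)\subsetneq R_{G\setminus W'}(X\setminus W')$. Given $S\subseteq V(G)$ and an integer $k\ge 0$, a \emph{chip} is a set $C\subseteq V(G)$ such that $G[C]$ is connected (in particular $C\ne\emptyset$), $|N(C)|\le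 3k$, and $N(C)$ is an important $C$–$S$ separator; let $\mathcal C$ be the family of inclusionwise maximal chips. Put $\eta=3k(3k\cdot 4^{3k}+1)$ and $\tau=(3k)^2\cdot 8^{3k}+2k$. **Theorem.** There is an algorithm that, given a connected graph $G$ with $n$ vertices and $m$ edges (by adjacency lists), an integer $k\ge 0$ and a $(2k,k)$-unbreakable set $S\subseteq V(G)$, computes in time $O(2^{O(k)}nm)$ the set $$A=\Bigl(\bigcap_{C\in\mathcal C}\bigl(V(G)\setminus N[C]\bigr)\Bigr)\cup\bigcup_{C\in\mathcal C}N(C)$$ (with $A=V(G)$ if $\mathcal C=\emptyset$), and this set satisfies: (a) $S\subseteq A$; (b) $|N(D)|\le\eta$ for every connected component $D$ of $G\setminus A$; (c) $A$ is $(\tau,k)$-unbreakable in $G$; (d) if $|S|>3k$, $G\setminus S$ is connected and $N(V(G)\setminus S)=S$, then $S\ne A$. Here time is the number of steps of a unit-cost random access machine with addition and subtraction, and the bound means: at most $c\,2^{ck}(nm+1)$ steps for one absolute constant $c$ (the $+1$ matters only for the one-vertex graph, where $m=0$). -/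

import Mathlib

namespace LocalDecomp

/-! ## Separations, separators, unbreakable sets, chips -/

section Graph

variable {V : Type*}

/-- The open neighbourhood `N_G(C)` of a vertex set `C`. -/
def nbhd (G : SimpleGraph V) (C : Set V) : Set V :=
  {v | v ∉ C ∧ ∃ u ∈ C, G.Adj u v}

/-- `(X, Y)` is a separation of `G`. -/
def IsSeparation (G : SimpleGraph V) (X Y : Set V) : Prop :=
  X ∪ Y = Set.univ ∧ ∀ x ∈ X \ Y, ∀ y ∈ Y \ X, ¬ G.Adj x y

/-- `A` is `(q, k)`-unbreakable in `G` (used for finite graphs only). -/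
def IsUnbreakable (G : SimpleGraph V) (q k : ℕ) (A : Set V) : Prop :=
  ∀ X Y : Set V, IsSeparation G X Y → (X ∩ Y).ncard ≤ k →
    ((X \ Y) ∩ A).ncard ≤ q ∨ ((Y \ X) ∩ A).ncard ≤ q

/-- The set of vertices reachable in `G \ W` from `X \ W`. -/
def reach (G : SimpleGraph V) (W X : Set V) : Set V :=
  {v | ∃ (x : V) (hx : x ∈ Wᶜ) (hv : v ∈ Wᶜ),
    x ∈ X ∧ (G.induce Wᶜ).Reachable ⟨x, hx⟩ ⟨v, hv⟩}

/-- `W` is an `X`-`Y` separator: no component of `G \ W` meets both `X` and `Y`. The set `W` may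
intersect `X` and `Y`. -/
def IsSeparator (G : SimpleGraph V) (X Y W : Set V) : Prop :=
  ∀ D : (G.induce Wᶜ).ConnectedComponent,
    ¬ ((∃ x ∈ D.supp, (x : V) ∈ X) ∧ ∃ y ∈ D.supp, (y : V) ∈ Y)

/-- `W` is an important `X`-`Y` separator (used for finite graphs only). -/
def IsImportantSeparator (G : SimpleGraph V) (X Y W : Set V) : Prop :=
  Minimal (IsSeparator G X Y) W ∧
    ¬ ∃ W' : Set V, IsSeparator G X Y W' ∧ W'.ncard ≤ W.ncard ∧ reach G W X ⊂ reach G W' X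

/-- `C` is a chip with respect to `S`. -/
def IsChip (G : SimpleGraph V) (k : ℕ) (S C : Set V) : Prop :=
  (G.induce C).Connected ∧ (nbhd G C).ncard ≤ 3 * k ∧ IsImportantSeparator G C S (nbhd G C)

/-- The family of all inclusionwise maximal chips. -/
def maxChips (G : SimpleGraph V) (k : ℕ) (S : Set V) : Set (Set V) :=
  {C | Maximal (IsChip G k S) C}

/-- What remains after cutting away all maximal chips: the vertices outside `N[C]` for every
maximal chip `C`, together with the neighbourhoods `N(C)` of the maximal chips. -/
def chipBag (G : SimpleGraph V) (k : ℕ) (S : Set V) : Set V :=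
  (⋂ C ∈ maxChips G k S, (C ∪ nbhd G C)ᶜ) ∪ ⋃ C ∈ maxChips G k S, nbhd G C

end Graph

/-- `η = 3k (3k · 4^{3k} + 1)`. -/
def eta (k : ℕ) : ℕ := 3 * k * (3 * k * 4 ^ (3 * k) + 1)

/-- `τ = (3k)² · 8^{3k} + 2k`. -/
def tau (k : ℕ) : ℕ := (3 * k) ^ 2 * 8 ^ (3 * k) + 2 * k

/-! ## A unit-cost random access machine

Memory consists of arrays of natural numbers. A program is a finite piece of code; it refers to
arrays by fixed names, so it uses finitely many of them, and it addresses cells indirectly by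
computed indices. The only arithmetic operations are addition and truncated subtraction. -/

/-- Memory contents: `σ a i` is cell `i` of array `a`. -/
abbrev Store := ℕ → ℕ → ℕ

inductive Expr where
  /-- a constant -/
  | lit (c : ℕ)
  /-- the content of cell `i` of array `a` -/
  | get (a : ℕ) (i : Expr)
  | add (x y : Expr)
  /-- truncated subtraction -/
  | sub (x y : Expr)

namespace Expr

def eval (σ : Store) : Expr → ℕ
  | lit c => c
  | get a i => σ a (i.eval σ)
  | add x y => x.eval σ + y.eval σ
  | sub x y => x.eval σ - y.eval σ

/-- Number of elementary operations in the evaluation of an expression. -/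
def cost : Expr → ℕ
  | lit _ => 1
  | get _ i => i.cost + 1
  | add x y => x.cost + y.cost + 1
  | sub x y => x.cost + y.cost + 1

end Expr

inductive Prog where
  | skip
  /-- `a[i] := e` -/
  | assign (a : ℕ) (i e : Expr)
  | seq (p q : Prog)
  /-- run `p` if `b ≠ 0`, otherwise `q` -/
  | cond (b : Expr) (p q : Prog)
  /-- run `p` as long as `b ≠ 0` -/
  | loop (b : Expr) (p : Prog)

/-- Write `x` into cell `i` of array `a`. -/
def Store.write (σ : Store) (a i x : ℕ) : Store :=
  Function.update σ a (Function.update (σ a) i x)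

/-- `Exec p σ t σ'`: started in memory `σ`, the program `p` halts after exactly `t` elementary steps
with memory `σ'`. -/
inductive Exec : Prog → Store → ℕ → Store → Prop where
  | skip (σ : Store) : Exec .skip σ 1 σ
  | assign (σ : Store) (a : ℕ) (i e : Expr) :
      Exec (.assign a i e) σ (i.cost + e.cost + 1) (σ.write a (i.eval σ) (e.eval σ))
  | seq {p q : Prog} {σ σ' σ'' : Store} {t t' : ℕ} (hp : Exec p σ t σ') (hq : Exec q σ' t' σ'') :
      Exec (.seq p q) σ (t + t') σ''
  | cond_true {b : Expr} {p q : Prog} {σ σ' : Store} {t : ℕ} (hb : b.eval σ ≠ 0)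
      (hp : Exec p σ t σ') : Exec (.cond b p q) σ (b.cost + 1 + t) σ'
  | cond_false {b : Expr} {p q : Prog} {σ σ' : Store} {t : ℕ} (hb : b.eval σ = 0)
      (hq : Exec q σ t σ') : Exec (.cond b p q) σ (b.cost + 1 + t) σ'
  | loop_done {b : Expr} {p : Prog} {σ : Store} (hb : b.eval σ = 0) :
      Exec (.loop b p) σ (b.cost + 1) σ
  | loop_step {b : Expr} {p : Prog} {σ σ' σ'' : Store} {t t' : ℕ} (hb : b.eval σ ≠ 0)
      (hp : Exec p σ t σ') (hl : Exec (.loop b p) σ' t' σ'') :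
      Exec (.loop b p) σ (b.cost + 1 + t + t') σ''

/-! ## Input and output -/

/-- `adj` lists, for every vertex, its neighbours once each, in an arbitrary order. -/
def IsAdjList {n : ℕ} (G : SimpleGraph (Fin n)) (adj : Fin n → List (Fin n)) : Prop :=
  ∀ v, (adj v).Nodup ∧ ∀ w, w ∈ adj v ↔ G.Adj v w

/-- Initial memory. Array `0` holds `n, k`. Array `2` holds the concatenated adjacency lists of the
vertices `0, …, n - 1`; the list of `v` occupies the cells from `off[v]` up to (not including)
`off[v + 1]`, where `off` is array `1`, of length `n + 1`. Array `3` is the characteristic vector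
of `S`. All other cells are `0`. -/
def inputStore {n : ℕ} (adj : Fin n → List (Fin n)) (k : ℕ) (S : Finset (Fin n)) : Store
  | 0, 0 => n
  | 0, 1 => k
  | 1, i => if i ≤ n then (((List.finRange n).take i).map fun u => (adj u).length).sum else 0
  | 2, i => (((List.finRange n).flatMap adj).map Fin.val).getD i 0
  | 3, i => if ∃ v ∈ S, (v : ℕ) = i then 1 else 0
  | _, _ => 0

/-- The computed vertex set, read off array `4`, its characteristic vector. -/
def outputSet (n : ℕ) (σ : Store) : Set (Fin n) := {v | σ 4 v ≠ 0}

end LocalDecomp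

/-!
The maximal chips are the maximal connected sets `C` disjoint from `S` with `|N(C)| ≤ 3k`. If one
of them, `C`, meets the neighbourhood `N(C')` of another, then `C'` meets `N(C)`, for otherwise
`C' ⊆ C`. Hence the part of a bag outside `S` on one side of a separation `(X, Y)`, and the
neighbourhood of a component of the complement of the bag, are covered by neighbourhoods of chips
that meet a small set, and it suffices that a vertex `v` is in at most `4^(3k)` maximal chips.

This follows by branching. By submodularity, a maximal chip that contains `Z` and avoids `T ⊇ S`
contains the side `R` of the furthest minimum cut between `Z` and `T`. If `N(R) ⊈ T`, choose a
vertex of `N(R) \ T` and let it join `R` or `T`. The first choice increases the minimum cut, the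
second the number of forbidden neighbours of `R`, and both numbers are at most `3k`. The leaves of
the search tree are numbered by the words of `6k` bits. The algorithm goes through all vertices `v`
and all words, finds `R` on every level by at most `3k + 1` searches for an augmenting path, and
discards a result if another one for the same `v` properly contains it.
-/

namespace LocalDecomp

section Connectivity

variable {V : Type*} {G : SimpleGraph V} {C W X Y : Set V} {u v : V}

theorem mem_of_reachable_induce {R : Set V} (hX : ∀ a ∈ X, ∀ b ∈ R, G.Adj a b → b ∈ X) {a b : R}
    (h : (G.induce R).Reachable a b) (ha : (a : V) ∈ X) : (b : V) ∈ X := by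
  obtain ⟨p⟩ := h
  induction p with
  | nil => exact ha
  | cons hab _ ih => exact ih (hX _ ha _ (Subtype.coe_prop _) hab)

theorem subset_of_disjoint_nbhd (hC : (G.induce C).Connected) (hCX : (C ∩ X).Nonempty)
    (h : Disjoint C (nbhd G X)) : C ⊆ X := by
  obtain ⟨x, hxC, hxX⟩ := hCX
  refine fun y hy => mem_of_reachable_induce (fun a ha b hb hab => ?_)
    (hC.preconnected ⟨x, hxC⟩ ⟨y, hy⟩) hxX
  by_contra hbX
  exact Set.disjoint_left.1 h hb ⟨hbX, a, ha, hab⟩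

theorem connected_induce_insert (hC : (G.induce C).Connected) (hv : v ∈ nbhd G C) :
    (G.induce (insert v C)).Connected := by
  obtain ⟨-, u, hu, huv⟩ := hv
  rw [Set.insert_eq]
  exact SimpleGraph.connected_induce_union .of_subsingleton hC.preconnected
    (Set.mem_singleton v) hu huv.symm

theorem reach_subset_compl : reach G W X ⊆ Wᶜ := fun _ ⟨_, _, hv, _⟩ => hv

theorem mem_reach_self (hv : v ∉ W) : v ∈ reach G W {v} :=
  ⟨v, hv, hv, rfl, .refl _⟩

theorem mem_reach_of_adj (hu : u ∈ reach G W X) (hv : v ∉ W) (huv : G.Adj u v) :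
    v ∈ reach G W X := by
  obtain ⟨x, hx, hu, hxX, hr⟩ := hu
  have hadj : (G.induce Wᶜ).Adj ⟨u, hu⟩ ⟨v, hv⟩ := huv
  exact ⟨x, hx, hv, hxX, hr.trans hadj.reachable⟩

theorem nbhd_reach_subset : nbhd G (reach G W X) ⊆ W := by
  rintro v ⟨hv, u, hu, huv⟩
  by_contra hvW
  exact hv (mem_reach_of_adj hu hvW huv)

theorem reach_subset (hXY : X \ W ⊆ Y) (hY : nbhd G Y ⊆ W) : reach G W X ⊆ Y := by
  rintro v ⟨x, hx, hv, hxX, hr⟩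
  refine mem_of_reachable_induce (fun a ha b hb hab => ?_) hr (hXY ⟨hxX, hx⟩)
  by_contra hbY
  exact hb (hY ⟨hbY, a, ha, hab⟩)

theorem subset_reach (hC : (G.induce C).Connected) (hv : v ∈ C) (hCW : Disjoint C W) :
    C ⊆ reach G W {v} :=
  subset_of_disjoint_nbhd hC ⟨v, hv, mem_reach_self (Set.disjoint_left.1 hCW hv)⟩
    (hCW.mono_right nbhd_reach_subset)

theorem connected_induce_reach (hv : v ∉ W) : (G.induce (reach G W {v})).Connected := by
  let X : Set V := {u | ∃ hu : u ∈ reach G W {v},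
    (G.induce (reach G W {v})).Reachable ⟨v, mem_reach_self hv⟩ ⟨u, hu⟩}
  have subset_X : reach G W {v} ⊆ X := by
    refine reach_subset ?_ ?_
    · rintro _ ⟨rfl, _⟩
      exact ⟨mem_reach_self hv, .refl _⟩
    · rintro w ⟨hwX, u, ⟨hu, hvu⟩, huw⟩
      by_contra hwW
      have hadj : (G.induce (reach G W {v})).Adj ⟨u, hu⟩ ⟨w, mem_reach_of_adj hu hwW huw⟩ := huw
      exact hwX ⟨_, hvu.trans hadj.reachable⟩
  exact SimpleGraph.connected_iff_exists_forall_reachable _ |>.2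
    ⟨⟨v, mem_reach_self hv⟩, fun u => (subset_X u.2).2⟩

theorem reach_eq_reach_singleton (hC : (G.induce C).Connected) (hv : v ∈ C)
    (hCW : Disjoint C W) : reach G W C = reach G W {v} :=
  (reach_subset (Set.sdiff_subset.trans (subset_reach hC hv hCW)) nbhd_reach_subset).antisymm
    (reach_subset (Set.sdiff_subset.trans (Set.singleton_subset_iff.2 ⟨v,
      Set.disjoint_left.1 hCW hv, Set.disjoint_left.1 hCW hv, hv, .refl _⟩)) nbhd_reach_subset)

theorem disjoint_nbhd : Disjoint C (nbhd G C) :=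
  Set.disjoint_right.2 fun _ h => h.1

theorem reach_nbhd : reach G (nbhd G C) C = C :=
  (reach_subset Set.sdiff_subset subset_rfl).antisymm fun v hv =>
    have hv' : v ∉ nbhd G C := Set.disjoint_left.1 disjoint_nbhd hv
    ⟨v, hv', hv', hv, .refl _⟩

theorem isSeparator_iff_disjoint_reach :
    IsSeparator G X Y W ↔ Disjoint (reach G W X) Y := by
  rw [Set.disjoint_left]
  constructor
  · rintro h u ⟨x, hx, hu, hxX, hr⟩ huY
    exact h ((G.induce Wᶜ).connectedComponentMk ⟨u, hu⟩)
      ⟨⟨⟨x, hx⟩, SimpleGraph.ConnectedComponent.sound hr, hxX⟩, ⟨⟨u, hu⟩, rfl, huY⟩⟩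
  · rintro h D ⟨⟨x, hx, hxX⟩, ⟨y, hy, hyY⟩⟩
    exact h ⟨x, x.2, y.2, hxX, SimpleGraph.ConnectedComponent.exact (hx.trans hy.symm)⟩ hyY

theorem image_supp_eq_reach (hv : v ∉ W) :
    Subtype.val '' ((G.induce Wᶜ).connectedComponentMk ⟨v, hv⟩).supp = reach G W {v} := by
  ext u
  constructor
  · rintro ⟨u, hu, rfl⟩
    exact ⟨v, hv, u.2, rfl, (SimpleGraph.ConnectedComponent.exact hu).symm⟩
  · rintro ⟨_, _, hu, rfl, hr⟩
    exact ⟨⟨u, hu⟩, SimpleGraph.ConnectedComponent.sound hr.symm, rfl⟩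

theorem nbhd_reach_compl_subset {R : Set V} :
    nbhd G (reach G Rᶜ X) ⊆ nbhd G R := by
  rintro w ⟨hw, u, hu, huw⟩
  have huR : u ∈ R := by simpa using reach_subset_compl hu
  exact ⟨fun hwR => hw (mem_reach_of_adj hu (by simpa using hwR) huw), u, huR, huw⟩

theorem ncard_nbhd_union_add_ncard_nbhd_inter_le [Finite V] (A B : Set V) :
    (nbhd G (A ∪ B)).ncard + (nbhd G (A ∩ B)).ncard ≤ (nbhd G A).ncard + (nbhd G B).ncard := by
  have card_closed (X : Set V) : (nbhd G X ∪ X).ncard = (nbhd G X).ncard + X.ncard :=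
    Set.ncard_union_eq (Set.disjoint_left.2 fun _ h => h.1)
  have union_closed : nbhd G (A ∪ B) ∪ (A ∪ B) = (nbhd G A ∪ A) ∪ (nbhd G B ∪ B) := by
    ext x
    simp only [nbhd, Set.mem_union, Set.mem_ofPred_eq]
    grind
  have inter_closed : nbhd G (A ∩ B) ∪ (A ∩ B) ⊆ (nbhd G A ∪ A) ∩ (nbhd G B ∪ B) := by
    intro x
    simp only [nbhd, Set.mem_union, Set.mem_ofPred_eq, Set.mem_inter_iff]
    grind
  have h_sets := Set.ncard_union_add_ncard_inter A B
  have h_closed := Set.ncard_union_add_ncard_inter (nbhd G A ∪ A) (nbhd G B ∪ B)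
  have h_inter := Set.ncard_le_ncard inter_closed
  rw [← union_closed] at h_closed
  simp only [card_closed] at h_closed h_inter
  omega

end Connectivity

section Chips

variable {V : Type*} {G : SimpleGraph V} {S C C' : Set V} {p k N : ℕ} {v : V}

/-- A chip without the importance condition. The maximal chips are the maximal prechips with
`p = 3 * k`, see `mem_maxChips_iff`. -/
structure IsPrechip (G : SimpleGraph V) (S : Set V) (p : ℕ) (C : Set V) : Prop where
  connected : (G.induce C).Connected
  disjoint : Disjoint C S
  ncard_nbhd_le : (nbhd G C).ncard ≤ p

theorem IsChip.isPrechip (h : IsChip G k S C) : IsPrechip G S (3 * k) C where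
  connected := h.1
  disjoint := by simpa only [isSeparator_iff_disjoint_reach, reach_nbhd] using h.2.2.1.1
  ncard_nbhd_le := h.2.1

theorem IsPrechip.exists_maximal [Finite V] (h : IsPrechip G S p C) :
    ∃ D, C ⊆ D ∧ Maximal (IsPrechip G S p) D :=
  (Set.toFinite {C | IsPrechip G S p C}).exists_le_maximal h

theorem reach_subset_of_maximal [Finite V] (h : Maximal (IsPrechip G S p) C) {W : Set V}
    (hCW : Disjoint C W) (hW : IsSeparator G C S W) (hcard : W.ncard ≤ (nbhd G C).ncard) :
    reach G W C ⊆ C := by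
  obtain ⟨⟨v, hv⟩⟩ := h.1.connected.nonempty
  rw [isSeparator_iff_disjoint_reach] at hW
  rw [reach_eq_reach_singleton h.1.connected hv hCW] at hW ⊢
  exact h.2
    ⟨connected_induce_reach (Set.disjoint_left.1 hCW hv), hW,
      (Set.ncard_le_ncard nbhd_reach_subset).trans (hcard.trans h.1.ncard_nbhd_le)⟩
    (subset_reach h.1.connected hv hCW)

theorem isChip_of_maximal [Finite V] (h : Maximal (IsPrechip G S (3 * k)) C) :
    IsChip G k S C := by
  refine ⟨h.1.connected, h.1.ncard_nbhd_le, ⟨?_, fun W hW hWN => ?_⟩, ?_⟩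
  · rw [isSeparator_iff_disjoint_reach, reach_nbhd]
    exact h.1.disjoint
  · rintro x ⟨hxC, u, hu, hux⟩
    by_contra hxW
    have hCW : Disjoint C W := disjoint_nbhd.mono_right hWN
    have huW : u ∉ W := Set.disjoint_left.1 hCW hu
    have hreach := reach_subset_of_maximal h hCW hW (Set.ncard_le_ncard hWN)
    exact hxC (hreach (mem_reach_of_adj ⟨u, huW, huW, hu, .refl _⟩ hxW hux))
  · rintro ⟨W, hW, hcard, hlt⟩
    rw [reach_nbhd] at hlt
    have hCW : Disjoint C W :=
      Set.disjoint_left.2 fun x hx => reach_subset_compl (hlt.1 hx)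
    exact hlt.2 (reach_subset_of_maximal h hCW hW hcard)

theorem mem_maxChips_iff [Finite V] :
    C ∈ maxChips G k S ↔ Maximal (IsPrechip G S (3 * k)) C := by
  constructor
  · intro h
    obtain ⟨D, hCD, hD⟩ := h.1.isPrechip.exists_maximal
    rwa [hCD.antisymm (h.2 (isChip_of_maximal hD) hCD)]
  · exact fun h => ⟨isChip_of_maximal h, fun D hD hCD => h.2 hD.isPrechip hCD⟩

theorem nbhd_inter_nonempty_symm (hC' : Maximal (IsPrechip G S p) C') (hC : IsPrechip G S p C)
    (h : (nbhd G C' ∩ C).Nonempty) : (nbhd G C ∩ C').Nonempty := by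
  by_contra hempty
  obtain ⟨x, ⟨hxC', y, hy, hyx⟩, hxC⟩ := h
  have hdisj : Disjoint C' (nbhd G C) := by
    rwa [Set.disjoint_iff_inter_eq_empty, Set.inter_comm, ← Set.not_nonempty_iff_eq_empty]
  have hyC : y ∈ C := by
    by_contra hyC
    exact Set.disjoint_left.1 hdisj hy ⟨hyC, x, hxC, hyx.symm⟩
  exact hxC' (hC'.2 hC (subset_of_disjoint_nbhd hC'.1.connected ⟨y, hy, hyC⟩ hdisj) hxC)

theorem mem_chipBag_iff : v ∈ chipBag G k S ↔
    (∀ C ∈ maxChips G k S, v ∉ C) ∨ ∃ C ∈ maxChips G k S, v ∈ nbhd G C := by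
  simp only [chipBag, Set.mem_union, Set.mem_iInter, Set.mem_iUnion, Set.mem_compl_iff, exists_prop]
  grind

theorem exists_maxChip_of_notMem_chipBag (hv : v ∉ chipBag G k S) :
    ∃ C ∈ maxChips G k S, v ∈ C := by
  by_contra! h
  exact hv (mem_chipBag_iff.2 (.inl h))

theorem nbhd_subset_chipBag (hC : C ∈ maxChips G k S) : nbhd G C ⊆ chipBag G k S :=
  fun _ hx => mem_chipBag_iff.2 (.inr ⟨C, hC, hx⟩)

theorem exists_mem_nbhd_of_mem_chipBag (hv : v ∈ chipBag G k S) (hC : C ∈ maxChips G k S)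
    (hvC : v ∈ C) : ∃ C' ∈ maxChips G k S, v ∈ nbhd G C' :=
  (mem_chipBag_iff.1 hv).resolve_left fun h => h C hC hvC

theorem subset_chipBag : S ⊆ chipBag G k S :=
  fun _ hv => mem_chipBag_iff.2 (.inl fun _ hC hvC =>
    Set.disjoint_left.1 hC.1.isPrechip.disjoint hvC hv)

theorem ne_chipBag (hS : 3 * k < S.ncard) (hc : (G.induce Sᶜ).Connected) (hN : nbhd G Sᶜ = S) :
    S ≠ chipBag G k S := by
  intro hSA
  obtain ⟨⟨v, hv⟩⟩ := hc.nonempty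
  obtain ⟨C, hC, hvC⟩ := exists_maxChip_of_notMem_chipBag (hSA ▸ hv)
  have hNC : nbhd G C ⊆ S := (nbhd_subset_chipBag hC).trans hSA.ge
  have hCS : C = Sᶜ := Set.Subset.antisymm
    (Set.subset_compl_iff_disjoint_right.2 hC.1.isPrechip.disjoint)
    (subset_of_disjoint_nbhd hc ⟨v, hv, hvC⟩ (disjoint_compl_left.mono_right hNC))
  have := hC.1.2.1
  rw [hCS, hN] at this
  omega

/-- The union of `N(C)` over the maximal chips `C` that meet `U`. -/
def chipNbhds (G : SimpleGraph V) (k : ℕ) (S U : Set V) : Set V :=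
  ⋃ C ∈ {C ∈ maxChips G k S | (C ∩ U).Nonempty}, nbhd G C

theorem mem_chipNbhds {U : Set V} (hC : C ∈ maxChips G k S) (hU : (C ∩ U).Nonempty)
    (hv : v ∈ nbhd G C) : v ∈ chipNbhds G k S U :=
  Set.mem_biUnion (show C ∈ {C ∈ maxChips G k S | (C ∩ U).Nonempty} from ⟨hC, hU⟩) hv

theorem ncard_biUnion_le {ι α : Type*} [Finite ι] {I : Set ι} {f : ι → Set α} {b : ℕ}
    (hf : ∀ i ∈ I, (f i).ncard ≤ b) : (⋃ i ∈ I, f i).ncard ≤ I.ncard * b := by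
  have hI : (⋃ i ∈ I, f i) = ⋃ i ∈ I.toFinite.toFinset, f i := by
    simp only [Set.Finite.mem_toFinset]
  rw [hI, Set.ncard_eq_toFinset_card I]
  exact (Finset.set_ncard_biUnion_le _ f).trans
    (Finset.sum_le_card_nsmul _ _ _ fun i hi => hf i (I.toFinite.mem_toFinset.1 hi))

theorem ncard_chipNbhds_le [Finite V] (hN : ∀ v, {C ∈ maxChips G k S | v ∈ C}.ncard ≤ N)
    (U : Set V) : (chipNbhds G k S U).ncard ≤ U.ncard * N * (3 * k) := by
  have hU : {C ∈ maxChips G k S | (C ∩ U).Nonempty} = ⋃ v ∈ U, {C ∈ maxChips G k S | v ∈ C} := by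
    ext C
    simp only [Set.mem_ofPred_eq, Set.mem_iUnion, exists_prop]
    exact ⟨fun ⟨hC, v, hvC, hv⟩ => ⟨v, hv, hC, hvC⟩, fun ⟨v, hv, hC, hvC⟩ => ⟨hC, v, hvC, hv⟩⟩
  calc (chipNbhds G k S U).ncard
      ≤ {C ∈ maxChips G k S | (C ∩ U).Nonempty}.ncard * (3 * k) :=
        ncard_biUnion_le fun C hC => hC.1.1.2.1
    _ ≤ U.ncard * N * (3 * k) := by
        rw [hU]
        exact Nat.mul_le_mul_right _ (ncard_biUnion_le fun v _ => hN v)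

theorem nbhd_component_subset [Finite V] {d : V} (hC : C ∈ maxChips G k S) (hd : d ∈ C)
    (hdA : d ∉ chipBag G k S) :
    nbhd G (reach G (chipBag G k S) {d}) ⊆ nbhd G C ∪ chipNbhds G k S (nbhd G C) := by
  have hDC : reach G (chipBag G k S) {d} ⊆ C :=
    reach_subset (by simpa [hdA] using hd) (nbhd_subset_chipBag hC)
  intro x hx
  by_cases hxC : x ∈ C
  · obtain ⟨C', hC', hxC'⟩ := exists_mem_nbhd_of_mem_chipBag (nbhd_reach_subset hx) hC hxC
    have hmeet := nbhd_inter_nonempty_symm (mem_maxChips_iff.1 hC') hC.1.isPrechip ⟨x, hxC', hxC⟩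
    exact .inr (mem_chipNbhds hC' (by rwa [Set.inter_comm]) hxC')
  · obtain ⟨-, u, hu, hux⟩ := hx
    exact .inl ⟨hxC, u, hDC hu, hux⟩

theorem ncard_nbhd_component_le [Finite V] (hN : ∀ v, {C ∈ maxChips G k S | v ∈ C}.ncard ≤ N)
    (D : (G.induce (chipBag G k S)ᶜ).ConnectedComponent) :
    (nbhd G (Subtype.val '' D.supp)).ncard ≤ 3 * k * (3 * k * N + 1) := by
  induction D using SimpleGraph.ConnectedComponent.ind with | h d =>
  obtain ⟨d, hd⟩ := d
  obtain ⟨C, hC, hdC⟩ := exists_maxChip_of_notMem_chipBag hd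
  have hNC : (nbhd G C).ncard ≤ 3 * k := hC.1.2.1
  rw [image_supp_eq_reach hd]
  calc (nbhd G (reach G (chipBag G k S) {d})).ncard
      ≤ (nbhd G C ∪ chipNbhds G k S (nbhd G C)).ncard :=
        Set.ncard_le_ncard (nbhd_component_subset hC hdC hd)
    _ ≤ (nbhd G C).ncard + (chipNbhds G k S (nbhd G C)).ncard := Set.ncard_union_le _ _
    _ ≤ 3 * k + 3 * k * N * (3 * k) :=
        Nat.add_le_add hNC ((ncard_chipNbhds_le hN _).trans (by gcongr))
    _ = 3 * k * (3 * k * N + 1) := by ring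

variable {X Y : Set V}

theorem IsSeparation.symm (h : IsSeparation G X Y) : IsSeparation G Y X :=
  ⟨by rw [Set.union_comm, h.1], fun x hx y hy hxy => h.2 y hy x hx hxy.symm⟩

theorem IsSeparation.nbhd_sdiff_subset (h : IsSeparation G X Y) (S : Set V) :
    nbhd G ((X \ Y) \ S) ⊆ (X ∩ Y) ∪ ((X \ Y) ∩ S) := by
  rintro w ⟨hw, u, hu, huw⟩
  have hwXY : w ∈ X ∪ Y := h.1.symm ▸ Set.mem_univ w
  have hwX : w ∈ X := by
    by_contra hwX
    exact h.2 u hu.1 w ⟨hwXY.resolve_left hwX, hwX⟩ huw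
  by_cases hwY : w ∈ Y
  · exact .inl ⟨hwX, hwY⟩
  · exact .inr ⟨⟨hwX, hwY⟩, by_contra fun hwS => hw ⟨⟨hwX, hwY⟩, hwS⟩⟩

theorem IsSeparation.mem_chipNbhds [Finite V] (hXY : IsSeparation G X Y) (hk : (X ∩ Y).ncard ≤ k)
    (hS : ((X \ Y) ∩ S).ncard ≤ 2 * k) (hvXY : v ∈ X \ Y) (hvS : v ∉ S)
    (hv : v ∈ chipBag G k S) : v ∈ chipNbhds G k S (X ∩ Y) := by
  set K := reach G ((X \ Y) \ S)ᶜ {v}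
  have hvR : v ∉ ((X \ Y) \ S)ᶜ := not_not.2 ⟨hvXY, hvS⟩
  have hvK : v ∈ K := mem_reach_self hvR
  have hNK : nbhd G K ⊆ (X ∩ Y) ∪ ((X \ Y) ∩ S) :=
    nbhd_reach_compl_subset.trans (hXY.nbhd_sdiff_subset S)
  have hK : IsPrechip G S (3 * k) K := by
    refine ⟨connected_induce_reach hvR, ?_, ?_⟩
    · exact Set.disjoint_left.2 fun u hu => (not_not.1 (reach_subset_compl hu)).2
    · calc (nbhd G K).ncard ≤ (X ∩ Y).ncard + ((X \ Y) ∩ S).ncard :=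
            (Set.ncard_le_ncard hNK).trans (Set.ncard_union_le _ _)
        _ ≤ 3 * k := by omega
  obtain ⟨C, hKC, hC⟩ := hK.exists_maximal
  obtain ⟨C', hC', hvC'⟩ := exists_mem_nbhd_of_mem_chipBag hv (mem_maxChips_iff.2 hC) (hKC hvK)
  obtain ⟨u, huK, huC'⟩ :=
    nbhd_inter_nonempty_symm (mem_maxChips_iff.1 hC') hK ⟨v, hvC', hvK⟩
  have hu : u ∈ X ∩ Y := (hNK huK).resolve_right fun h =>
    Set.disjoint_left.1 hC'.1.isPrechip.disjoint huC' h.2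
  exact LocalDecomp.mem_chipNbhds hC' ⟨u, huC', hu⟩ hvC'

theorem IsSeparation.ncard_side_le [Finite V]
    (hN : ∀ v, {C ∈ maxChips G k S | v ∈ C}.ncard ≤ N) (hXY : IsSeparation G X Y)
    (hk : (X ∩ Y).ncard ≤ k) (hS : ((X \ Y) ∩ S).ncard ≤ 2 * k) :
    ((X \ Y) ∩ chipBag G k S).ncard ≤ k * N * (3 * k) + 2 * k := by
  have hsub : (X \ Y) ∩ chipBag G k S ⊆ chipNbhds G k S (X ∩ Y) ∪ ((X \ Y) ∩ S) := by
    rintro v ⟨hvXY, hv⟩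
    by_cases hvS : v ∈ S
    · exact .inr ⟨hvXY, hvS⟩
    · exact .inl (hXY.mem_chipNbhds hk hS hvXY hvS hv)
  calc ((X \ Y) ∩ chipBag G k S).ncard
      ≤ (chipNbhds G k S (X ∩ Y)).ncard + ((X \ Y) ∩ S).ncard :=
        (Set.ncard_le_ncard hsub).trans (Set.ncard_union_le _ _)
    _ ≤ k * N * (3 * k) + 2 * k :=
        Nat.add_le_add ((ncard_chipNbhds_le hN _).trans (by gcongr)) hS

theorem isUnbreakable_chipBag [Finite V] (hN : ∀ v, {C ∈ maxChips G k S | v ∈ C}.ncard ≤ N)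
    (hS : IsUnbreakable G (2 * k) k S) :
    IsUnbreakable G (k * N * (3 * k) + 2 * k) k (chipBag G k S) := by
  intro X Y hXY hk
  exact (hS X Y hXY hk).imp (hXY.ncard_side_le hN hk)
    (hXY.symm.ncard_side_le hN (by rwa [Set.inter_comm]))

theorem IsUnbreakable.mono {A : Set V} {q q' : ℕ} (h : IsUnbreakable G q k A) (hq : q ≤ q') :
    IsUnbreakable G q' k A :=
  fun X Y hXY hk => (h X Y hXY hk).imp (fun h => h.trans hq) fun h => h.trans hq

theorem le_tau (k : ℕ) : k * 4 ^ (3 * k) * (3 * k) + 2 * k ≤ tau k := by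
  have h_pow : 4 ^ (3 * k) ≤ 8 ^ (3 * k) := Nat.pow_le_pow_left (by omega) _
  calc k * 4 ^ (3 * k) * (3 * k) + 2 * k ≤ k * 8 ^ (3 * k) * (9 * k) + 2 * k := by gcongr; omega
    _ = tau k := by
      rw [tau]
      ring

end Chips

section FurthestCut

variable {V : Type*} {G : SimpleGraph V} {S Z T R R' C : Set V} {p l : ℕ}

/-- `R` is the side of `Z` in a cut between `Z` and `T`, the cut being `N(R)`. -/
structure IsSide (G : SimpleGraph V) (Z T R : Set V) : Prop where
  subset : Z ⊆ R
  disjoint : Disjoint R T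
  connected : (G.induce R).Connected

theorem isSide_reach {v : V} (hZ : (G.induce Z).Connected) (hv : v ∈ Z) (hZR : Z ⊆ R)
    (hRT : Disjoint R T) : IsSide G Z T (reach G Rᶜ {v}) where
  subset := subset_reach hZ hv (Set.disjoint_compl_right_iff_subset.2 hZR)
  disjoint := hRT.mono_left (reach_subset_compl.trans (compl_compl R).subset)
  connected := connected_induce_reach (not_not.2 (hZR hv))

theorem IsSide.union (hZ : Z.Nonempty) (h : IsSide G Z T R) (h' : IsSide G Z T R') :
    IsSide G Z T (R ∪ R') where
  subset := h.subset.trans Set.subset_union_left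
  disjoint := h.disjoint.union_left h'.disjoint
  connected := SimpleGraph.induce_union_connected h.connected.preconnected
    h'.connected.preconnected
    (hZ.mono (Set.subset_inter h.subset h'.subset))

theorem le_ncard_nbhd_of_isSide [Finite V] (hZ : (G.induce Z).Connected)
    (h : ∀ R, IsSide G Z T R → l ≤ (nbhd G R).ncard) (hZR : Z ⊆ R) (hRT : Disjoint R T) :
    l ≤ (nbhd G R).ncard := by
  obtain ⟨⟨v, hv⟩⟩ := hZ.nonempty
  exact (h _ (isSide_reach hZ hv hZR hRT)).trans (Set.ncard_le_ncard nbhd_reach_compl_subset)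

/-- `R` is the furthest minimum cut between `Z` and `T`: the largest of the sides with the fewest
neighbours. -/
structure IsFurthestCut (G : SimpleGraph V) (Z T R : Set V) : Prop extends IsSide G Z T R where
  ncard_nbhd_le : ∀ ⦃R'⦄, IsSide G Z T R' → (nbhd G R).ncard ≤ (nbhd G R').ncard
  subset_of_ncard_nbhd_le : ∀ ⦃R'⦄, IsSide G Z T R' → (nbhd G R').ncard ≤ (nbhd G R).ncard → R' ⊆ R

theorem IsFurthestCut.unique (h : IsFurthestCut G Z T R) (h' : IsFurthestCut G Z T R') : R = R' :=
  (h'.subset_of_ncard_nbhd_le h.toIsSide (h.ncard_nbhd_le h'.toIsSide)).antisymm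
    (h.subset_of_ncard_nbhd_le h'.toIsSide (h'.ncard_nbhd_le h.toIsSide))

theorem exists_isFurthestCut [Finite V] (hZ : (G.induce Z).Connected) (hZT : Disjoint Z T) :
    ∃ R, IsFurthestCut G Z T R := by
  obtain ⟨R₀, hR₀, hmin⟩ := Set.exists_min_image {R | IsSide G Z T R} (fun R => (nbhd G R).ncard)
    (Set.toFinite _) ⟨Z, subset_rfl, hZT, hZ⟩
  obtain ⟨R, -, ⟨hR, hRmin⟩, hRmax⟩ :=
    (Set.toFinite {R | IsSide G Z T R ∧ (nbhd G R).ncard ≤ (nbhd G R₀).ncard}).exists_le_maximal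
      ⟨hR₀, le_rfl⟩
  refine ⟨R, hR, fun R' hR' => hRmin.trans (hmin R' hR'), fun R' hR' hle => ?_⟩
  have h_inter := le_ncard_nbhd_of_isSide hZ hmin (Set.subset_inter hR.subset hR'.subset)
    (hR.disjoint.mono_left Set.inter_subset_left)
  have h_submod := ncard_nbhd_union_add_ncard_nbhd_inter_le (G := G) R R'
  have h_union := hR.union (Set.nonempty_coe_sort.1 hZ.nonempty) hR'
  exact Set.subset_union_right.trans (hRmax ⟨h_union, by omega⟩ Set.subset_union_left)

theorem IsFurthestCut.lt_ncard_nbhd {x : V} (h : IsFurthestCut G Z T R) (hx : x ∈ nbhd G R)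
    (hR' : IsSide G (insert x R) T R') : (nbhd G R).ncard < (nbhd G R').ncard := by
  by_contra! hle
  have hxR' : x ∈ R' := hR'.subset (Set.mem_insert _ _)
  refine hx.1 (h.subset_of_ncard_nbhd_le ?_ hle hxR')
  exact ⟨h.subset.trans ((Set.subset_insert _ _).trans hR'.subset), hR'.disjoint, hR'.connected⟩

theorem IsFurthestCut.subset_of_maximal [Finite V] (h : IsFurthestCut G Z T R)
    (hZ : (G.induce Z).Connected) (hST : S ⊆ T) (hC : Maximal (IsPrechip G S p) C) (hZC : Z ⊆ C)
    (hCT : Disjoint C T) : R ⊆ C := by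
  have hCside : IsSide G Z T C := ⟨hZC, hCT, hC.1.connected⟩
  have h_inter := le_ncard_nbhd_of_isSide hZ h.ncard_nbhd_le
    (Set.subset_inter h.subset hZC) (hCT.mono_left Set.inter_subset_right)
  have h_submod := ncard_nbhd_union_add_ncard_nbhd_inter_le (G := G) R C
  have h_union := h.toIsSide.union (Set.nonempty_coe_sort.1 hZ.nonempty) hCside
  have hRC : IsPrechip G S p (R ∪ C) :=
    ⟨h_union.connected, h_union.disjoint.mono_right hST, by have := hC.1.ncard_nbhd_le; omega⟩
  exact Set.subset_union_left.trans (hC.2 hRC Set.subset_union_right)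

theorem IsFurthestCut.eq_of_nbhd_subset [Finite V] (h : IsFurthestCut G Z T R)
    (hZ : (G.induce Z).Connected) (hST : S ⊆ T) (hC : Maximal (IsPrechip G S p) C) (hZC : Z ⊆ C)
    (hCT : Disjoint C T) (hN : nbhd G R ⊆ T) : R = C :=
  (h.subset_of_maximal hZ hST hC hZC hCT).antisymm <|
    subset_of_disjoint_nbhd hC.1.connected
      ((Set.nonempty_coe_sort.1 hZ.nonempty).mono (Set.subset_inter hZC h.subset))
      (hCT.mono_right hN)

open Classical in
/-- The furthest minimum cut between `Z` and `T` (the whole vertex set if there is none). -/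
noncomputable def furthestCut (G : SimpleGraph V) (Z T : Set V) : Set V :=
  if h : ∃ R, IsFurthestCut G Z T R then h.choose else Set.univ

theorem IsFurthestCut.furthestCut_eq (h : IsFurthestCut G Z T R) : furthestCut G Z T = R := by
  have hex : ∃ R, IsFurthestCut G Z T R := ⟨R, h⟩
  rw [furthestCut, dif_pos hex]
  exact hex.choose_spec.unique h

end FurthestCut

section Branch

variable {n : ℕ} {G : SimpleGraph (Fin n)} {p L r : ℕ} {S Z T R C : Set (Fin n)} {x : Fin n}

open Classical in
/-- The leaf with number `r < 2 ^ L` of the search tree for the prechips that contain `Z` and avoid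
`T`. As long as the furthest minimum cut `R` has a neighbour outside `T`, the search branches on the
largest such vertex, which joins `R` or `T` according to the leading binary digit of `r`. -/
noncomputable def branch (G : SimpleGraph (Fin n)) (p : ℕ) :
    ℕ → ℕ → Set (Fin n) → Set (Fin n) → Option (Set (Fin n))
  | 0, _, Z, T =>
    if (nbhd G (furthestCut G Z T)).ncard ≤ p ∧ nbhd G (furthestCut G Z T) ⊆ T then
      some (furthestCut G Z T)
    else none
  | L + 1, r, Z, T =>
    if (nbhd G (furthestCut G Z T)).ncard ≤ p then
      if h : ∃ x, IsGreatest (nbhd G (furthestCut G Z T) \ T) x then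
        if 2 ^ L ≤ r then branch G p L (r - 2 ^ L) (insert h.choose (furthestCut G Z T)) T
        else branch G p L r (furthestCut G Z T) (insert h.choose T)
      else some (furthestCut G Z T)
    else none

theorem branch_of_lt (hR : IsFurthestCut G Z T R) (h : p < (nbhd G R).ncard) :
    branch G p L r Z T = none := by
  cases L with
  | zero => rw [branch, hR.furthestCut_eq, if_neg fun h' => absurd h'.1 (not_le.2 h)]
  | succ L => rw [branch, hR.furthestCut_eq, if_neg (not_le.2 h)]

theorem branch_of_subset (hR : IsFurthestCut G Z T R) (hp : (nbhd G R).ncard ≤ p)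
    (h : nbhd G R ⊆ T) : branch G p L r Z T = some R := by
  cases L with
  | zero => rw [branch, hR.furthestCut_eq, if_pos ⟨hp, h⟩]
  | succ L =>
    rw [branch, hR.furthestCut_eq, if_pos hp, dif_neg]
    exact fun ⟨x, hx, _⟩ => hx.2 (h hx.1)

theorem branch_zero_of_mem (hR : IsFurthestCut G Z T R) (hx : x ∈ nbhd G R \ T) :
    branch G p 0 r Z T = none := by
  rw [branch, hR.furthestCut_eq, if_neg fun h => hx.2 (h.2 hx.1)]

theorem branch_succ (hR : IsFurthestCut G Z T R) (hp : (nbhd G R).ncard ≤ p)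
    (hx : IsGreatest (nbhd G R \ T) x) : branch G p (L + 1) r Z T =
      if 2 ^ L ≤ r then branch G p L (r - 2 ^ L) (insert x R) T
      else branch G p L r R (insert x T) := by
  have hex : ∃ x, IsGreatest (nbhd G R \ T) x := ⟨x, hx⟩
  have h : hex.choose = x := hex.choose_spec.unique hx
  rw [branch, hR.furthestCut_eq, if_pos hp, dif_pos hex, h]

theorem exists_isGreatest {A : Set (Fin n)} (hA : A.Nonempty) : ∃ x, IsGreatest A x := by
  obtain ⟨x, hx, hmax⟩ := Set.exists_max_image A id (Set.toFinite _) hA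
  exact ⟨x, hx, hmax⟩

theorem isPrechip_of_branch_eq_some {L r : ℕ} {Z T : Set (Fin n)}
    (hZ : (G.induce Z).Connected) (hZT : Disjoint Z T)
    (h : branch G p L r Z T = some C) : Z ⊆ C ∧ IsPrechip G T p C := by
  obtain ⟨R, hR⟩ := exists_isFurthestCut hZ hZT
  rcases lt_or_ge p (nbhd G R).ncard with hp | hp
  · simp [branch_of_lt hR hp] at h
  rcases (nbhd G R \ T).eq_empty_or_nonempty with hN | hN
  · rw [branch_of_subset hR hp (Set.sdiff_eq_empty.1 hN), Option.some_inj] at h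
    exact h ▸ ⟨hR.subset, hR.connected, hR.disjoint, hp⟩
  obtain ⟨x, hx⟩ := exists_isGreatest hN
  cases L with
  | zero => simp [branch_zero_of_mem hR hx.1] at h
  | succ L =>
    rw [branch_succ hR hp hx] at h
    split at h
    · obtain ⟨hsub, hC⟩ := isPrechip_of_branch_eq_some (connected_induce_insert hR.connected hx.1.1)
        (Set.disjoint_insert_left.2 ⟨hx.1.2, hR.disjoint⟩) h
      exact ⟨hR.subset.trans ((Set.subset_insert _ _).trans hsub), hC⟩
    · obtain ⟨hsub, hC⟩ := isPrechip_of_branch_eq_some hR.connected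
        (Set.disjoint_insert_right.2 ⟨hx.1.1.1, hR.disjoint⟩) h
      exact ⟨hR.subset.trans hsub, hC.connected, hC.disjoint.mono_right (Set.subset_insert _ _),
        hC.ncard_nbhd_le⟩

theorem subset_nbhd_of_disjoint {V : Type*} {G : SimpleGraph V} {Z R W : Set V} (hZR : Z ⊆ R)
    (hRW : Disjoint R W) (hW : W ⊆ nbhd G Z) : W ⊆ nbhd G R := fun _ hw =>
  have ⟨_, u, hu, huw⟩ := hW hw
  ⟨Set.disjoint_right.1 hRW hw, u, hZR hu, huw⟩

/-- The size of `W` and the bound `l` are at most `p`, and each branching raises one of them. -/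
theorem exists_branch_eq_some_of_le {L : ℕ} {Z W : Set (Fin n)}
    (hC : Maximal (IsPrechip G S p) C) (l : ℕ) (hZ : (G.induce Z).Connected) (hZC : Z ⊆ C)
    (hW : W ⊆ nbhd G Z) (hWS : Disjoint W S)
    (hCW : Disjoint C W) (hl : ∀ R, IsSide G Z (S ∪ W) R → l ≤ (nbhd G R).ncard)
    (hL : 2 * p ≤ L + l + W.ncard) : ∃ r < 2 ^ L, branch G p L r Z (S ∪ W) = some C := by
  have hCT : Disjoint C (S ∪ W) := hC.1.disjoint.union_right hCW
  obtain ⟨R, hR⟩ := exists_isFurthestCut hZ (hCT.mono_left hZC)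
  have hRC := hR.subset_of_maximal hZ Set.subset_union_left hC hZC hCT
  have hp : (nbhd G R).ncard ≤ p :=
    (hR.ncard_nbhd_le ⟨hZC, hCT, hC.1.connected⟩).trans hC.1.ncard_nbhd_le
  have hWR : W ⊆ nbhd G R := subset_nbhd_of_disjoint hR.subset (hCW.mono_left hRC) hW
  have hlR := hl R hR.toIsSide
  rcases (nbhd G R \ (S ∪ W)).eq_empty_or_nonempty with hN | hN
  · rw [Set.sdiff_eq_empty] at hN
    refine ⟨0, by positivity, ?_⟩
    rw [branch_of_subset hR hp hN, hR.eq_of_nbhd_subset hZ Set.subset_union_left hC hZC hCT hN]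
  obtain ⟨x, hx⟩ := exists_isGreatest hN
  have ⟨⟨hxN, hxT⟩, _⟩ := hx
  have hxW : x ∉ W := fun h => hxT (.inr h)
  cases L with
  | zero =>
    have := Set.ncard_lt_ncard (hWR.ssubset_of_mem_notMem hxN hxW)
    omega
  | succ L =>
    by_cases hxC : x ∈ C
    · have hins : insert x R ⊆ C := Set.insert_subset hxC hRC
      obtain ⟨r, hr, hrC⟩ := exists_branch_eq_some_of_le hC _
        (connected_induce_insert hR.connected hxN) hins
        (subset_nbhd_of_disjoint (Set.subset_insert _ _) (hCW.mono_left hins) hWR) hWS hCW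
        (fun R' hR' => hR.lt_ncard_nbhd hxN hR') (L := L) (by omega)
      refine ⟨r + 2 ^ L, by rw [pow_succ]; omega, ?_⟩
      rw [branch_succ hR hp hx, if_pos (by omega), Nat.add_sub_cancel, hrC]
    · have hcut : ∀ R', IsSide G R (S ∪ insert x W) R' → l ≤ (nbhd G R').ncard := fun R' hR' =>
        hl R' ⟨hR.subset.trans hR'.subset, hR'.disjoint.mono_right
          (Set.union_subset_union_right _ (Set.subset_insert _ _)), hR'.connected⟩
      obtain ⟨r, hr, hrC⟩ := exists_branch_eq_some_of_le hC l hR.connected hRC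
        (Set.insert_subset hxN hWR)
        (Set.disjoint_insert_left.2 ⟨fun h => hxT (.inl h), hWS⟩)
        (Set.disjoint_insert_right.2 ⟨hxC, hCW⟩) hcut (L := L)
        (by rw [Set.ncard_insert_of_notMem hxW]; omega)
      refine ⟨r, by rw [pow_succ]; omega, ?_⟩
      rw [branch_succ hR hp hx, if_neg (by omega), ← Set.union_insert, hrC]

theorem exists_branch_eq_some (hC : Maximal (IsPrechip G S p) C) (hx : x ∈ C) :
    ∃ r < 2 ^ (2 * p), branch G p (2 * p) r {x} S = some C := by
  have := exists_branch_eq_some_of_le (L := 2 * p) (W := ∅) hC 0 (Z := {x})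
    (SimpleGraph.Connected.mk .of_subsingleton) (Set.singleton_subset_iff.2 hx)
    (Set.empty_subset _) (Set.empty_disjoint _) (Set.disjoint_empty _) (fun _ _ => Nat.zero_le _)
    (by simp)
  simpa using this

theorem ncard_maxChips_mem_le (G : SimpleGraph (Fin n)) (k : ℕ) (S : Set (Fin n)) (v : Fin n) :
    {C ∈ maxChips G k S | v ∈ C}.ncard ≤ 4 ^ (3 * k) := by
  have hsub : {C ∈ maxChips G k S | v ∈ C} ⊆
      (fun r => (branch G (3 * k) (2 * (3 * k)) r {v} S).getD ∅) ''
        (Finset.range (2 ^ (2 * (3 * k))) : Set ℕ) := by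
    rintro C ⟨hC, hv⟩
    obtain ⟨r, hr, hrC⟩ := exists_branch_eq_some (mem_maxChips_iff.1 hC) hv
    exact ⟨r, by simpa using hr, by simp [hrC]⟩
  calc _ ≤ _ := Set.ncard_le_ncard hsub
    _ ≤ _ := Set.ncard_image_le
    _ = 4 ^ (3 * k) := by rw [Set.ncard_coe_finset, Finset.card_range, pow_mul]; norm_num

end Branch

section Flow

variable {V : Type*} {G : SimpleGraph V} {Z T R : Set V} {q : V → Option V} {u v w x y : V}

/-- A system of disjoint paths from `T` to the neighbourhood of `Z`, coded as a matching: `q u` is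
the predecessor of `u` on its path, undefined if `u` is the first vertex, and `q u = u` if `u` is on
no path. The vertices that are not values of `q` are the last vertices of the paths. -/
structure IsFlow (G : SimpleGraph V) (Z T : Set V) (q : V → Option V) : Prop where
  inj : ∀ ⦃u u' w⦄, q u = some w → q u' = some w → u = u'
  edge : ∀ ⦃u w⦄, q u = some w → u = w ∨ G.Adj w u
  none_mem : ∀ ⦃u⦄, q u = none → u ∈ T
  cover : ∀ ⦃w⦄, (∀ u, q u ≠ some w) → w ∈ nbhd G Z
  fixed : ∀ z ∈ Z, q z = some z

theorem isFlow_some : IsFlow G Z T some where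
  inj := by rintro u u' w ⟨⟩ ⟨⟩; rfl
  edge := by rintro u w ⟨⟩; exact .inl rfl
  none_mem := by simp
  cover w h := absurd rfl (h w)
  fixed _ _ := rfl

/-- One step of the search for an augmenting path. -/
def Step (G : SimpleGraph V) (Z : Set V) (q : V → Option V) (u x : V) : Prop :=
  x ∉ Z ∧ ∃ w, q u = some w ∧ (x = w ∨ G.Adj w x)

/-- The vertices found by the search for an augmenting path. -/
def residualReach (G : SimpleGraph V) (Z T : Set V) (q : V → Option V) : Set V :=
  {x | ∃ t ∈ T, Relation.ReflTransGen (Step G Z q) t x}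

theorem subset_residualReach : T ⊆ residualReach G Z T q := fun t ht => ⟨t, ht, .refl⟩

theorem mem_residualReach_of_step (hu : u ∈ residualReach G Z T q) (hux : Step G Z q u x) :
    x ∈ residualReach G Z T q := by
  obtain ⟨t, ht, htu⟩ := hu
  exact ⟨t, ht, htu.tail hux⟩

theorem residualReach_subset (hT : T ⊆ R) (hR : ∀ u ∈ R, ∀ x, Step G Z q u x → x ∈ R) :
    residualReach G Z T q ⊆ R := by
  rintro x ⟨t, ht, htx⟩
  induction htx with
  | refl => exact hT ht
  | tail _ hux hu => exact hR _ hu _ hux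

theorem disjoint_residualReach (hZT : Disjoint Z T) : Disjoint Z (residualReach G Z T q) :=
  disjoint_compl_right.mono_right <|
    residualReach_subset hZT.subset_compl_left fun _ _ _ h => h.1

/-- Every vertex beyond `N[R]` has a successor, which is outside `R`; the remaining vertices outside
`R` are thus as many as the vertices of `N(R)`. -/
theorem IsFlow.ncard_leaving [Finite V] (h : IsFlow G Z T q) (hZR : Z ⊆ R) :
    {u ∈ Rᶜ | ∀ w, q u = some w → w ∈ R ∪ nbhd G R}.ncard = (nbhd G R).ncard := by
  set leaving := {u ∈ Rᶜ | ∀ w, q u = some w → w ∈ R ∪ nbhd G R}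
  have h_leaving : leaving ⊆ Rᶜ := Set.sep_subset _ _
  have h_nbhd : nbhd G R ⊆ Rᶜ := disjoint_nbhd.subset_compl_left
  have h_image : q '' (Rᶜ \ leaving) = some '' (Rᶜ \ nbhd G R) := by
    ext o
    constructor
    · rintro ⟨u, ⟨huR, hu⟩, rfl⟩
      obtain ⟨w, hw, hwR⟩ : ∃ w, q u = some w ∧ w ∉ R ∪ nbhd G R := by
        by_contra! hno
        exact hu ⟨huR, hno⟩
      exact ⟨w, ⟨fun h => hwR (.inl h), fun h => hwR (.inr h)⟩, hw.symm⟩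
    · rintro ⟨w, ⟨hwR, hwN⟩, rfl⟩
      have h_closed : ∀ r ∈ R, ¬ G.Adj w r := fun r hr hwr => hwN ⟨hwR, r, hr, hwr.symm⟩
      obtain ⟨u, hu⟩ : ∃ u, q u = some w := by
        by_contra! hno
        obtain ⟨-, z, hz, hzw⟩ := h.cover hno
        exact h_closed z (hZR hz) hzw.symm
      have huR : u ∉ R := fun hR =>
        (h.edge hu).elim (fun he => hwR (he ▸ hR)) (h_closed u hR)
      exact ⟨u, ⟨huR, fun hl => (hl.2 w hu).elim hwR hwN⟩, hu⟩
  have h_inj : Set.InjOn q (Rᶜ \ leaving) := by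
    rintro u hu u' - huu'
    have : q u ∈ some '' (Rᶜ \ nbhd G R) := h_image ▸ Set.mem_image_of_mem q hu
    obtain ⟨w, -, hw⟩ := this
    exact h.inj hw.symm (huu' ▸ hw.symm)
  have h_card := congrArg Set.ncard h_image
  rw [h_inj.ncard_image, Set.ncard_image_of_injective _ (Option.some_injective V)] at h_card
  have := Set.ncard_sdiff_add_ncard_of_subset h_leaving
  have := Set.ncard_sdiff_add_ncard_of_subset h_nbhd
  omega

theorem IsFlow.setOf_none_subset_leaving (h : IsFlow G Z T q) (hRT : Disjoint R T) :
    {u | q u = none} ⊆ {u ∈ Rᶜ | ∀ w, q u = some w → w ∈ R ∪ nbhd G R} := fun _ hu =>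
  ⟨fun hR => Set.disjoint_left.1 hRT hR (h.none_mem hu), fun _ hw => nomatch hu.symm.trans hw⟩

theorem IsFlow.ncard_none_le [Finite V] (h : IsFlow G Z T q) (hZR : Z ⊆ R) (hRT : Disjoint R T) :
    {u | q u = none}.ncard ≤ (nbhd G R).ncard :=
  (Set.ncard_le_ncard (h.setOf_none_subset_leaving hRT)).trans_eq (h.ncard_leaving hZR)

theorem IsFlow.residualReach_subset_compl [Finite V] (h : IsFlow G Z T q) (hZR : Z ⊆ R)
    (hRT : Disjoint R T) (hle : (nbhd G R).ncard ≤ {u | q u = none}.ncard) :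
    residualReach G Z T q ⊆ Rᶜ := by
  have h_tight := Set.eq_of_subset_of_ncard_le (h.setOf_none_subset_leaving hRT)
    ((h.ncard_leaving hZR).trans_le hle)
  refine residualReach_subset hRT.subset_compl_left ?_
  rintro u hu x ⟨-, w, hw, hx⟩ hxR
  have hwR : w ∉ R ∪ nbhd G R := fun hwR => by
    have : u ∈ {u | q u = none} :=
      h_tight ▸ ⟨hu, fun w' hw' => Option.some.inj (hw.symm.trans hw') ▸ hwR⟩
    exact nomatch hw.symm.trans this
  rcases hx with rfl | hx
  · exact hwR (.inl hxR)
  · exact hwR (.inr ⟨fun h => hwR (.inl h), x, hxR, hx.symm⟩)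

/-- A search that does not find an augmenting path exhibits a cut as small as the flow. -/
theorem IsFlow.ncard_nbhd_compl_residualReach_le [Finite V] (h : IsFlow G Z T q)
    (hZT : Disjoint Z T) (hstuck : ∀ u ∈ residualReach G Z T q, ∀ w, q u = some w → w ∉ nbhd G Z) :
    (nbhd G (residualReach G Z T q)ᶜ).ncard ≤ {u | q u = none}.ncard := by
  set A := residualReach G Z T q
  set B : Set V := some ⁻¹' (q '' A)
  have hBA : ∀ w ∈ B, ∀ x, (x = w ∨ G.Adj w x) → x ∈ A := by
    rintro w ⟨u, hu, hw⟩ x hx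
    refine mem_residualReach_of_step hu ⟨fun hxZ => ?_, w, hw, hx⟩
    have hwZ : w ∉ Z := fun hwZ => Set.disjoint_left.1 (disjoint_residualReach hZT) hwZ <|
      h.inj hw (h.fixed w hwZ) ▸ hu
    exact hx.elim (fun he => hwZ (he ▸ hxZ)) fun hx => hstuck u hu w hw ⟨hwZ, x, hxZ, hx.symm⟩
  have h_nbhd : nbhd G Aᶜ ⊆ A \ B := by
    rintro x ⟨hx, u, hu, hux⟩
    exact ⟨not_not.1 hx, fun hxB => hu (hBA x hxB u (.inr hux.symm))⟩
  have h_inj : Set.InjOn q (A \ {u | q u = none}) := by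
    rintro u ⟨-, hu⟩ u' - huu'
    obtain ⟨w, hw⟩ := Option.ne_none_iff_exists'.1 hu
    exact h.inj hw (huu' ▸ hw)
  have h_image : q '' (A \ {u | q u = none}) ⊆ some '' B := by
    rintro _ ⟨u, ⟨hu, hne⟩, rfl⟩
    obtain ⟨w, hw⟩ := Option.ne_none_iff_exists'.1 hne
    exact ⟨w, ⟨u, hu, hw⟩, hw.symm⟩
  have h_card := Set.ncard_le_ncard h_image
  rw [h_inj.ncard_image, Set.ncard_image_of_injective _ (Option.some_injective V)] at h_card
  have := Set.ncard_le_ncard h_nbhd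
  have := Set.ncard_sdiff_add_ncard_of_subset fun w hw => hBA w hw w (.inl rfl)
  have := Set.ncard_le_ncard_sdiff_add_ncard A {u | q u = none}
  omega

theorem IsFlow.isFurthestCut [Finite V] (h : IsFlow G Z T q) (hZ : (G.induce Z).Connected)
    (hv : v ∈ Z) (hZT : Disjoint Z T)
    (hstuck : ∀ u ∈ residualReach G Z T q, ∀ w, q u = some w → w ∉ nbhd G Z) :
    IsFurthestCut G Z T (reach G (residualReach G Z T q) {v}) ∧
      (nbhd G (reach G (residualReach G Z T q) {v})).ncard = {u | q u = none}.ncard := by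
  set A := residualReach G Z T q
  have h_disj : Disjoint Z A := disjoint_residualReach hZT
  have h_side : IsSide G Z T (reach G A {v}) := compl_compl A ▸ isSide_reach hZ hv
    h_disj.subset_compl_right (disjoint_compl_left.mono_right subset_residualReach)
  have h_le : (nbhd G (reach G A {v})).ncard ≤ {u | q u = none}.ncard := calc
    _ ≤ (nbhd G Aᶜ).ncard :=
      Set.ncard_le_ncard (by simpa only [compl_compl] using nbhd_reach_compl_subset (R := Aᶜ))
    _ ≤ _ := h.ncard_nbhd_compl_residualReach_le hZT hstuck
  refine ⟨⟨h_side, fun R' hR' => ?_, fun R' hR' hle => ?_⟩, h_le.antisymm ?_⟩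
  · exact h_le.trans (h.ncard_none_le hR'.subset hR'.disjoint)
  · have h_compl := h.residualReach_subset_compl hR'.subset hR'.disjoint (hle.trans h_le)
    exact subset_reach hR'.connected (hR'.subset hv)
      (Set.subset_compl_iff_disjoint_left.1 h_compl)
  · exact h.ncard_none_le h_side.subset h_side.disjoint

variable [DecidableEq V]

/-- Augmenting a flow starts by opening a gap at `y`, which then moves towards `T`; a gap at `y` is
coded as an additional terminal. -/
theorem IsFlow.remove (h : IsFlow G Z T q) (hw : q y = some w) (hN : w ∈ nbhd G Z) (hy : y ∉ Z) :
    IsFlow G Z (insert y T) (Function.update q y none) := by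
  have h_some {u w} : Function.update q y none u = some w → q u = some w := by
    rw [Function.update_apply]
    split <;> simp
  refine ⟨fun u u' w h1 h2 => h.inj (h_some h1) (h_some h2), fun u w h1 => h.edge (h_some h1),
    fun u hu => ?_, fun w' hw' => ?_, fun z hz => ?_⟩
  · rw [Function.update_apply] at hu
    split at hu
    · next he => exact .inl he
    · exact .inr (h.none_mem hu)
  · by_cases hww : w' = w
    · exact hww ▸ hN
    · refine h.cover fun u hu => hw' u ?_
      rwa [Function.update_of_ne]
      rintro rfl
      exact hww (Option.some.inj (hu.symm.trans hw))
  · rw [Function.update_of_ne (ne_of_mem_of_not_mem hz hy), h.fixed z hz]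

theorem IsFlow.swap {x' : V} (h : IsFlow G Z (insert x T) q) (hx : q x = none)
    (hx' : x' ∉ Z) (hstep : Step G Z q x' x) :
    IsFlow G Z (insert x' T) (q ∘ Equiv.swap x x') := by
  obtain ⟨hxZ, w', hw', hs⟩ := hstep
  refine ⟨fun u u' w h1 h2 => (Equiv.swap x x').injective (h.inj h1 h2), fun u w hu => ?_,
    fun u hu => ?_, fun w hw => ?_, fun z hz => ?_⟩
  · rw [Function.comp, Equiv.swap_apply_def] at hu
    split_ifs at hu with hux hux'
    · exact Option.some.inj (hw'.symm.trans hu) ▸ hux ▸ hs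
    · exact nomatch hx.symm.trans hu
    · exact h.edge hu
  · rw [Function.comp, Equiv.swap_apply_def] at hu
    split_ifs at hu with hux hux'
    · exact nomatch hw'.symm.trans hu
    · exact .inl hux'
    · exact .inr ((h.none_mem hu).resolve_left hux)
  · exact h.cover fun u hu => hw (Equiv.swap x x' u) (by simpa using hu)
  · rw [Function.comp, Equiv.swap_apply_of_ne_of_ne (ne_of_mem_of_not_mem hz hxZ)
      (ne_of_mem_of_not_mem hz hx'), h.fixed z hz]

theorem ncard_none_update [Finite V] (hw : q y = some w) :
    {u | Function.update q y none u = none}.ncard = {u | q u = none}.ncard + 1 := by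
  have : {u | Function.update q y none u = none} = insert y {u | q u = none} := by
    ext u
    by_cases h : u = y <;> simp [h, Function.update_apply]
  rw [this, Set.ncard_insert_of_notMem (by simp [hw])]

theorem ncard_none_swap (x x' : V) :
    {u | (q ∘ Equiv.swap x x') u = none}.ncard = {u | q u = none}.ncard :=
  Set.ncard_preimage_of_injective_subset_range (s := {u | q u = none})
    (Equiv.swap x x').injective (by simp)

end Flow

local infixr:60 " ⨾ " => Prog.seq

section Logic

/-- `p` started in `σ` halts within `T` steps in a memory that satisfies `Q`. -/
def Runs (p : Prog) (σ : Store) (T : ℕ) (Q : Store → Prop) : Prop :=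
  ∃ t τ, Exec p σ t τ ∧ t ≤ T ∧ Q τ

/-- The arrays a program writes to. -/
def Prog.mods : Prog → List ℕ
  | .skip => []
  | .assign a _ _ => [a]
  | .seq p q => p.mods ++ q.mods
  | .cond _ p q => p.mods ++ q.mods
  | .loop _ p => p.mods

/-- The memories `σ` and `σ'` differ at most in arrays that `p` writes to. -/
def Frame (p : Prog) (σ σ' : Store) : Prop := ∀ a ∉ p.mods, σ' a = σ a

variable {p q : Prog} {b : Expr} {σ σ' σ'' : Store} {T T' : ℕ} {Q Q' : Store → Prop}

theorem Frame.eq (h : Frame p σ σ') (a : ℕ) (ha : p.mods.contains a = false := by rfl) :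
    σ' a = σ a :=
  h a (by simpa using ha)

theorem Frame.trans (h : Frame p σ σ') (h' : Frame p σ' σ'') : Frame p σ σ'' :=
  fun a ha => (h' a ha).trans (h a ha)

theorem Frame.of_subset (h : Frame p σ σ') (hpq : p.mods ⊆ q.mods) : Frame q σ σ' :=
  fun a ha => h a fun ha' => ha (hpq ha')

@[simp]
theorem Store.write_same (σ : Store) (a i x : ℕ) :
    σ.write a i x a = Function.update (σ a) i x := by
  simp [Store.write]

@[simp]
theorem Store.write_ne (σ : Store) {a c : ℕ} (i x : ℕ) (h : c ≠ a) : σ.write a i x c = σ c := by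
  simp [Store.write, h]

theorem Exec.frame {t : ℕ} (h : Exec p σ t σ') : Frame p σ σ' := by
  intro a ha
  induction h with
  | skip => rfl
  | assign => exact Store.write_ne _ _ _ (List.ne_of_not_mem_cons ha)
  | seq _ _ ih1 ih2 =>
    rw [Prog.mods, List.mem_append, not_or] at ha
    rw [ih2 ha.2, ih1 ha.1]
  | cond_true _ _ ih => exact ih fun h => ha (List.mem_append_left _ h)
  | cond_false _ _ ih => exact ih fun h => ha (List.mem_append_right _ h)
  | loop_done => rfl
  | loop_step _ _ _ ih1 ih2 => rw [ih2 ha, ih1 ha]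

theorem Runs.mono (h : Runs p σ T Q) (hT : T ≤ T') (hQ : ∀ σ', Q σ' → Q' σ') :
    Runs p σ T' Q' :=
  have ⟨t, σ', he, ht, hq⟩ := h
  ⟨t, σ', he, ht.trans hT, hQ σ' hq⟩

theorem Runs.frame (h : Runs p σ T Q) : Runs p σ T fun σ' => Frame p σ σ' ∧ Q σ' :=
  have ⟨t, σ', he, ht, hq⟩ := h
  ⟨t, σ', he, ht, he.frame, hq⟩

theorem Runs.imp (h : Runs p σ T Q) (hT : T ≤ T') (hQ : ∀ σ', Frame p σ σ' → Q σ' → Q' σ') :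
    Runs p σ T' Q' :=
  h.frame.mono hT fun σ' h' => hQ σ' h'.1 h'.2

theorem Runs.seq (hp : Runs p σ T Q) (hq : ∀ σ', Frame p σ σ' → Q σ' → Runs q σ' T' Q') :
    Runs (p ⨾ q) σ (T + T') Q' := by
  obtain ⟨t, σ', he, ht, h⟩ := hp
  obtain ⟨t', σ'', he', ht', h'⟩ := hq σ' he.frame h
  exact ⟨t + t', σ'', .seq he he', Nat.add_le_add ht ht', h'⟩

theorem Runs.cond (hp : b.eval σ ≠ 0 → Runs p σ T Q) (hq : b.eval σ = 0 → Runs q σ T' Q) :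
    Runs (.cond b p q) σ (b.cost + 1 + (T + T')) Q := by
  by_cases hb : b.eval σ = 0
  · obtain ⟨t, σ', he, ht, h⟩ := hq hb
    exact ⟨_, σ', .cond_false hb he, by omega, h⟩
  · obtain ⟨t, σ', he, ht, h⟩ := hp hb
    exact ⟨_, σ', .cond_true hb he, by omega, h⟩

/-- The running time of the loop is paid for by the potential `φ`. -/
theorem Runs.loop {I : Store → Prop} {φ : Store → ℕ} (h0 : I σ)
    (hs : ∀ σ', Frame p σ σ' → I σ' → b.eval σ' ≠ 0 →
      ∃ T, Runs p σ' T fun σ'' => I σ'' ∧ φ σ'' + T + b.cost + 1 ≤ φ σ') :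
    Runs (.loop b p) σ (φ σ + b.cost + 1) fun σ' => I σ' ∧ b.eval σ' = 0 := by
  induction hφ : φ σ using Nat.strong_induction_on generalizing σ with
  | _ N ih =>
    by_cases hb : b.eval σ = 0
    · exact ⟨_, σ, .loop_done hb, by omega, h0, hb⟩
    · obtain ⟨T, t, σ', he, ht, hI, hle⟩ := hs σ (fun _ _ => rfl) h0 hb
      obtain ⟨t', σ'', he', ht', h_end⟩ :=
        ih (φ σ') (by omega) hI (fun τ hτ => hs τ (he.frame.trans hτ)) rfl
      exact ⟨_, σ'', .loop_step hb he he', by omega, h_end⟩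

/-- Effect of a program without loops. -/
def Prog.act : Prog → Store → Store
  | .skip, σ => σ
  | .assign a i e, σ => σ.write a (i.eval σ) (e.eval σ)
  | .seq p q, σ => q.act (p.act σ)
  | .cond b p q, σ => if b.eval σ ≠ 0 then p.act σ else q.act σ
  | .loop _ _, σ => σ

/-- The program contains no loops. -/
def Prog.isFlat : Prog → Bool
  | .skip => true
  | .assign _ _ _ => true
  | .seq p q => p.isFlat && q.isFlat
  | .cond _ p q => p.isFlat && q.isFlat
  | .loop _ _ => false

/-- Time bound for a program without loops. -/
def Prog.time : Prog → ℕ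
  | .skip => 1
  | .assign _ i e => i.cost + e.cost + 1
  | .seq p q => p.time + q.time
  | .cond b p q => b.cost + 1 + (p.time + q.time)
  | .loop _ _ => 0

theorem runs_act (p : Prog) (h : p.isFlat = true) (σ : Store) :
    Runs p σ p.time fun σ' => σ' = p.act σ := by
  induction p generalizing σ with
  | skip => exact ⟨_, _, .skip σ, le_rfl, rfl⟩
  | assign a i e => exact ⟨_, _, .assign σ a i e, le_rfl, rfl⟩
  | seq p q ihp ihq =>
    rw [Prog.isFlat, Bool.and_eq_true] at h
    refine (ihp h.1 σ).seq fun σ' _ hσ' => ?_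
    rw [hσ']
    exact ihq h.2 _
  | cond b p q ihp ihq =>
    rw [Prog.isFlat, Bool.and_eq_true] at h
    refine .cond (fun hb => ?_) fun hb => ?_
    · simpa [Prog.act, hb] using ihp h.1 σ
    · simpa [Prog.act, hb] using ihq h.2 σ
  | loop => cases h

theorem frame_act (p : Prog) (σ : Store) (h : p.isFlat = true := by rfl) :
    Frame p σ (p.act σ) :=
  have ⟨_, _, _, _, hf, h⟩ := (runs_act p h σ).frame
  h ▸ hf

theorem Runs.flat (hQ : Q (p.act σ)) (h : p.isFlat = true := by rfl)
    (hT : p.time ≤ T := by exact Nat.le_of_ble_eq_true rfl) : Runs p σ T Q :=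
  (runs_act p h σ).mono hT fun _ h => h ▸ hQ

theorem Runs.flat_seq (hq : Runs q (p.act σ) T Q) (h : p.isFlat = true := by rfl) :
    Runs (p ⨾ q) σ (p.time + T) Q :=
  (runs_act p h σ).seq fun _ _ h => h ▸ hq

/-- The content of cell `0` of array `a`. -/
def sc (a : ℕ) : Expr := .get a (.lit 0)

/-- `a[0] := e` -/
def set (a : ℕ) (e : Expr) : Prog := .assign a (.lit 0) e

/-- Negation of a truth value. -/
def Expr.neg (e : Expr) : Expr := .sub (.lit 1) e

/-- Conjunction of truth values. -/
def Expr.both (e f : Expr) : Expr := .sub (.lit 1) (.add e.neg f.neg)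

theorem Expr.eval_neg (e : Expr) : e.neg.eval σ ≠ 0 ↔ e.eval σ = 0 := by
  simp only [Expr.neg, Expr.eval]; omega

theorem Expr.eval_both (e f : Expr) : (e.both f).eval σ ≠ 0 ↔ e.eval σ ≠ 0 ∧ f.eval σ ≠ 0 := by
  simp only [Expr.neg, Expr.both, Expr.eval]; omega

/-- Run `body` with `i[0] = 0, 1, …` as long as `i[0]` is less than `N`. -/
def forTo (i : ℕ) (N : Expr) (body : Prog) : Prog :=
  set i (.lit 0) ⨾ .loop (.sub N (sc i)) (body ⨾ set i (.add (sc i) (.lit 1)))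

theorem Runs.forTo {i m : ℕ} {N : Expr} {body : Prog} {I : ℕ → Store → Prop} {T : ℕ → ℕ}
    (hi : i ∉ body.mods) (hN : ∀ σ', Frame (forTo i N body) σ σ' → N.eval σ' = m)
    (h0 : I 0 (σ.write i 0 0))
    (hs : ∀ j < m, ∀ σ', Frame (LocalDecomp.forTo i N body) σ σ' → σ' i 0 = j → I j σ' →
      Runs body σ' (T j) fun σ'' => I (j + 1) (σ''.write i 0 (j + 1))) :
    Runs (forTo i N body) σ ((∑ j ∈ Finset.range m, (T j + N.cost + 10)) + N.cost + 7) (I m) := by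
  have h_frame {σ'} (h : Frame (body ⨾ set i (.add (sc i) (.lit 1))) (σ.write i 0 0) σ') :
      Frame (LocalDecomp.forTo i N body) σ σ' := fun a ha =>
    (h.of_subset (List.subset_append_right _ _) a ha).trans
      (Store.write_ne _ _ _ (List.ne_of_not_mem_cons ha))
  refine (Runs.flat_seq (Runs.loop (I := fun σ' => σ' i 0 ≤ m ∧ I (σ' i 0) σ')
    (φ := fun σ' => ∑ j ∈ Finset.Ico (σ' i 0) m, (T j + N.cost + 10))
    ⟨by simp [Prog.act, set, Expr.eval], by simpa [Prog.act, set, Expr.eval] using h0⟩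
    fun σ' hf ⟨_, hI⟩ hb => ?_)).imp ?_ ?_
  · have hm : σ' i 0 < m := by
      have : m - σ' i 0 ≠ 0 := hN _ (h_frame hf) ▸ hb
      omega
    refine ⟨T (σ' i 0) + 6, (hs _ hm σ' (h_frame hf) rfl hI).seq fun τ hτ hIτ => .flat ?_⟩
    have hτi : τ i 0 = σ' i 0 := by rw [hτ i hi]
    simp only [set, sc, Prog.act, Expr.eval, hτi, Store.write_same, Function.update_self]
    refine ⟨⟨hm, hIτ⟩, ?_⟩
    rw [Finset.sum_eq_sum_Ico_succ_bot hm]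
    simp only [Expr.cost]
    omega
  · simp [Prog.act, Prog.time, set, Expr.eval, sc, Expr.cost]
    omega
  · rintro σ' hf ⟨⟨hle, hI⟩, hb⟩
    have : m - σ' i 0 = 0 := hN _ hf ▸ hb
    rwa [show σ' i 0 = m by omega] at hI

theorem Runs.forTo_const {i m c : ℕ} {N : Expr} {body : Prog} {I : ℕ → Store → Prop}
    (hi : i ∉ body.mods) (hN : ∀ σ', Frame (LocalDecomp.forTo i N body) σ σ' → N.eval σ' = m)
    (h0 : I 0 (σ.write i 0 0))
    (hs : ∀ j < m, ∀ σ', Frame (LocalDecomp.forTo i N body) σ σ' → σ' i 0 = j → I j σ' →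
      Runs body σ' c fun σ'' => I (j + 1) (σ''.write i 0 (j + 1))) :
    Runs (LocalDecomp.forTo i N body) σ (m * (c + N.cost + 10) + N.cost + 7) (I m) :=
  (Runs.forTo hi hN h0 hs).mono (by simp) fun _ h => h

end Logic

/- Names of the arrays used besides the input `0`–`3` and the output `4`. A number or a single
vertex is kept in cell `0` of its array, and `n` stands for an undefined vertex. -/
local notation "BOUND" => (5 : ℕ)
local notation "DEPTH" => (6 : ℕ)
local notation "POWER" => (7 : ℕ)
local notation "SOURCE" => (8 : ℕ)
local notation "SINK" => (9 : ℕ)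
local notation "FLOW" => (10 : ℕ)
local notation "MARK" => (11 : ℕ)
local notation "PARENT" => (12 : ℕ)
local notation "QUEUE" => (13 : ℕ)
local notation "START" => (14 : ℕ)
local notation "BLOCKED" => (15 : ℕ)
local notation "HEAD" => (16 : ℕ)
local notation "TAIL" => (17 : ℕ)
local notation "CURRENT" => (18 : ℕ)
local notation "IMAGE" => (19 : ℕ)
local notation "NEIGHBOUR" => (20 : ℕ)
local notation "NBHD" => (21 : ℕ)
local notation "MEMBER" => (22 : ℕ)
local notation "NUM_ARC" => (23 : ℕ)
local notation "NUM_VERTEX" => (24 : ℕ)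
local notation "VALUE" => (25 : ℕ)
local notation "ROUND" => (26 : ℕ)
local notation "END" => (27 : ℕ)
local notation "STATUS" => (28 : ℕ)
local notation "GUESS" => (29 : ℕ)
local notation "LEVEL" => (30 : ℕ)
local notation "ROOT" => (31 : ℕ)
local notation "LEAF" => (32 : ℕ)
local notation "RIVAL" => (33 : ℕ)
local notation "CANDIDATE" => (34 : ℕ)
local notation "TOP" => (35 : ℕ)
local notation "MISSING" => (36 : ℕ)
local notation "EXTRA" => (37 : ℕ)
local notation "CUTS" => (38 : ℕ)
local notation "CHIPS" => (39 : ℕ)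

section Vertices

variable {n : ℕ} {adj : Fin n → List (Fin n)} {k : ℕ} {S : Finset (Fin n)} {σ σ' : Store}
  {body p : Prog}

/-- The vertex set with characteristic vector `f`. -/
def marked (n : ℕ) (f : ℕ → ℕ) : Set (Fin n) := {u | f u ≠ 0}

theorem mem_marked {f : ℕ → ℕ} {u : Fin n} : u ∈ marked n f ↔ f u ≠ 0 := Iff.rfl

theorem marked_update {f : ℕ → ℕ} {x : Fin n} {c : ℕ} (hc : c ≠ 0) :
    marked n (Function.update f x c) = insert x (marked n f) := by
  ext u
  by_cases h : u = x <;> simp [mem_marked, ← Fin.ext_iff, h, hc]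

/-- The vertex with number `x`, if there is one. -/
def toVertex (n x : ℕ) : Option (Fin n) := if h : x < n then some ⟨x, h⟩ else none

theorem toVertex_val (u : Fin n) : toVertex n u = some u := by simp [toVertex]

theorem toVertex_eq_some {x : ℕ} {u : Fin n} : toVertex n x = some u ↔ x = u := by
  refine ⟨fun h => ?_, fun h => h ▸ toVertex_val u⟩
  exact congrArg Fin.val (Option.some.inj (Option.dite_none_right_eq_some.1 h).2)

theorem toVertex_eq_none {x : ℕ} : toVertex n x = none ↔ n ≤ x := by
  simp [toVertex]

/-- The input arrays are as in the initial memory. -/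
def HasInput (adj : Fin n → List (Fin n)) (k : ℕ) (S : Finset (Fin n)) (σ : Store) : Prop :=
  ∀ a < 4, σ a = inputStore adj k S a

/-- The program writes to no input array. -/
abbrev Prog.KeepsInput (p : Prog) : Prop := ∀ a ∈ p.mods, 4 ≤ a

theorem HasInput.size (h : HasInput adj k S σ) : σ 0 0 = n := by rw [h 0 (by omega)]; rfl

theorem HasInput.param (h : HasInput adj k S σ) : σ 0 1 = k := by rw [h 0 (by omega)]; rfl

theorem HasInput.eval_size (h : HasInput adj k S σ) : (sc 0).eval σ = n := h.size

theorem HasInput.marked_terminals (h : HasInput adj k S σ) :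
    marked n (σ 3) = (S : Set (Fin n)) := by
  ext u
  rw [mem_marked, h 3 (by omega)]
  simp [inputStore, ← Fin.ext_iff]

theorem HasInput.of_frame (h : HasInput adj k S σ) (hf : Frame p σ σ')
    (hp : p.KeepsInput := by decide) :
    HasInput adj k S σ' :=
  fun a ha => (hf a fun ha' => absurd (hp a ha') (not_le.2 ha)).trans (h a ha)

theorem HasInput.write (h : HasInput adj k S σ) {a i x : ℕ} (ha : 4 ≤ a) :
    HasInput adj k S (σ.write a i x) :=
  fun c hc => (σ.write_ne i x (by omega)).trans (h c hc)

theorem HasInput.offset (h : HasInput adj k S σ) {j : ℕ} (hj : j ≤ n) :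
    σ 1 j = (((List.finRange n).take j).flatMap adj).length := by
  rw [h 1 (by omega), List.length_flatMap]
  exact if_pos hj

theorem HasInput.offset_succ (h : HasInput adj k S σ) (w : Fin n) :
    σ 1 (w + 1) = σ 1 w + (adj w).length := by
  rw [h.offset w.2, h.offset w.2.le, List.take_add_one]
  simp

theorem HasInput.arc (h : HasInput adj k S σ) (w : Fin n) {j : ℕ} (hj : j < (adj w).length) :
    σ 2 (σ 1 w + j) = (adj w)[j] := by
  have h_split : List.finRange n = (List.finRange n).take w ++ w ::
      (List.finRange n).drop (w + 1) := by
    conv_lhs => rw [← List.take_append_drop w (List.finRange n)]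
    rw [List.drop_eq_getElem_cons (by simp)]
    simp
  have h_arcs : σ 2 (σ 1 w + j) =
      (((List.finRange n).flatMap adj).map Fin.val).getD (σ 1 w + j) 0 := by
    rw [h 2 (by omega)]
    rfl
  rw [h_arcs, h.offset w.2.le]
  conv_lhs => arg 1; arg 2; rw [h_split]
  rw [List.flatMap_append, List.flatMap_cons, List.getD_eq_getElem?_getD, List.getElem?_map,
    List.getElem?_append_right (by omega), Nat.add_sub_cancel_left, List.getElem?_append_left hj,
    List.getElem?_eq_getElem hj]
  rfl

/-- Run `body` for all vertices. -/
def forVertex (body : Prog) : Prog := forTo NUM_VERTEX (sc 0) body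

theorem Runs.forVertex {I : ℕ → Store → Prop} {T : Fin n → ℕ} (hσ : HasInput adj k S σ)
    (hbody : body.KeepsInput) (hV : NUM_VERTEX ∉ body.mods) (h0 : I 0 (σ.write NUM_VERTEX 0 0))
    (hs : ∀ (u : Fin n) (τ : Store), Frame (forVertex body) σ τ → HasInput adj k S τ →
      τ NUM_VERTEX 0 = u → I u τ →
      Runs body τ (T u) fun τ' => I (u + 1) (τ'.write NUM_VERTEX 0 (u + 1))) :
    Runs (forVertex body) σ (∑ u, (T u + 12) + 9) (I n) := by
  have hB {τ} (hf : Frame (LocalDecomp.forVertex body) σ τ) : HasInput adj k S τ := by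
    refine hσ.of_frame hf fun a ha => ?_
    simp only [LocalDecomp.forVertex, LocalDecomp.forTo, set, Prog.mods, List.mem_append,
      List.mem_singleton] at ha
    rcases ha with rfl | ha | rfl
    exacts [by decide, hbody a ha, by decide]
  refine (Runs.forTo (T := fun j => if h : j < n then T ⟨j, h⟩ else 0) hV
    (fun τ hf => (hB hf).size) h0 fun j hj τ hf hτ hI => ?_).mono ?_ fun _ h => h
  · rw [dif_pos hj]
    exact hs ⟨j, hj⟩ τ hf (hB hf) hτ hI
  · rw [Finset.sum_range]
    simp [sc, Expr.cost]

/-- `a[u] := e` for all vertices `u`. -/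
def fill (a : ℕ) (e : Expr) : Prog := forVertex (.assign a (sc NUM_VERTEX) e)

theorem runs_fill {a : ℕ} {e : Expr} {f : Fin n → ℕ} (hσ : HasInput adj k S σ)
    (he : ∀ (u : Fin n) (τ : Store), Frame (fill a e) σ τ → τ NUM_VERTEX 0 = u → τ a u = σ a u →
      e.eval τ = f u) (ha : 4 ≤ a := by decide) (ha' : a ≠ NUM_VERTEX := by decide) :
    Runs (fill a e) σ (n * (e.cost + 20) + 20) fun σ' => ∀ u : Fin n, σ' a u = f u := by
  refine (Runs.forVertex (T := fun _ => e.cost + 3) (I := fun j τ =>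
    ∀ u : Fin n, τ a u = if (u : ℕ) < j then f u else σ a u) hσ ?_ ?_ ?_ ?_).mono ?_ ?_
  · simpa [Prog.KeepsInput, Prog.mods] using ha
  · simpa [Prog.mods] using ha'.symm
  · simp [ha']
  · rintro u τ hf - hτ hI
    have hfu := he u τ hf hτ ((hI u).trans (if_neg (lt_irrefl _)))
    refine .flat (fun v => ?_) rfl (by simp only [Prog.time, sc, Expr.cost]; omega)
    rw [Store.write_ne _ _ _ ha', Prog.act, Store.write_same, hfu, sc, Expr.eval, Expr.eval, hτ,
      Function.update_apply, hI v]
    rcases lt_trichotomy (v : ℕ) u with h | h | h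
    · rw [if_neg h.ne, if_pos h, if_pos (h.trans u.val.lt_succ_self)]
    · rw [if_pos h, if_pos (by omega), Fin.ext h]
    · rw [if_neg h.ne', if_neg h.not_gt, if_neg (by omega)]
  · simp only [Finset.sum_const, Finset.card_univ, Fintype.card_fin, smul_eq_mul]
    ring_nf
    omega
  · exact fun τ hI u => (hI u).trans (if_pos u.2)

theorem runs_copy {a b : ℕ} (hσ : HasInput adj k S σ) (hb : b ≠ a := by decide)
    (hb' : b ≠ NUM_VERTEX := by decide) (ha : 4 ≤ a := by decide)
    (ha' : a ≠ NUM_VERTEX := by decide) :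
    Runs (fill a (.get b (sc NUM_VERTEX))) σ (n * 23 + 20) fun σ' => ∀ u : Fin n, σ' a u = σ b u :=
  runs_fill hσ (fun u τ hf hτ _ => by
    rw [Expr.eval, sc, Expr.eval, Expr.eval, hτ, hf b (by simp [fill, forVertex, forTo, set,
      Prog.mods, hb, hb'])]) ha ha'

/-- `x` is the number of the last vertex with property `P`, or `n` if there is none. -/
def IsLast (n : ℕ) (P : Fin n → Prop) (x : ℕ) : Prop :=
  (x = n ∧ ∀ u, ¬ P u) ∨ ∃ u : Fin n, x = u ∧ IsGreatest {u | P u} u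

/-- `a[0]` becomes the last vertex that satisfies `e`, or `n` if there is none. -/
def find (a : ℕ) (e : Expr) : Prog :=
  set a (sc 0) ⨾ forVertex (.cond e (set a (sc NUM_VERTEX)) .skip)

theorem runs_find {a : ℕ} {e : Expr} {P : Fin n → Prop} (hσ : HasInput adj k S σ)
    (he : ∀ (u : Fin n) (τ : Store), Frame (find a e) σ τ → τ NUM_VERTEX 0 = u →
      (e.eval τ ≠ 0 ↔ P u)) (ha : 4 ≤ a := by decide) (ha' : a ≠ NUM_VERTEX := by decide) :
    Runs (find a e) σ (n * (e.cost + 20) + 20) fun σ' => IsLast n P (σ' a 0) := by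
  have h_act : (set a (sc 0)).act σ = σ.write a 0 n := by
    rw [set, Prog.act, hσ.eval_size]
    rfl
  refine (Runs.flat_seq (Runs.forVertex (T := fun _ => e.cost + 6) (I := fun j τ =>
    IsLast n (fun u => (u : ℕ) < j ∧ P u) (τ a 0))
    (h_act ▸ hσ.write ha) ?_ ?_ ?_ ?_)).mono ?_ ?_
  · simpa [Prog.KeepsInput, Prog.mods, set] using ha
  · simpa [Prog.mods, set] using ha'.symm
  · left
    simp [h_act, ha']
  · rintro u τ hf - hτ hI
    have heu := he u τ (fun b hb => by
      rw [hf b fun h => hb (List.mem_append_right _ h), h_act,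
        Store.write_ne _ _ _ (List.ne_of_not_mem_cons hb)]) hτ
    refine .flat ?_ rfl (by simp only [Prog.time, set, sc, Expr.cost]; omega)
    rw [Store.write_ne _ _ _ ha', Prog.act]
    split_ifs with h
    · right
      refine ⟨u, ?_, ⟨u.val.lt_succ_self, heu.1 h⟩, fun v hv => Nat.lt_succ_iff.1 hv.1⟩
      simp [set, sc, Prog.act, Expr.eval, hτ]
    · have h_iff (v : Fin n) : (v : ℕ) < u + 1 ∧ P v ↔ (v : ℕ) < u ∧ P v :=
        and_congr_left fun hv => Nat.lt_succ_iff_lt_or_eq.trans <|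
          or_iff_left fun hvu => h (heu.2 (Fin.ext hvu ▸ hv))
      simpa only [h_iff, Prog.act] using hI
  · simp only [Finset.sum_const, Finset.card_univ, Fintype.card_fin, smul_eq_mul, Prog.time, set,
      sc, Expr.cost]
    ring_nf
    omega
  · exact fun τ hI => by simpa using hI

/-- Run `body` for all neighbours `x` of the vertex with number `a[0]`, stored in
`NEIGHBOUR[0]`. -/
def forAdj (a : ℕ) (body : Prog) : Prog :=
  forTo NUM_ARC (.sub (.get 1 (.add (sc a) (.lit 1))) (.get 1 (sc a)))
    (set NEIGHBOUR (.get 2 (.add (.get 1 (sc a)) (sc NUM_ARC))) ⨾ body)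

theorem Runs.forAdj {a c : ℕ} {w : Fin n} {I : List (Fin n) → Store → Prop}
    (hσ : HasInput adj k S σ) (hw : σ a 0 = w) (hbody : body.KeepsInput) (ha : a ∉ body.mods)
    (hA : NUM_ARC ∉ body.mods) (h0 : I [] (σ.write NUM_ARC 0 0))
    (hs : ∀ (l : List (Fin n)) (x : Fin n) (l' : List (Fin n)) (τ : Store), adj w = l ++ x :: l' →
      Frame (forAdj a body) σ τ → HasInput adj k S τ → I l τ →
      Runs body (τ.write NEIGHBOUR 0 x) c fun τ' =>
        I (l ++ [x]) (τ'.write NUM_ARC 0 (l.length + 1)))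
    (ha' : a ≠ NUM_ARC := by decide) (ha'' : a ≠ NEIGHBOUR := by decide) :
    Runs (forAdj a body) σ ((adj w).length * (c + 28) + 16) (I (adj w)) := by
  have h_mods {b} (hb : b ∈ (LocalDecomp.forAdj a body).mods) :
      b = NUM_ARC ∨ b = NEIGHBOUR ∨ b ∈ body.mods := by
    simpa [LocalDecomp.forAdj, LocalDecomp.forTo, set, Prog.mods, or_left_comm, or_comm] using hb
  have hB {τ} (hf : Frame (LocalDecomp.forAdj a body) σ τ) : HasInput adj k S τ :=
    hσ.of_frame hf fun b hb => by
      rcases h_mods hb with rfl | rfl | h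
      exacts [by decide, by decide, hbody b h]
  have hwτ {τ} (hf : Frame (LocalDecomp.forAdj a body) σ τ) : τ a 0 = w := by
    rw [hf a fun h => by rcases h_mods h with h | h | h <;> contradiction, hw]
  refine (Runs.forTo_const (m := (adj w).length) (c := c + 9)
    (I := fun j τ => I ((adj w).take j) τ) ?_ (fun τ hf => ?_) ?_ fun j hj τ hf hτ hI => ?_).mono
    ?_ fun τ h => by simpa using h
  · simpa [Prog.mods, set] using hA
  · simp [Expr.eval, sc, hwτ hf, (hB hf).offset_succ w]
  · simpa using h0
  · have h_split : adj w = (adj w).take j ++ (adj w)[j] :: (adj w).drop (j + 1) := by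
      rw [← List.drop_eq_getElem_cons hj, List.take_append_drop]
    have h_act : (set NEIGHBOUR (.get 2 (.add (.get 1 (sc a)) (sc NUM_ARC)))).act τ =
        τ.write NEIGHBOUR 0 (adj w)[j] := by
      simp only [set, sc, Prog.act, Expr.eval, hwτ hf, hτ, (hB hf).arc w hj]
    refine (Runs.flat_seq (h_act ▸ hs _ _ _ τ h_split hf (hB hf) hI)).mono ?_ fun τ' h => ?_
    · simp only [Prog.time, set, sc, Expr.cost]
      omega
    · rw [List.length_take_of_le hj.le] at h
      rwa [List.take_add_one, List.getElem?_eq_getElem hj]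
  · simp only [sc, Expr.cost]
    ring_nf
    rfl

end Vertices

section Neighbourhood

variable {n : ℕ} {G : SimpleGraph (Fin n)} {adj : Fin n → List (Fin n)} {k : ℕ}
  {S : Finset (Fin n)} {σ : Store}

/-- The size of the input, up to a constant factor. -/
def size (adj : Fin n → List (Fin n)) : ℕ := n + ∑ u, (adj u).length + 1

/-- Add the neighbours of the vertex `NUM_VERTEX[0]` to `NBHD`. -/
def addNbrs : Prog := forAdj NUM_VERTEX (.assign NBHD (sc NEIGHBOUR) (.lit 1))

theorem runs_addNbrs (hσ : HasInput adj k S σ) {w : Fin n} (hw : σ NUM_VERTEX 0 = w) :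
    Runs addNbrs σ ((adj w).length * 32 + 16) fun σ' =>
      marked n (σ' NBHD) = {x | x ∈ adj w} ∪ marked n (σ NBHD) := by
  refine Runs.forAdj (c := 4)
    (I := fun l τ => marked n (τ NBHD) = {x | x ∈ l} ∪ marked n (σ NBHD)) hσ hw (by decide)
    (by decide) (by decide) (by simp) fun l x _ τ _ _ _ hI => .flat ?_
  simp only [Prog.act, sc, Expr.eval, Store.write_same, Function.update_self]
  rw [Store.write_ne _ _ _ (by decide), Store.write_same, marked_update one_ne_zero,
    Store.write_ne _ _ _ (by decide), hI]
  ext y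
  simp only [Set.mem_insert_iff, Set.mem_union, Set.mem_ofPred_eq, List.mem_append,
    List.mem_singleton]
  tauto

/-- `NBHD` becomes the neighbourhood of `MEMBER`. -/
def findNbhd : Prog :=
  fill NBHD (.lit 0) ⨾ forVertex (.cond (.get MEMBER (sc NUM_VERTEX)) addNbrs .skip) ⨾
    fill NBHD (.both (.get NBHD (sc NUM_VERTEX)) (.neg (.get MEMBER (sc NUM_VERTEX))))

theorem runs_forVertex_addNbrs (hadj : IsAdjList G adj) (hσ : HasInput adj k S σ)
    (h0 : ∀ u : Fin n, σ NBHD u = 0) :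
    Runs (forVertex (.cond (.get MEMBER (sc NUM_VERTEX)) addNbrs .skip)) σ
      (∑ u, ((adj u).length * 32 + 33) + 9) fun σ' =>
        marked n (σ' NBHD) = {x | ∃ u ∈ marked n (σ MEMBER), G.Adj u x} := by
  refine (Runs.forVertex (T := fun u => (adj u).length * 32 + 21) (I := fun j τ =>
    marked n (τ NBHD) = {x | ∃ u ∈ marked n (σ MEMBER), (u : ℕ) < j ∧ G.Adj u x}) hσ (by decide)
    (by decide) ?_ fun u τ hf hB hτ hI => ?_).mono le_rfl fun τ hI => by simpa using hI
  · ext x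
    simpa [mem_marked] using h0 x
  · have hu : (Expr.get MEMBER (sc NUM_VERTEX)).eval τ = σ MEMBER u := by
      rw [Expr.eval, sc, Expr.eval, Expr.eval, hτ, hf.eq MEMBER]
    refine (Runs.cond (T' := 1) (fun hb => (runs_addNbrs hB hτ).mono le_rfl fun τ' h => ?_)
      fun hb => .flat ?_).mono (by simp only [sc, Expr.cost]; omega) fun _ h => h
    · rw [hu] at hb
      rw [Store.write_ne _ _ _ (by decide), h, hI]
      ext x
      simp only [Set.mem_union, Set.mem_ofPred_eq, (hadj _).2, Nat.lt_succ_iff_lt_or_eq,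
        ← Fin.ext_iff]
      constructor
      · rintro (hx | ⟨v, hv, hvu, hx⟩)
        exacts [⟨u, hb, .inr rfl, hx⟩, ⟨v, hv, .inl hvu, hx⟩]
      · rintro ⟨v, hv, hvu | rfl, hx⟩
        exacts [.inr ⟨v, hv, hvu, hx⟩, .inl hx]
    · rw [hu] at hb
      rw [Store.write_ne _ _ _ (by decide), Prog.act, hI]
      ext x
      refine exists_congr fun v => and_congr_right fun hv => and_congr_left fun _ =>
        (Nat.lt_succ_iff_lt_or_eq.trans (or_iff_left fun h => hv ?_)).symm
      rwa [h]

theorem runs_findNbhd (hadj : IsAdjList G adj) (hσ : HasInput adj k S σ) :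
    Runs findNbhd σ (150 * size adj) fun σ' =>
      marked n (σ' NBHD) = nbhd G (marked n (σ MEMBER)) := by
  refine ((runs_fill (f := fun _ => 0) hσ fun _ _ _ _ _ => rfl).seq fun σ₁ hf₁ h₁ =>
    (runs_forVertex_addNbrs hadj (hσ.of_frame hf₁) h₁).seq fun σ₂ hf₂ h₂ =>
    (runs_fill (f := fun u => if σ₂ NBHD u ≠ 0 ∧ σ₂ MEMBER u = 0 then 1 else 0)
      ((hσ.of_frame hf₁).of_frame hf₂) ?_).mono le_rfl ?_).mono ?_
    fun _ h => h
  · intro u τ hf hu h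
    simp only [Expr.both, Expr.neg, Expr.eval, sc, hu, h, hf.eq MEMBER]
    split <;> omega
  · intro σ₃ h₃
    ext x
    have hx : σ₂ NBHD x ≠ 0 ↔ ∃ u ∈ marked n (σ MEMBER), G.Adj u x := by
      rw [← mem_marked, h₂, hf₁.eq MEMBER]
      rfl
    have hx' : σ₃ NBHD x ≠ 0 ↔ σ₂ NBHD x ≠ 0 ∧ σ₂ MEMBER x = 0 := by simp [h₃]
    rw [mem_marked, hx', hx, hf₂.eq MEMBER, hf₁.eq MEMBER, and_comm]
    simp [nbhd, mem_marked]
  · simp only [size, Finset.sum_add_distrib, ← Finset.sum_mul, Finset.sum_const, Finset.card_univ,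
      Fintype.card_fin, smul_eq_mul, Expr.both, Expr.neg, Expr.cost, sc]
    omega

end Neighbourhood

section Search

variable {n : ℕ} {G : SimpleGraph (Fin n)} {adj : Fin n → List (Fin n)} {k : ℕ}
  {S : Finset (Fin n)} {σ : Store} {Z T : Set (Fin n)} {q : Fin n → Option (Fin n)}
  {mark parent queue : ℕ → ℕ} {tail h p : ℕ} {u v w x : Fin n}

/-- The queue contains the vertices with nonzero marks, ordered by their marks `1, 2, …`. -/
structure IsQueue (n : ℕ) (mark queue : ℕ → ℕ) (tail : ℕ) : Prop where
  mark_queue : ∀ i < tail, ∃ u : Fin n, queue i = u ∧ mark u = i + 1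
  queue_mark : ∀ u : Fin n, mark u ≠ 0 → mark u ≤ tail ∧ queue (mark u - 1) = u

/-- Following parents leads from every marked vertex backwards along steps to `T`, with decreasing
marks. Parents that are not vertices mark the roots. -/
def IsSearchTree (G : SimpleGraph (Fin n)) (Z T : Set (Fin n)) (q : Fin n → Option (Fin n))
    (mark parent : ℕ → ℕ) : Prop :=
  ∀ u : Fin n, mark u ≠ 0 → (toVertex n (parent u) = none ∧ u ∈ T) ∨
    ∃ u', toVertex n (parent u) = some u' ∧ mark u' ≠ 0 ∧ mark u' < mark u ∧ Step G Z q u' u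

/-- State of the search when the first `h` entries of the queue have been processed. -/
structure SearchInv (G : SimpleGraph (Fin n)) (Z T : Set (Fin n)) (q : Fin n → Option (Fin n))
    (mark parent queue : ℕ → ℕ) (tail h : ℕ) : Prop extends IsQueue n mark queue tail where
  subset : marked n mark ⊆ residualReach G Z T q
  tree : IsSearchTree G Z T q mark parent
  closed : ∀ u : Fin n, mark u ≠ 0 → mark u ≤ h → ∀ x, Step G Z q u x → mark x ≠ 0
  head_le : h ≤ tail

/-- All nonzero values of `f` are kept in `g`. -/
def Extends (n : ℕ) (f g : ℕ → ℕ) : Prop := ∀ u : Fin n, f u ≠ 0 → g u = f u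

theorem Extends.trans {f₁ f₂ f₃ : ℕ → ℕ} (h : Extends n f₁ f₂) (h' : Extends n f₂ f₃) :
    Extends n f₁ f₃ := fun u hu => (h' u (h u hu ▸ hu)).trans (h u hu)

theorem Extends.ne_zero {f g : ℕ → ℕ} (h : Extends n f g) (hu : f u ≠ 0) : g u ≠ 0 := h u hu ▸ hu

theorem extends_update {f : ℕ → ℕ} {c : ℕ} (hx : f x = 0) :
    Extends n f (Function.update f x c) := fun u hu =>
  Function.update_of_ne (fun hux : (u : ℕ) = x => hu (hux ▸ hx)) _ _

theorem IsQueue.push (hQ : IsQueue n mark queue tail) (hx : mark x = 0) :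
    IsQueue n (Function.update mark x (tail + 1)) (Function.update queue tail x) (tail + 1) where
  mark_queue i hi := by
    rcases Nat.lt_succ_iff_lt_or_eq.1 hi with hi | rfl
    · obtain ⟨u, hu, hui⟩ := hQ.mark_queue i hi
      refine ⟨u, by rw [Function.update_of_ne hi.ne, hu], ?_⟩
      rw [extends_update hx u (by omega), hui]
    · exact ⟨x, by simp⟩
  queue_mark u hu := by
    by_cases hux : (u : ℕ) = x
    · simp [hux]
    · rw [Function.update_of_ne hux] at hu ⊢
      obtain ⟨hle, hq⟩ := hQ.queue_mark u hu
      exact ⟨by omega, by rw [Function.update_of_ne (by omega), hq]⟩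

theorem IsSearchTree.push (hP : IsSearchTree G Z T q mark parent)
    (hQ : IsQueue n mark queue tail) (hx : mark x = 0)
    (hp : (toVertex n p = none ∧ x ∈ T) ∨
      ∃ u, toVertex n p = some u ∧ mark u ≠ 0 ∧ Step G Z q u x) :
    IsSearchTree G Z T q (Function.update mark x (tail + 1)) (Function.update parent x p) := by
  have h_ext : Extends n mark (Function.update mark x (tail + 1)) := extends_update hx
  intro u hu
  by_cases hux : (u : ℕ) = x
  · obtain rfl := Fin.ext hux
    simp only [Function.update_self]
    refine hp.imp id fun ⟨u', hpu, hu', hstep⟩ => ⟨u', hpu, h_ext.ne_zero hu', ?_, hstep⟩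
    rw [h_ext u' hu']
    exact Nat.lt_succ_of_le (hQ.queue_mark u' hu').1
  · rw [Function.update_of_ne hux] at hu ⊢
    rw [Function.update_of_ne hux]
    refine (hP u hu).imp id fun ⟨u', hpu, hu', hlt, hstep⟩ =>
      ⟨u', hpu, h_ext.ne_zero hu', ?_, hstep⟩
    rwa [h_ext u' hu']

theorem SearchInv.push (hI : SearchInv G Z T q mark parent queue tail h) (hx : mark x = 0)
    (hp : (toVertex n p = none ∧ x ∈ T) ∨
      ∃ u, toVertex n p = some u ∧ mark u ≠ 0 ∧ Step G Z q u x) :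
    SearchInv G Z T q (Function.update mark x (tail + 1)) (Function.update parent x p)
      (Function.update queue tail x) (tail + 1) h where
  toIsQueue := hI.toIsQueue.push hx
  subset := by
    rw [marked_update (by omega)]
    refine Set.insert_subset ?_ hI.subset
    rcases hp with ⟨-, hxT⟩ | ⟨u, -, hu, hstep⟩
    exacts [subset_residualReach hxT, mem_residualReach_of_step (hI.subset hu) hstep]
  tree := hI.tree.push hI.toIsQueue hx hp
  closed u hu huh y hstep := by
    have hux : (u : ℕ) ≠ x := fun hux => by
      have := hI.head_le
      rw [hux, Function.update_self] at huh
      omega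
    rw [Function.update_of_ne hux] at hu huh
    exact (extends_update hx).ne_zero (hI.closed u hu huh y hstep)
  head_le := hI.head_le.trans (Nat.le_succ _)

theorem SearchInv.succ (hI : SearchInv G Z T q mark parent queue tail h) (hv : mark v = h + 1)
    (hc : ∀ x, Step G Z q v x → mark x ≠ 0) :
    SearchInv G Z T q mark parent queue tail (h + 1) :=
  { hI with
    closed := fun u hu huh x hs => by
      rcases Nat.le_succ_iff.1 huh with huh | huh
      · exact hI.closed u hu huh x hs
      · have hu' := (hI.queue_mark u hu).2
        have hv' := (hI.queue_mark v (by omega)).2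
        rw [huh.trans hv.symm, hv'] at hu'
        exact hc x (Fin.ext hu' ▸ hs)
    head_le := hv ▸ (hI.queue_mark v (by omega)).1 }

theorem SearchInv.marked_eq (hI : SearchInv G Z T q mark parent queue tail tail)
    (hT : T ⊆ marked n mark) : marked n mark = residualReach G Z T q :=
  hI.subset.antisymm <| residualReach_subset hT fun u hu x hs =>
    hI.closed u hu (hI.queue_mark u hu).1 x hs

/-- `SearchInv` for the arrays of the program. -/
abbrev SearchState (G : SimpleGraph (Fin n)) (Z T : Set (Fin n)) (q : Fin n → Option (Fin n))
    (σ : Store) (h : ℕ) : Prop :=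
  SearchInv G Z T q (σ MARK) (σ PARENT) (σ QUEUE) (σ TAIL 0) h

/-- Put the vertex `NEIGHBOUR[0]` into the queue, with parent `CURRENT[0]`, unless it is blocked or
has been visited before. -/
def visit : Prog :=
  .cond (.both (.neg (.get MARK (sc NEIGHBOUR))) (.neg (.get BLOCKED (sc NEIGHBOUR))))
    (.assign MARK (sc NEIGHBOUR) (.add (sc TAIL) (.lit 1)) ⨾
      .assign PARENT (sc NEIGHBOUR) (sc CURRENT) ⨾ .assign QUEUE (sc TAIL) (sc NEIGHBOUR) ⨾
      set TAIL (.add (sc TAIL) (.lit 1)))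
    .skip

theorem runs_visit (hI : SearchState G Z T q σ h) (hZ : marked n (σ BLOCKED) = Z)
    (hx : σ NEIGHBOUR 0 = x) (hp : x ∉ Z → (toVertex n (σ CURRENT 0) = none ∧ x ∈ T) ∨
      ∃ u : Fin n, toVertex n (σ CURRENT 0) = some u ∧ σ MARK u ≠ 0 ∧ Step G Z q u x) :
    Runs visit σ 45 fun σ' => SearchState G Z T q σ' h ∧ Extends n (σ MARK) (σ' MARK) ∧
      (x ∉ Z → σ' MARK x ≠ 0) := by
  have hb : (Expr.both (.neg (.get MARK (sc NEIGHBOUR))) (.neg (.get BLOCKED (sc NEIGHBOUR)))).eval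
      σ ≠ 0 ↔ σ MARK x = 0 ∧ x ∉ Z := by
    rw [Expr.eval_both, Expr.eval_neg, Expr.eval_neg, ← hZ, mem_marked, not_not]
    simp only [Expr.eval, sc, hx]
  refine .flat ?_
  simp only [visit, Prog.act]
  split_ifs with h
  · obtain ⟨h0, hxZ⟩ := hb.1 h
    simp only [SearchState, set, sc, Prog.act, Expr.eval, Store.write, hx, ne_eq,
      Function.update_self, Function.update_of_ne, Nat.reduceEqDiff, not_false_eq_true]
    exact ⟨hI.push h0 (hp hxZ), extends_update h0, by simp⟩
  · rw [hb, not_and_not_right] at h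
    exact ⟨hI, fun _ _ => rfl, fun hxZ h0 => hxZ (h h0)⟩

/-- Visit all vertices of `START`, which have no parent. -/
def visitStart : Prog :=
  forVertex (.cond (.get START (sc NUM_VERTEX)) (set NEIGHBOUR (sc NUM_VERTEX) ⨾ visit) .skip)

theorem runs_visitStart (hσ : HasInput adj k S σ) (hT : marked n (σ START) = T)
    (hZ : marked n (σ BLOCKED) = Z) (hZT : Disjoint Z T) (hc : σ CURRENT 0 = n)
    (hI : SearchState G Z T q σ 0) :
    Runs visitStart σ (n * 70 + 9) fun σ' =>
      SearchState G Z T q σ' 0 ∧ T ⊆ marked n (σ' MARK) := by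
  refine (Runs.forVertex (T := fun _ => 58) (I := fun j τ => SearchState G Z T q τ 0 ∧
    ∀ u ∈ T, (u : ℕ) < j → τ MARK u ≠ 0) hσ (by decide) (by decide) ⟨hI, by simp⟩ ?_).mono
    (by simp) fun τ h => ⟨h.1, fun u hu => h.2 u hu u.2⟩
  rintro u τ hf - hτ ⟨hI, hm⟩
  have hu : (Expr.get START (sc NUM_VERTEX)).eval τ = σ START u := by
    rw [Expr.eval, sc, Expr.eval, Expr.eval, hτ, hf.eq START]
  have h_succ {τ' : Store} (hext : Extends n (τ MARK) (τ' MARK)) (huT : u ∈ T → τ' MARK u ≠ 0)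
      (v : Fin n) (hv : v ∈ T) (hvu : (v : ℕ) < u + 1) : τ' MARK v ≠ 0 := by
    rcases Nat.lt_succ_iff_lt_or_eq.1 hvu with h | h
    exacts [hext.ne_zero (hm v hv h), Fin.ext h ▸ huT (Fin.ext h ▸ hv)]
  refine (Runs.cond (T := 50) (T' := 1)
    (fun hb => .mono (.flat_seq (T := 45) ?_) (by decide) fun _ h => h)
    fun hb => .flat ?_).mono (by simp [Expr.cost, sc]) fun _ h => h
  · have huT : u ∈ T := by rwa [hu, ← mem_marked, hT] at hb
    refine (runs_visit (x := u) (σ := (set NEIGHBOUR (sc NUM_VERTEX)).act τ) hI ?_ ?_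
      fun _ => .inl ⟨?_, huT⟩).mono le_rfl
      fun τ' ⟨hI', hext, hx⟩ => ⟨hI', h_succ hext fun _ => hx (hZT.notMem_of_mem_right huT)⟩
    · rw [← hZ, ← hf.eq BLOCKED]
      rfl
    · simpa [set, sc, Prog.act, Expr.eval] using hτ
    · rw [toVertex_eq_none, ← hc, ← hf.eq CURRENT]
      rfl
  · refine ⟨hI, h_succ (fun _ _ => rfl) fun huT => absurd hb ?_⟩
    rwa [hu, ← ne_eq, ← mem_marked, hT]

/-- Visit the vertex `IMAGE[0]` and its neighbours. -/
def visitClosedNbhd : Prog := set NEIGHBOUR (sc IMAGE) ⨾ visit ⨾ forAdj IMAGE visit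

theorem runs_visitClosedNbhd (hadj : IsAdjList G adj) (hσ : HasInput adj k S σ)
    (hZ : marked n (σ BLOCKED) = Z) (hI : SearchState G Z T q σ h) (hv : σ CURRENT 0 = v)
    (hv' : σ MARK v ≠ 0) (hw : σ IMAGE 0 = w) (hq : q v = some w) :
    Runs visitClosedNbhd σ ((adj w).length * 73 + 70) fun σ' => SearchState G Z T q σ' h ∧
      Extends n (σ MARK) (σ' MARK) ∧ ∀ x, Step G Z q v x → σ' MARK x ≠ 0 := by
  have h_visit (x : Fin n) (hx : x = w ∨ G.Adj w x) (τ : Store) (hI : SearchState G Z T q τ h)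
      (hf : Frame visitClosedNbhd σ τ) (hext : Extends n (σ MARK) (τ MARK))
      (hτ : τ NEIGHBOUR 0 = x) :
      Runs visit τ 45 fun τ' => SearchState G Z T q τ' h ∧ Extends n (τ MARK) (τ' MARK) ∧
        (x ∉ Z → τ' MARK x ≠ 0) :=
    runs_visit hI (by rw [hf.eq BLOCKED, hZ]) hτ fun hxZ => .inr
      ⟨v, by rw [hf.eq CURRENT, hv, toVertex_val], hext.ne_zero hv', hxZ, w, hq, hx⟩
  have h_set : Frame visitClosedNbhd σ ((set NEIGHBOUR (sc IMAGE)).act σ) :=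
    (frame_act _ σ).of_subset (by decide)
  refine (Runs.flat_seq <| (h_visit w (.inl rfl) ((set NEIGHBOUR (sc IMAGE)).act σ) hI h_set
    (fun _ _ => rfl) (by simpa [set, sc, Prog.act, Expr.eval] using hw)).seq
    fun σ₁ hf₁ ⟨hI₁, hext₁, hw₁⟩ => Runs.forAdj (c := 45) (w := w)
    (I := fun l τ => SearchState G Z T q τ h ∧ Extends n (σ MARK) (τ MARK) ∧
      ∀ x, x = w ∨ x ∈ l → x ∉ Z → τ MARK x ≠ 0) ((hσ.of_frame h_set).of_frame hf₁) ?_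
    (by decide) (by decide) (by decide) ⟨hI₁, hext₁, by simpa using hw₁⟩ ?_).mono ?_ ?_
  · rw [hf₁.eq IMAGE]
    simpa [set, sc, Prog.act, Expr.eval] using hw
  · rintro l x l' τ hl hf - ⟨hIτ, hext, hm⟩
    have hfτ : Frame visitClosedNbhd σ τ :=
      h_set.trans <| (hf₁.of_subset (by decide)).trans (hf.of_subset (by decide))
    have hwx : G.Adj w x := (hadj w).2 x |>.1 (by simp [hl])
    refine (h_visit x (.inr hwx) (τ.write NEIGHBOUR 0 x) hIτ ?_ hext ?_).mono le_rfl
      fun τ' ⟨hI', hext', hx⟩ => ⟨hI', hext.trans hext', fun y hy hyZ => ?_⟩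
    · exact hfτ.trans fun a ha => Store.write_ne _ _ _ fun h => ha (h ▸ by decide)
    · simp
    · rw [List.mem_append, List.mem_singleton, ← or_assoc] at hy
      rcases hy with hy | rfl
      exacts [hext'.ne_zero (hm y hy hyZ), hx hyZ]
  · simp only [Prog.time, set, sc, Expr.cost]
    omega
  · rintro τ ⟨hIτ, hext, hm⟩
    refine ⟨hIτ, hext, fun x ⟨hxZ, w', hw', hx⟩ => hm x ?_ hxZ⟩
    rwa [(hadj w).2, Option.some.inj (hq.symm.trans hw')]

/-- Take the first unprocessed vertex from the queue. -/
def dequeue : Prog :=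
  set CURRENT (.get QUEUE (sc HEAD)) ⨾ set HEAD (.add (sc HEAD) (.lit 1)) ⨾
    set IMAGE (.get FLOW (sc CURRENT))

/-- Take the first unprocessed vertex from the queue and visit all vertices that are one step
away. -/
def expand : Prog := dequeue ⨾ .cond (.sub (sc 0) (sc IMAGE)) visitClosedNbhd .skip

theorem runs_expand (hadj : IsAdjList G adj) (hσ : HasInput adj k S σ)
    (hZ : marked n (σ BLOCKED) = Z) (hq : ∀ u : Fin n, toVertex n (σ FLOW u) = q u)
    (hI : SearchState G Z T q σ h) (hh : σ HEAD 0 = h) (hv : σ QUEUE h = v)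
    (hv' : σ MARK v = h + 1) :
    Runs expand σ (((q v).elim 0 fun w => (adj w).length) * 73 + 110) fun σ' =>
      SearchState G Z T q σ' (h + 1) ∧ Extends n (σ MARK) (σ' MARK) ∧ σ' HEAD 0 = h + 1 := by
  have h_frame := frame_act dequeue σ
  have hσ' := hσ.of_frame h_frame
  have h_head : dequeue.act σ HEAD 0 = h + 1 := by
    simp [dequeue, set, sc, Prog.act, Expr.eval, hh]
  have h_current : dequeue.act σ CURRENT 0 = v := by
    simp [dequeue, set, sc, Prog.act, Expr.eval, hh, hv]
  have h_image : dequeue.act σ IMAGE 0 = σ FLOW v := by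
    simp [dequeue, set, sc, Prog.act, Expr.eval, hh, hv]
  have h_mark : dequeue.act σ MARK = σ MARK := h_frame.eq MARK
  have h_visit {τ : Store} (hτ : SearchState G Z T q τ h) (hext : Extends n (σ MARK) (τ MARK))
      (hstep : ∀ x, Step G Z q v x → τ MARK x ≠ 0) : SearchState G Z T q τ (h + 1) :=
    hτ.succ ((hext v (by omega)).trans hv') hstep
  have h_cond : (Expr.sub (sc 0) (sc IMAGE)).eval (dequeue.act σ) = n - σ FLOW v := by
    rw [Expr.eval, hσ'.eval_size, sc, Expr.eval, Expr.eval, h_image]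
  refine (Runs.flat_seq (Runs.cond (T := ((q v).elim 0 fun w => (adj w).length) * 73 + 70)
    (T' := 1) (fun hb => ?_) fun hb => .flat ?_)).mono
    (by simp only [dequeue, Prog.time, set, sc, Expr.cost]; omega) fun _ h => h
  · rw [h_cond] at hb
    have hw : toVertex n (σ FLOW v) = some ⟨σ FLOW v, Nat.lt_of_sub_ne_zero hb⟩ :=
      toVertex_eq_some.2 rfl
    rw [← hq v, hw]
    refine (runs_visitClosedNbhd hadj hσ' (h_frame.eq BLOCKED ▸ hZ) hI h_current
      (by rw [h_mark, hv']; exact h.succ_ne_zero) h_image (hq v ▸ hw)).imp le_rfl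
      fun τ hf ⟨hτ, hext, hstep⟩ => ?_
    rw [h_mark] at hext
    exact ⟨h_visit hτ hext hstep, hext, hf.eq HEAD ▸ h_head⟩
  · rw [h_cond] at hb
    refine ⟨h_visit hI (fun _ _ => rfl) fun x ⟨_, w, hw, _⟩ => ?_, fun _ _ => rfl, h_head⟩
    rw [← hq v, toVertex_eq_none.2 (by omega)] at hw
    cases hw

/-- Expand the vertices of the queue until it is empty. -/
def searchLoop : Prog := .loop (.sub (sc TAIL) (sc HEAD)) expand

theorem sum_add_le_sum {ι : Type*} [Fintype ι] {f g : ι → ℕ} {c : ℕ} (i : ι)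
    (h : ∀ j, f j ≤ g j) (hi : f i + c ≤ g i) : ∑ j, f j + c ≤ ∑ j, g j := by
  classical
  calc ∑ j, f j + c = ∑ j ∈ Finset.univ.erase i, f j + (f i + c) := by
        rw [← Finset.sum_erase_add _ _ (Finset.mem_univ i), add_assoc]
    _ ≤ ∑ j ∈ Finset.univ.erase i, g j + g i := add_le_add (Finset.sum_le_sum fun j _ => h j) hi
    _ = ∑ j, g j := Finset.sum_erase_add _ _ (Finset.mem_univ i)

theorem sum_length_image_le (adj : Fin n → List (Fin n))
    (hq : ∀ u u' w, q u = some w → q u' = some w → u = u') :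
    ∑ u, ((q u).elim 0 fun w => (adj w).length) ≤ ∑ u, (adj u).length := by
  classical
  have h_elim (u : Fin n) : ((q u).elim 0 fun w => (adj w).length) =
      ∑ w, if q u = some w then (adj w).length else 0 := by
    cases q u <;> simp
  simp only [h_elim]
  rw [Finset.sum_comm]
  refine Finset.sum_le_sum fun w _ => ?_
  rw [← Finset.sum_filter, Finset.sum_const, smul_eq_mul]
  refine mul_le_of_le_one_left (Nat.zero_le _) (Finset.card_le_one.2 fun u hu u' hu' => ?_)
  exact hq u u' w (Finset.mem_filter.1 hu).2 (Finset.mem_filter.1 hu').2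

theorem runs_searchLoop (hadj : IsAdjList G adj) (hσ : HasInput adj k S σ)
    (hZ : marked n (σ BLOCKED) = Z) (hq : ∀ u : Fin n, toVertex n (σ FLOW u) = q u)
    (hinj : ∀ u u' w, q u = some w → q u' = some w → u = u') (hT : T ⊆ marked n (σ MARK))
    (hh : σ HEAD 0 = 0) (hI : SearchState G Z T q σ 0) :
    Runs searchLoop σ ((∑ u, (adj u).length) * 73 + n * 120 + 6) fun σ' =>
      marked n (σ' MARK) = residualReach G Z T q ∧ IsSearchTree G Z T q (σ' MARK) (σ' PARENT) := by
  -- Every marked vertex outside the processed part of the queue still has to pay for its expansion.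
  let pay (τ : Store) (u : Fin n) : ℕ := if τ MARK u ≠ 0 ∧ τ MARK u ≤ τ HEAD 0 then 0 else
    ((q u).elim 0 fun w => (adj w).length) * 73 + 120
  have h_pay : ∑ u, pay σ u ≤ (∑ u, (adj u).length) * 73 + n * 120 := by
    calc ∑ u, pay σ u ≤ ∑ u, (((q u).elim 0 fun w => (adj w).length) * 73 + 120) :=
          Finset.sum_le_sum fun u _ => by simp only [pay]; split <;> omega
      _ = (∑ u, ((q u).elim 0 fun w => (adj w).length)) * 73 + n * 120 := by
          rw [Finset.sum_add_distrib, Finset.sum_mul]; simp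
      _ ≤ _ := by grw [sum_length_image_le adj hinj]
  refine (Runs.loop (I := fun τ => SearchState G Z T q τ (τ HEAD 0) ∧ T ⊆ marked n (τ MARK))
    (φ := fun τ => ∑ u, pay τ u) ⟨by rwa [hh], hT⟩ fun τ hf ⟨hIτ, hTτ⟩ hb => ?_).mono
    (by grw [h_pay]; simp [sc, Expr.cost]) fun τ ⟨⟨hIτ, hTτ⟩, hb⟩ => ?_
  · have h_lt : τ HEAD 0 < τ TAIL 0 := Nat.lt_of_sub_ne_zero hb
    obtain ⟨v, hv, hv'⟩ := hIτ.mark_queue _ h_lt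
    refine ⟨_, (runs_expand hadj (hσ.of_frame hf) (hf.eq BLOCKED ▸ hZ) (hf.eq FLOW ▸ hq) hIτ rfl hv
      hv').mono le_rfl fun ρ ⟨hIρ, hext, hρ⟩ => ⟨⟨hρ ▸ hIρ, fun u hu => hext.ne_zero (hTτ hu)⟩, ?_⟩⟩
    have h_le := sum_add_le_sum (f := pay ρ) (g := pay τ)
      (c := ((q v).elim 0 fun w => (adj w).length) * 73 + 120) v (fun u => ?_) ?_
    · simp only [sc, Expr.cost]
      omega
    · by_cases hu : τ MARK u ≠ 0 ∧ τ MARK u ≤ τ HEAD 0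
      · simp only [pay, hext u hu.1, hρ]
        rw [if_pos ⟨hu.1, by omega⟩]
        exact Nat.zero_le _
      · simp only [pay, if_neg hu]
        split <;> omega
    · simp only [pay, hext v (by omega), hρ]
      rw [if_pos ⟨by omega, by omega⟩, if_neg (by omega)]
      omega
  · have h_eq : τ TAIL 0 = τ HEAD 0 := le_antisymm (Nat.sub_eq_zero_iff_le.1 hb) hIτ.head_le
    refine ⟨SearchInv.marked_eq (tail := τ TAIL 0) (h_eq ▸ hIτ) hTτ, hIτ.tree⟩

/-- Compute the vertices that can be reached from `START` by steps of the flow `FLOW` in the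
complement of `BLOCKED`, in breadth-first order. -/
def search : Prog :=
  fill MARK (.lit 0) ⨾ (set TAIL (.lit 0) ⨾ set CURRENT (sc 0)) ⨾ visitStart ⨾
    set HEAD (.lit 0) ⨾ searchLoop

theorem runs_search (hadj : IsAdjList G adj) (hσ : HasInput adj k S σ)
    (hT : marked n (σ START) = T) (hZ : marked n (σ BLOCKED) = Z) (hZT : Disjoint Z T)
    (hq : ∀ u : Fin n, toVertex n (σ FLOW u) = q u)
    (hinj : ∀ u u' w, q u = some w → q u' = some w → u = u') :
    Runs search σ (400 * size adj) fun σ' =>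
      marked n (σ' MARK) = residualReach G Z T q ∧ IsSearchTree G Z T q (σ' MARK) (σ' PARENT) := by
  refine ((runs_fill (f := fun _ => 0) hσ fun _ _ _ _ _ => rfl).seq
    (T' := 7 + (n * 70 + 9 + (3 + ((∑ u, (adj u).length) * 73 + n * 120 + 6))))
    fun σ₁ hf₁ h₁ => ?_).mono (by simp only [size, Expr.cost]; omega) fun _ h => h
  have hσ₁ := hσ.of_frame hf₁
  have hT₁ : marked n (σ₁ START) = T := hf₁.eq START ▸ hT
  have hZ₁ : marked n (σ₁ BLOCKED) = Z := hf₁.eq BLOCKED ▸ hZ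
  have hq₁ : ∀ u : Fin n, toVertex n (σ₁ FLOW u) = q u := hf₁.eq FLOW ▸ hq
  have h_init : SearchState G Z T q ((set TAIL (.lit 0) ⨾ set CURRENT (sc 0)).act σ₁) 0 := by
    have h_none (u : Fin n) (hu : σ₁ MARK u ≠ 0) : False := hu (h₁ u)
    exact ⟨⟨fun i hi => absurd hi i.not_lt_zero, fun u hu => (h_none u hu).elim⟩,
      fun u hu => (h_none u hu).elim, fun u hu => (h_none u hu).elim,
      fun u hu => (h_none u hu).elim, Nat.zero_le _⟩
  have hf₂ := frame_act (set TAIL (.lit 0) ⨾ set CURRENT (sc 0)) σ₁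
  refine Runs.flat_seq <| (runs_visitStart (hσ₁.of_frame hf₂) hT₁ hZ₁ hZT hσ₁.size h_init).seq
    fun σ₃ hf₃ ⟨hI, hT'⟩ => ?_
  have hσ₃ := (hσ₁.of_frame hf₂).of_frame hf₃
  refine Runs.flat_seq <| runs_searchLoop hadj (hσ₃.of_frame (frame_act _ _)) ?_ (fun u => ?_) hinj
    hT' rfl hI
  · exact (congrArg (marked n) (hf₃.eq BLOCKED)).trans hZ₁
  · exact (congrArg (fun f => toVertex n (f u)) (hf₃.eq FLOW)).trans (hq₁ u)

end Search

section MaxFlow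

variable {n : ℕ} {G : SimpleGraph (Fin n)} {adj : Fin n → List (Fin n)} {k : ℕ}
  {S : Finset (Fin n)} {σ : Store} {Z T : Set (Fin n)} {q q₀ : Fin n → Option (Fin n)}
  {mark : ℕ → ℕ} {x x' y w : Fin n} {j : ℕ}

/-- The partial map on vertices with table `f`; entries that are not vertices mean `none`. -/
def vertexMap (n : ℕ) (f : ℕ → ℕ) (u : Fin n) : Option (Fin n) := toVertex n (f u)

theorem vertexMap_update (f : ℕ → ℕ) (x : Fin n) (c : ℕ) :
    vertexMap n (Function.update f x c) = Function.update (vertexMap n f) x (toVertex n c) := by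
  ext1 u
  by_cases h : u = x
  · simp [vertexMap, h]
  · simp [vertexMap, h, Fin.val_ne_of_ne h]

/-- `q` arises from the flow `q₀` by augmentation along the part of the search path behind `x`. -/
structure IsAugmenting (G : SimpleGraph (Fin n)) (Z T : Set (Fin n)) (mark : ℕ → ℕ)
    (q₀ q : Fin n → Option (Fin n)) (x : Fin n) : Prop where
  mark_ne : mark x ≠ 0
  isFlow : IsFlow G Z (insert x T) (Function.update q x none)
  ncard_none : {u | Function.update q x none u = none}.ncard = {u | q₀ u = none}.ncard + 1
  unchanged : ∀ u : Fin n, mark u ≤ mark x → q u = q₀ u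

theorem update_update_eq_comp_swap (h : x' ≠ x) :
    Function.update (Function.update q x (q x')) x' none =
      Function.update q x none ∘ Equiv.swap x x' := by
  ext1 u
  simp only [Function.comp, Equiv.swap_apply_def, Function.update_apply]
  split_ifs <;> simp_all

theorem IsAugmenting.step (h : IsAugmenting G Z T mark q₀ q x) (hx' : mark x' ≠ 0)
    (hlt : mark x' < mark x) (hZ : x' ∉ Z) (hs : Step G Z q₀ x' x) :
    IsAugmenting G Z T mark q₀ (Function.update q x (q x')) x' := by
  have hne : x' ≠ x := fun h => hlt.ne (congrArg (fun u : Fin n => mark u) h)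
  refine ⟨hx', ?_, ?_, fun u hu => ?_⟩
  · rw [update_update_eq_comp_swap hne]
    refine h.isFlow.swap (Function.update_self ..) hZ ?_
    rwa [Step, Function.update_of_ne hne, h.unchanged x' hlt.le]
  · rw [update_update_eq_comp_swap hne, ncard_none_swap, h.ncard_none]
  · rw [Function.update_of_ne fun hux => (hux ▸ hu).not_gt hlt, h.unchanged u (hu.trans hlt.le)]

/-- Augment the flow along the search path that ends in `END[0]`. -/
def augment : Prog :=
  .loop (.sub (sc 0) (.get PARENT (sc END)))
    (.assign FLOW (sc END) (.get FLOW (.get PARENT (sc END))) ⨾ set END (.get PARENT (sc END))) ⨾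
  .assign FLOW (sc END) (sc 0)

theorem runs_augment (hσ : HasInput adj k S σ) (hq : IsFlow G Z T (vertexMap n (σ FLOW)))
    (hM : Disjoint (marked n (σ MARK)) Z)
    (hP : IsSearchTree G Z T (vertexMap n (σ FLOW)) (σ MARK) (σ PARENT)) (hy : σ END 0 = y)
    (hy' : σ MARK y ≠ 0) (hw : vertexMap n (σ FLOW) y = some w) (hwZ : w ∈ nbhd G Z) :
    Runs augment σ (30 * size adj) fun σ' => IsFlow G Z T (vertexMap n (σ' FLOW)) ∧
      {u | vertexMap n (σ' FLOW) u = none}.ncard =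
        {u | vertexMap n (σ FLOW) u = none}.ncard + 1 := by
  let rank (x : ℕ) : ℕ := (Finset.univ.filter fun u : Fin n => σ MARK u < σ MARK x).card
  have h_rank : rank (σ END 0) ≤ n := by
    simpa using Finset.card_le_univ
      (Finset.univ.filter fun u : Fin n => σ MARK u < σ MARK (σ END 0))
  have h_init : IsAugmenting G Z T (σ MARK) (vertexMap n (σ FLOW)) (vertexMap n (σ FLOW)) y :=
    ⟨hy', hq.remove hw hwZ (hM.notMem_of_mem_left hy'), ncard_none_update hw, fun _ _ => rfl⟩
  refine ((Runs.loop (φ := fun τ => 19 * rank (τ END 0)) (I := fun τ => ∃ x : Fin n, τ END 0 = x ∧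
    IsAugmenting G Z T (σ MARK) (vertexMap n (σ FLOW)) (vertexMap n (τ FLOW)) x)
    ⟨y, hy, h_init⟩ ?_).seq (T' := 5) fun τ hf ⟨⟨x, hx, hI⟩, hb⟩ => .flat ?_).mono
    (by simp only [Expr.cost, sc, size]; omega) fun _ h => h
  · rintro τ hf ⟨x, hx, hI⟩ hb
    rw [Expr.eval, (hσ.of_frame hf).eval_size, Expr.eval, sc, Expr.eval, Expr.eval, hx,
      hf.eq PARENT] at hb
    obtain ⟨hp, -⟩ | ⟨x', hp, hx', hlt, hs⟩ := hP x hI.mark_ne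
    · rw [toVertex_eq_none] at hp
      omega
    rw [toVertex_eq_some] at hp
    refine ⟨12, .flat ?_⟩
    simp only [Prog.act, set, sc, Expr.eval, hx, hf.eq PARENT, hp, Store.write, ne_eq,
      Function.update_self, Function.update_of_ne, Nat.reduceEqDiff, not_false_eq_true,
      Expr.cost]
    refine ⟨⟨x', rfl, vertexMap_update _ x _ ▸ hI.step hx' hlt (hM.notMem_of_mem_left hx') hs⟩, ?_⟩
    have : rank x' < rank x := Finset.card_lt_card <| Finset.ssubset_iff_of_subset
      (fun u hu => by simp at hu ⊢; omega) |>.2 ⟨x', by simpa using hlt, by simp⟩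
    omega
  · have hn : (sc 0).eval τ = n := (hσ.of_frame hf).eval_size
    rw [Expr.eval, hn, Expr.eval, sc, Expr.eval, Expr.eval, hx, hf.eq PARENT] at hb
    have hxT : x ∈ T := by
      obtain ⟨-, h⟩ | ⟨x', hp, -⟩ := hP x hI.mark_ne
      · exact h
      · have := toVertex_eq_some.1 hp
        omega
    rw [Prog.act, hn, sc, Expr.eval, Expr.eval, hx, Store.write_same, vertexMap_update,
      toVertex_eq_none.2 le_rfl]
    exact ⟨Set.insert_eq_of_mem hxT ▸ hI.isFlow, hI.ncard_none⟩

/-- The vertex `NUM_VERTEX[0]` has been visited and its image is adjacent to the blocked set. -/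
def isEnd : Expr :=
  .both (.get MARK (sc NUM_VERTEX)) (.both (.sub (sc 0) (.get FLOW (sc NUM_VERTEX)))
    (.get NBHD (.get FLOW (sc NUM_VERTEX))))

/-- `END[0]` becomes the end of an augmenting path, or `n` if there is none. -/
def findEnd : Prog := search ⨾ find END isEnd

/-- The state between two rounds of augmentation, after `j` rounds. -/
structure FlowState (adj : Fin n → List (Fin n)) (k : ℕ) (S : Finset (Fin n))
    (G : SimpleGraph (Fin n)) (Z T : Set (Fin n)) (j : ℕ) (σ : Store) : Prop where
  input : HasInput adj k S σ
  start : marked n (σ START) = T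
  blocked : marked n (σ BLOCKED) = Z
  nbhd : marked n (σ NBHD) = nbhd G Z
  isFlow : IsFlow G Z T (vertexMap n (σ FLOW))
  value : σ VALUE 0 = {u | vertexMap n (σ FLOW) u = none}.ncard
  value_le : σ VALUE 0 ≤ j
  progress : σ VALUE 0 = j ∨
    marked n (σ MARK) = residualReach G Z T (vertexMap n (σ FLOW)) ∧
    ∀ u ∈ residualReach G Z T (vertexMap n (σ FLOW)), ∀ w, vertexMap n (σ FLOW) u = some w →
      w ∉ LocalDecomp.nbhd G Z

theorem runs_findEnd (hadj : IsAdjList G adj) (hZT : Disjoint Z T)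
    (h : FlowState adj k S G Z T j σ) :
    Runs findEnd σ (500 * size adj) fun σ' =>
      marked n (σ' MARK) = residualReach G Z T (vertexMap n (σ FLOW)) ∧
      IsSearchTree G Z T (vertexMap n (σ FLOW)) (σ' MARK) (σ' PARENT) ∧
      IsLast n (fun u => u ∈ residualReach G Z T (vertexMap n (σ FLOW)) ∧
        ∃ w, vertexMap n (σ FLOW) u = some w ∧ w ∈ nbhd G Z) (σ' END 0) := by
  refine ((runs_search (q := vertexMap n (σ FLOW)) hadj h.input h.start h.blocked hZT
    (fun _ => rfl) h.isFlow.inj).seq (T' := n * 60 + 20) fun σ₁ hf₁ ⟨hM, hP⟩ =>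
    (runs_find (h.input.of_frame hf₁) (fun u τ hf hu => ?_)).imp ?_ fun σ₂ hf₂ h_end =>
    ⟨(congrArg (marked n) (hf₂.eq MARK)).trans hM, hf₂.eq MARK ▸ hf₂.eq PARENT ▸ hP, h_end⟩).mono
    ?_ fun _ h => h
  · have hn : (sc 0).eval τ = n := ((h.input.of_frame hf₁).of_frame hf).eval_size
    have hN (w : Fin n) : σ NBHD w ≠ 0 ↔ w ∈ nbhd G Z := h.nbhd ▸ Iff.rfl
    rw [isEnd, Expr.eval_both, Expr.eval_both, ← hM, Expr.eval, Expr.eval, Expr.eval, Expr.eval,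
      Expr.eval, hn, sc, Expr.eval, Expr.eval, hu, hf.eq MARK, hf.eq FLOW, hf.eq NBHD, hf₁.eq FLOW,
      hf₁.eq NBHD]
    refine and_congr_right fun _ => ⟨fun ⟨hlt, hne⟩ => ?_, fun ⟨w, hw, hwN⟩ => ?_⟩
    · have hlt := Nat.lt_of_sub_ne_zero hlt
      exact ⟨⟨_, hlt⟩, toVertex_eq_some.2 rfl, (hN ⟨_, hlt⟩).1 hne⟩
    · rw [toVertex_eq_some.1 hw]
      exact ⟨Nat.sub_ne_zero_of_lt w.2, (hN w).2 hwN⟩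
  · simp only [isEnd, Expr.both, Expr.neg, Expr.cost, sc]
    omega
  · simp only [size]
    omega

/-- Augment the flow, if possible. -/
def round : Prog :=
  findEnd ⨾ .cond (.sub (sc 0) (sc END)) (augment ⨾ set VALUE (.add (sc VALUE) (.lit 1))) .skip

theorem runs_round (hadj : IsAdjList G adj) (hZT : Disjoint Z T)
    (h : FlowState adj k S G Z T j σ) :
    Runs round σ (600 * size adj) (FlowState adj k S G Z T (j + 1)) := by
  refine ((runs_findEnd hadj hZT h).seq (T' := 6 + (30 * size adj + 6 + 1))
    fun σ₁ hf ⟨hM, hP, h_end⟩ => ?_).mono (by simp only [size]; omega) fun _ h => h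
  have hσ₁ := h.input.of_frame hf
  have hb : (Expr.sub (sc 0) (sc END)).eval σ₁ = n - σ₁ END 0 := by
    rw [Expr.eval, hσ₁.eval_size]
    rfl
  refine Runs.cond (fun hb' => ?_) fun hb' => .flat ?_
  · rw [hb] at hb'
    obtain ⟨h_eq, -⟩ | ⟨y, hy, ⟨hyM, w, hw, hwN⟩, -⟩ := h_end
    · omega
    refine (runs_augment (Z := Z) (T := T) (w := w) hσ₁ (hf.eq FLOW ▸ h.isFlow) ?_
      (hf.eq FLOW ▸ hP) hy (hM ▸ hyM : y ∈ marked n (σ₁ MARK)) (hf.eq FLOW ▸ hw) hwN).seq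
      fun σ₂ hf₂ ⟨hq, h_card⟩ => .flat ?_
    · exact hM ▸ (disjoint_residualReach hZT).symm
    have h_value : σ VALUE 0 = j := h.progress.resolve_right fun h => h.2 y hyM w hw hwN
    have h_val : (set VALUE (.add (sc VALUE) (.lit 1))).act σ₂ VALUE 0 = j + 1 := by
      simp [set, sc, Prog.act, Expr.eval, hf₂.eq VALUE, hf.eq VALUE, h_value]
    have hf₃ := frame_act (set VALUE (.add (sc VALUE) (.lit 1))) σ₂
    refine ⟨(hσ₁.of_frame hf₂).of_frame hf₃, ?_, ?_, ?_, hq, ?_, h_val.le, .inl h_val⟩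
    · rw [hf₃.eq START, hf₂.eq START, hf.eq START, h.start]
    · rw [hf₃.eq BLOCKED, hf₂.eq BLOCKED, hf.eq BLOCKED, h.blocked]
    · rw [hf₃.eq NBHD, hf₂.eq NBHD, hf.eq NBHD, h.nbhd]
    · rw [h_val, hf₃.eq FLOW, h_card, hf.eq FLOW, ← h.value, h_value]
  · rw [hb] at hb'
    obtain ⟨-, h_none⟩ | ⟨y, hy, -⟩ := h_end
    · refine ⟨hσ₁, ?_, ?_, ?_, ?_, ?_, ?_, .inr ?_⟩
      · rw [Prog.act, hf.eq START, h.start]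
      · rw [Prog.act, hf.eq BLOCKED, h.blocked]
      · rw [Prog.act, hf.eq NBHD, h.nbhd]
      · rw [Prog.act, hf.eq FLOW]
        exact h.isFlow
      · rw [Prog.act, hf.eq FLOW, hf.eq VALUE, h.value]
      · rw [Prog.act, hf.eq VALUE]
        exact h.value_le.trans (Nat.le_succ j)
      · rw [Prog.act, hf.eq FLOW]
        exact ⟨hM, fun u hu w hw hwN => h_none u ⟨hu, w, hw, hwN⟩⟩
    · omega

/-- Prepare the computation of a flow from `SINK` to `SOURCE`. -/
def initFlow : Prog :=
  fill FLOW (sc NUM_VERTEX) ⨾ fill START (.get SINK (sc NUM_VERTEX)) ⨾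
    fill BLOCKED (.get SOURCE (sc NUM_VERTEX)) ⨾ fill MEMBER (.get SOURCE (sc NUM_VERTEX)) ⨾
    findNbhd ⨾ set VALUE (.lit 0)

theorem marked_congr {f g : ℕ → ℕ} (h : ∀ u : Fin n, f u = g u) : marked n f = marked n g := by
  ext u
  rw [mem_marked, mem_marked, h]

theorem runs_initFlow (hadj : IsAdjList G adj) (hσ : HasInput adj k S σ)
    (hZ : marked n (σ SOURCE) = Z) (hT : marked n (σ SINK) = T) :
    Runs initFlow σ (350 * size adj) (FlowState adj k S G Z T 0) := by
  refine ((runs_fill (e := sc NUM_VERTEX) (f := fun u => u) hσ fun u _ _ h _ => h).seq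
    (T' := (n * 23 + 20) + ((n * 23 + 20) + ((n * 23 + 20) + (150 * size adj + 3))))
    fun σ₁ hf₁ h₁ => ?_).mono (by simp only [size, sc, Expr.cost]; omega) fun _ h => h
  have hσ₁ := hσ.of_frame hf₁
  refine (runs_copy hσ₁).seq fun σ₂ hf₂ h₂ => ?_
  have hσ₂ := hσ₁.of_frame hf₂
  refine (runs_copy hσ₂).seq fun σ₃ hf₃ h₃ => ?_
  have hσ₃ := hσ₂.of_frame hf₃
  refine (runs_copy hσ₃).seq fun σ₄ hf₄ h₄ => ?_
  have hσ₄ := hσ₃.of_frame hf₄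
  refine (runs_findNbhd hadj hσ₄).seq fun σ₅ hf₅ h₅ => .flat ?_
  have hf₆ := frame_act (set VALUE (.lit 0)) σ₅
  have h_flow : vertexMap n ((set VALUE (.lit 0)).act σ₅ FLOW) = some := by
    ext1 u
    rw [hf₆.eq FLOW, hf₅.eq FLOW, hf₄.eq FLOW, hf₃.eq FLOW, hf₂.eq FLOW, vertexMap, h₁ u,
      toVertex_val]
  have h_value : (set VALUE (.lit 0)).act σ₅ VALUE 0 = 0 := rfl
  refine ⟨(hσ₄.of_frame hf₅).of_frame hf₆, ?_, ?_, ?_, ?_, ?_, h_value.le, .inl h_value⟩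
  · rw [hf₆.eq START, hf₅.eq START, hf₄.eq START, hf₃.eq START, ← hT, ← hf₁.eq SINK]
    exact marked_congr h₂
  · rw [hf₆.eq BLOCKED, hf₅.eq BLOCKED, hf₄.eq BLOCKED, ← hZ, ← hf₁.eq SOURCE, ← hf₂.eq SOURCE]
    exact marked_congr h₃
  · rw [hf₆.eq NBHD, h₅, ← hZ, ← hf₁.eq SOURCE, ← hf₂.eq SOURCE, ← hf₃.eq SOURCE]
    exact congrArg (nbhd G) (marked_congr h₄)
  · rw [h_flow]
    exact isFlow_some
  · rw [h_flow, h_value]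
    simp

/-- Compute a maximum flow from `SINK` to `SOURCE`, up to the value `BOUND[0] + 1`. -/
def computeFlow : Prog := initFlow ⨾ forTo ROUND (.add (sc BOUND) (.lit 1)) round

theorem runs_computeFlow (hadj : IsAdjList G adj) (hσ : HasInput adj k S σ)
    (hZ : marked n (σ SOURCE) = Z) (hT : marked n (σ SINK) = T) (hZT : Disjoint Z T) :
    Runs computeFlow σ ((σ BOUND 0 + 2) * (1000 * size adj))
      (FlowState adj k S G Z T (σ BOUND 0 + 1)) := by
  refine ((runs_initFlow hadj hσ hZ hT).seq fun σ₁ hf₁ h₁ =>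
    (Runs.forTo_const (I := FlowState adj k S G Z T) (m := σ BOUND 0 + 1) (c := 600 * size adj)
      (by decide) (fun τ hf => ?_) ?_ ?_)).mono ?_ fun _ h => h
  · simp [Expr.eval, sc, hf.eq BOUND, hf₁.eq BOUND]
  · exact { h₁ with input := h₁.input.write (by decide) }
  · rintro j - τ - - h
    exact (runs_round hadj hZT h).mono le_rfl fun τ' h' =>
      { h' with input := h'.input.write (by decide) }
  · have : 1 ≤ size adj := Nat.le_add_left _ _
    simp only [sc, Expr.cost]
    nlinarith

end MaxFlow

section Guess

variable {n : ℕ} {G : SimpleGraph (Fin n)} {adj : Fin n → List (Fin n)} {k : ℕ}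
  {S : Finset (Fin n)} {σ σ' τ : Store} {T Z R : Set (Fin n)} {v : Fin n} {p r L : ℕ}
  {E : Option (Set (Fin n))}

/-- Tests whether `NUM_VERTEX[0]` equals `ROOT[0]`. -/
def isRoot : Expr :=
  .neg (.add (.sub (sc NUM_VERTEX) (sc ROOT)) (.sub (sc ROOT) (sc NUM_VERTEX)))

theorem eval_isRoot : isRoot.eval σ = if σ NUM_VERTEX 0 = σ ROOT 0 then 1 else 0 := by
  simp only [isRoot, Expr.neg, Expr.eval, sc]
  split <;> omega

theorem runs_fill_isRoot {a : ℕ} (hσ : HasInput adj k S σ) (hv : σ ROOT 0 = v)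
    (ha : 4 ≤ a := by decide) (ha' : a ≠ NUM_VERTEX := by decide) (ha'' : a ≠ ROOT := by decide) :
    Runs (fill a isRoot) σ (n * 33 + 20) fun σ' => marked n (σ' a) = {v} := by
  refine (runs_fill (f := fun u => if u = v then 1 else 0) hσ (fun u τ hf hu _ => ?_) ha
    ha').mono (by simp only [isRoot, Expr.neg, sc, Expr.cost]; omega) fun σ' h => ?_
  · have h_root : ROOT ∉ (fill a isRoot).mods := by
      simpa [fill, forVertex, forTo, set, Prog.mods] using ha''.symm
    rw [eval_isRoot, hu, hf ROOT h_root, hv]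
    simp only [Fin.ext_iff]
  · ext u
    simp [mem_marked, h]

theorem residualReach_some (hv : v ∉ Z) : residualReach G Z {v} some = reach G Z {v} := by
  refine (residualReach_subset (Set.singleton_subset_iff.2 (mem_reach_self hv)) ?_).antisymm
    (reach_subset (Set.sdiff_subset.trans subset_residualReach) ?_)
  · rintro u hu x ⟨hx, w, ⟨⟩, rfl | hux⟩
    exacts [hu, mem_reach_of_adj hu hx hux]
  · rintro x ⟨hx, u, hu, hux⟩
    by_contra hxZ
    exact hx (mem_residualReach_of_step hu ⟨hxZ, u, rfl, .inr hux⟩)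

/-- `MARK` becomes the component of `ROOT[0]` outside the set in `MARK`. -/
def component : Prog :=
  fill BLOCKED (.get MARK (sc NUM_VERTEX)) ⨾ fill START isRoot ⨾ fill FLOW (sc NUM_VERTEX) ⨾
    search

theorem runs_component (hadj : IsAdjList G adj) (hσ : HasInput adj k S σ) (hv : σ ROOT 0 = v)
    (hM : marked n (σ MARK) = Z) (hvZ : v ∉ Z) :
    Runs component σ (520 * size adj) fun σ' => marked n (σ' MARK) = reach G Z {v} := by
  refine ((runs_copy hσ).seq (T' := n * 33 + 20 + (n * 22 + 20 + 400 * size adj))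
    fun σ₁ hf₁ h₁ => ?_).mono (by simp only [size]; omega) fun _ h => h
  have hσ₁ := hσ.of_frame hf₁
  refine (runs_fill_isRoot hσ₁ ((congrFun (hf₁.eq ROOT) 0).trans hv)).seq fun σ₂ hf₂ h₂ => ?_
  have hσ₂ := hσ₁.of_frame hf₂
  refine (runs_fill (e := sc NUM_VERTEX) (f := fun u => u) hσ₂ fun u _ _ h _ => h).seq
    fun σ₃ hf₃ h₃ => ?_
  refine (runs_search (Z := Z) (q := some) hadj (hσ₂.of_frame hf₃)
    ((congrArg (marked n) (hf₃.eq START)).trans h₂) ?_ (Set.disjoint_singleton_right.2 hvZ)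
    (fun u => by rw [h₃, toVertex_val])
    (isFlow_some (G := G) (Z := Z) (T := {v})).inj).mono le_rfl fun σ₄ h₄ => ?_
  · rw [hf₃.eq BLOCKED, hf₂.eq BLOCKED, marked_congr h₁, hM]
  · rw [h₄.1, residualReach_some hvZ]

/-- `SOURCE` becomes the component of `ROOT[0]` outside the set in `MARK`, and `END[0]` its last
neighbour outside `SINK`. -/
def cut : Prog :=
  component ⨾ fill SOURCE (.get MARK (sc NUM_VERTEX)) ⨾ fill MEMBER (.get MARK (sc NUM_VERTEX)) ⨾
    findNbhd ⨾ find END (.both (.get NBHD (sc NUM_VERTEX)) (.neg (.get SINK (sc NUM_VERTEX))))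

theorem runs_cut (hadj : IsAdjList G adj) (hσ : HasInput adj k S σ) (hv : σ ROOT 0 = v)
    (hM : marked n (σ MARK) = Z) (hvZ : v ∉ Z) (hT : marked n (σ SINK) = T)
    (hR : reach G Z {v} = R) :
    Runs cut σ (900 * size adj) fun σ' =>
      marked n (σ' SOURCE) = R ∧ IsLast n (· ∈ nbhd G R \ T) (σ' END 0) := by
  refine ((runs_component hadj hσ hv hM hvZ).seq (T' := n * 23 + 20 + (n * 23 + 20 +
    (150 * size adj + (n * 40 + 20)))) fun σ₁ hf₁ h₁ => ?_).mono (by simp only [size]; omega)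
    fun _ h => h
  have hσ₁ := hσ.of_frame hf₁
  refine (runs_copy hσ₁).seq fun σ₂ hf₂ h₂ => ?_
  have hσ₂ := hσ₁.of_frame hf₂
  refine (runs_copy hσ₂).seq fun σ₃ hf₃ h₃ => ?_
  have hσ₃ := hσ₂.of_frame hf₃
  refine (runs_findNbhd hadj hσ₃).seq fun σ₄ hf₄ h₄ => ?_
  have h_source : marked n (σ₄ SOURCE) = R := by
    rw [hf₄.eq SOURCE, hf₃.eq SOURCE, marked_congr h₂, h₁, hR]
  have h_nbhd : marked n (σ₄ NBHD) = nbhd G R := by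
    rw [h₄, marked_congr h₃, hf₂.eq MARK, h₁, hR]
  have h_sink : marked n (σ₄ SINK) = T := by
    rw [hf₄.eq SINK, hf₃.eq SINK, hf₂.eq SINK, hf₁.eq SINK, hT]
  refine (runs_find (P := (· ∈ nbhd G R \ T)) (hσ₃.of_frame hf₄) fun u τ hf hu => ?_).imp
    (by simp only [Expr.both, Expr.neg, sc, Expr.cost]; omega) fun σ₅ hf₅ h₅ =>
    ⟨(congrArg (marked n) (hf₅.eq SOURCE)).trans h_source, h₅⟩
  rw [Expr.eval_both, Expr.eval_neg, Expr.eval, Expr.eval, sc, Expr.eval, Expr.eval, hu,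
    hf.eq NBHD, hf.eq SINK, Set.mem_sdiff, ← h_nbhd, ← h_sink, mem_marked, mem_marked, not_not]

/-- `BOUND` contains the bound `p` on the size of a cut, `DEPTH` the number of branchings, and
`POWER` the powers of two that decide them. -/
def Tables (p : ℕ) (σ : Store) : Prop :=
  σ BOUND 0 = p ∧ σ DEPTH 0 = 2 * p ∧ ∀ j ≤ 2 * p, σ POWER j = 2 ^ j

theorem Tables.of_frame {q : Prog} (h : Tables p σ) (hf : Frame q σ σ')
    (h5 : q.mods.contains BOUND = false := by rfl) (h6 : q.mods.contains DEPTH = false := by rfl)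
    (h7 : q.mods.contains POWER = false := by rfl) : Tables p σ' := by
  rwa [Tables, hf.eq BOUND h5, hf.eq DEPTH h6, hf.eq POWER h7]

/-- The power of two that decides the next branching. -/
def power : Expr := .get POWER (.sub (sc DEPTH) (.add (sc LEVEL) (.lit 1)))

theorem Tables.eval_power (h : Tables p σ) (hL : σ LEVEL 0 + (L + 1) = 2 * p) :
    power.eval σ = 2 ^ L := by
  have h_exp : σ DEPTH 0 - (σ LEVEL 0 + 1) = L := by rw [h.2.1]; omega
  rw [← h.2.2 L (by omega), power]
  simp only [sc, Expr.eval, h_exp]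

/-- `L` levels before the end, the result of the search that started with `SOURCE`, `SINK` and
`GUESS` as stored will be `E`. -/
def WillReturn (G : SimpleGraph (Fin n)) (p : ℕ) (v : Fin n) (E : Option (Set (Fin n))) :
    ℕ → Store → Prop
  | 0, _ => E = none
  | L + 1, τ => v ∈ marked n (τ SOURCE) ∧ (G.induce (marked n (τ SOURCE))).Connected ∧
      Disjoint (marked n (τ SOURCE)) (marked n (τ SINK)) ∧
      E = branch G p L (τ GUESS 0) (marked n (τ SOURCE)) (marked n (τ SINK))

/-- State of a search with result `E` when `L` levels are left: the search goes on if `STATUS[0]`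
is `0`, it has found a set if `STATUS[0]` is `1`, and it has failed if `STATUS[0]` is `2`. -/
def GuessState (G : SimpleGraph (Fin n)) (p : ℕ) (v : Fin n) (E : Option (Set (Fin n))) (L : ℕ)
    (τ : Store) : Prop :=
  (τ STATUS 0 = 0 ∧ WillReturn G p v E L τ) ∨
    (τ STATUS 0 = 1 ∧ E = some (marked n (τ SOURCE))) ∨ (τ STATUS 0 = 2 ∧ E = none)

theorem GuessState.congr (h : GuessState G p v E L σ) (h10 : σ' SOURCE = σ SOURCE)
    (h11 : σ' SINK = σ SINK) (h30 : σ' STATUS = σ STATUS) (h31 : σ' GUESS = σ GUESS) :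
    GuessState G p v E L σ' := by
  cases L with
  | zero => rwa [GuessState, WillReturn, h10, h30]
  | succ => rwa [GuessState, WillReturn, h10, h11, h30, h31]

/-- Move the vertex `END[0]` to `SOURCE` or to `SINK`, as decided by `GUESS[0]`. -/
def branchStep : Prog :=
  .cond (.sub (.add (sc GUESS) (.lit 1)) power)
    (set GUESS (.sub (sc GUESS) power) ⨾ .assign SOURCE (sc END) (.lit 1))
    (.assign SINK (sc END) (.lit 1))

theorem willReturn_branchStep {x : Fin n} (ht : Tables p σ) (hL : σ LEVEL 0 + (L + 1) = 2 * p)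
    (hv : v ∈ Z) (hR : IsFurthestCut G Z T R) (hp : (nbhd G R).ncard ≤ p)
    (hx : IsGreatest (nbhd G R \ T) x) (h_source : marked n (σ SOURCE) = R)
    (h_sink : marked n (σ SINK) = T) (h_end : σ END 0 = x) :
    WillReturn G p v (branch G p (L + 1) (σ GUESS 0) Z T) (L + 1) (branchStep.act σ) := by
  have h_act : branchStep.act σ = if 2 ^ L ≤ σ GUESS 0
      then (σ.write GUESS 0 (σ GUESS 0 - 2 ^ L)).write SOURCE x 1 else σ.write SINK x 1 := by
    simp only [branchStep, Prog.act, Expr.eval, ht.eval_power hL, set, sc, Store.write_ne, ne_eq,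
      Nat.reduceEqDiff, not_false_eq_true, h_end, ← Nat.lt_succ_iff, Nat.sub_ne_zero_iff_lt,
      Nat.succ_eq_add_one]
  have hvR : v ∈ R := hR.subset hv
  rw [h_act, branch_succ hR hp hx]
  split_ifs with h
  · have h_source' : marked n (((σ.write GUESS 0 (σ GUESS 0 - 2 ^ L)).write SOURCE x 1) SOURCE) =
        insert x R := by
      rw [Store.write_same, marked_update one_ne_zero, Store.write_ne _ _ _ (by decide), h_source]
    have h_sink' : marked n (((σ.write GUESS 0 (σ GUESS 0 - 2 ^ L)).write SOURCE x 1) SINK) =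
        T := h_sink
    rw [WillReturn, h_source', h_sink']
    exact ⟨.inr hvR, connected_induce_insert hR.connected hx.1.1,
      Set.disjoint_insert_left.2 ⟨hx.1.2, hR.disjoint⟩, rfl⟩
  · have h_source' : marked n (σ.write SINK x 1 SOURCE) = R := h_source
    have h_sink' : marked n (σ.write SINK x 1 SINK) = insert x T := by
      rw [Store.write_same, marked_update one_ne_zero, h_sink]
    rw [WillReturn, h_source', h_sink']
    exact ⟨hvR, hR.connected, Set.disjoint_insert_right.2 ⟨hx.1.1.1, hR.disjoint⟩, rfl⟩

/-- Branch on `END[0]`, or return `SOURCE` if that is not a vertex. -/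
def descend : Prog := .cond (.sub (sc 0) (sc END)) branchStep (set STATUS (.lit 1))

theorem guessState_descend (hσ : HasInput adj k S σ) (ht : Tables p σ)
    (hL : σ LEVEL 0 + L = 2 * p) (h_status : σ STATUS 0 = 0) (hv : v ∈ Z)
    (hR : IsFurthestCut G Z T R) (hp : (nbhd G R).ncard ≤ p) (h_source : marked n (σ SOURCE) = R)
    (h_sink : marked n (σ SINK) = T) (h_end : IsLast n (· ∈ nbhd G R \ T) (σ END 0)) :
    GuessState G p v (branch G p L (σ GUESS 0) Z T) L (descend.act σ) := by
  rcases h_end with ⟨h_end, h_none⟩ | ⟨x, h_end, hx⟩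
  · have h_subset : nbhd G R ⊆ T := fun x hx => by_contra fun hxT => h_none x ⟨hx, hxT⟩
    have h_act : descend.act σ = σ.write STATUS 0 1 := by
      simp [descend, Prog.act, Expr.eval, sc, set, hσ.size, h_end]
    refine .inr (.inl ⟨by simp [h_act], ?_⟩)
    rw [branch_of_subset hR hp h_subset, h_act, Store.write_ne _ _ _ (by decide), h_source]
  · have h_act : descend.act σ = branchStep.act σ := by
      simp [descend, Prog.act, Expr.eval, sc, hσ.size, h_end, Nat.sub_ne_zero_of_lt x.2]
    rw [h_act]
    refine .inl ⟨by rwa [(frame_act branchStep σ).eq STATUS], ?_⟩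
    cases L with
    | zero => exact branch_zero_of_mem hR hx.1
    | succ L => exact willReturn_branchStep ht hL hv hR hp hx h_source h_sink h_end

/-- One level of the search. -/
def level : Prog :=
  computeFlow ⨾ .cond (.sub (sc VALUE) (sc BOUND)) (set STATUS (.lit 2)) (cut ⨾ descend)

theorem runs_cut_descend (hadj : IsAdjList G adj) (ht : Tables p σ) (hroot : σ ROOT 0 = v)
    (hL : σ LEVEL 0 + L = 2 * p) (h_status : σ STATUS 0 = 0) (h_sink : marked n (σ SINK) = T)
    (hZ : (G.induce Z).Connected) (hv : v ∈ Z) (hZT : Disjoint Z T)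
    (hflow : FlowState adj k S G Z T (p + 1) σ) (h_value : σ VALUE 0 ≤ p) :
    Runs (cut ⨾ descend) σ (950 * size adj)
      (GuessState G p v (branch G p L (σ GUESS 0) Z T) L) := by
  obtain ⟨h_mark, h_stuck⟩ := hflow.progress.resolve_left (by omega)
  obtain ⟨hR, h_card⟩ := hflow.isFlow.isFurthestCut hZ hv hZT h_stuck
  have hvM : v ∉ residualReach G Z T (vertexMap n (σ FLOW)) :=
    (disjoint_residualReach hZT).notMem_of_mem_left hv
  refine ((runs_cut hadj hflow.input hroot h_mark hvM h_sink rfl).seq (T' := 50)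
    fun σ₁ hf₁ h₁ => .flat ?_).mono (by simp only [size]; omega) fun _ h => h
  rw [← hf₁.eq GUESS]
  refine guessState_descend (hflow.input.of_frame hf₁) (ht.of_frame hf₁) ?_ ?_ hv hR
    (by rwa [h_card, ← hflow.value]) h₁.1 ?_ h₁.2
  · rwa [hf₁.eq LEVEL]
  · rwa [hf₁.eq STATUS]
  · rwa [hf₁.eq SINK]

theorem runs_level (hadj : IsAdjList G adj) (hσ : HasInput adj k S σ) (ht : Tables p σ)
    (hroot : σ ROOT 0 = v) (hL : σ LEVEL 0 + L = 2 * p) (h_status : σ STATUS 0 = 0)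
    (h : WillReturn G p v E (L + 1) σ) :
    Runs level σ ((p + 2) * (2000 * size adj)) (GuessState G p v E L) := by
  obtain ⟨hv, hZ, hZT, rfl⟩ := h
  have h_flow := runs_computeFlow hadj hσ rfl rfl hZT
  rw [ht.1] at h_flow
  refine (h_flow.seq (T' := 960 * size adj) fun σ₁ hf₁ h₁ => ?_).mono (by nlinarith)
    fun _ h => h
  have ht₁ := ht.of_frame hf₁
  have h_eval : (Expr.sub (sc VALUE) (sc BOUND)).eval σ₁ = σ₁ VALUE 0 - p := by rw [← ht₁.1]; rfl
  refine (Runs.cond (T := 3) (T' := 950 * size adj) (fun hb => .flat ?_) fun hb => ?_).mono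
    (by simp only [sc, Expr.cost, size]; omega) fun _ h => h
  · obtain ⟨R, hR⟩ := exists_isFurthestCut hZ hZT
    have h_le := h₁.isFlow.ncard_none_le hR.subset hR.disjoint
    rw [← h₁.value] at h_le
    exact .inr (.inr ⟨rfl, branch_of_lt hR (by omega)⟩)
  · rw [← hf₁.eq GUESS]
    refine runs_cut_descend hadj ht₁ ?_ ?_ ?_ ?_ hZ hv hZT h₁ (by omega)
    · rwa [hf₁.eq ROOT]
    · rwa [hf₁.eq LEVEL]
    · rwa [hf₁.eq STATUS]
    · rw [hf₁.eq SINK]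

/-- Prepare the search from `ROOT[0]` with guess `g`; a root in the terminal set fails at once. -/
def initGuess (g : Expr) : Prog :=
  fill SOURCE isRoot ⨾ fill SINK (.get 3 (sc NUM_VERTEX)) ⨾ set GUESS g ⨾
    set STATUS (.add (.get 3 (sc ROOT)) (.get 3 (sc ROOT)))

open Classical in
/-- The set that the search from the vertex `v` with guess `r` returns. -/
noncomputable def candidate (G : SimpleGraph (Fin n)) (p : ℕ) (S : Set (Fin n)) (v : Fin n)
    (r : ℕ) : Option (Set (Fin n)) :=
  if v ∈ S then none else branch G p (2 * p) r {v} S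

theorem runs_initGuess {a : ℕ} (hσ : HasInput adj k S σ) (hroot : σ ROOT 0 = v)
    (hr : σ a 0 = r) (ha : a ∉ (initGuess (.lit 0)).mods := by decide) :
    Runs (initGuess (sc a)) σ (100 * size adj)
      (GuessState G p v (candidate G p S v r) (2 * p + 1)) := by
  have ha' : a ∉ (fill SOURCE isRoot).mods ∧ a ∉ (fill SINK (.get 3 (sc NUM_VERTEX))).mods := by
    simp only [initGuess, Prog.mods, List.mem_append, not_or] at ha
    exact ⟨ha.1, ha.2.1⟩
  refine ((runs_fill_isRoot hσ hroot).seq (T' := n * 23 + 20 + 13) fun σ₁ hf₁ h₁ => ?_).mono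
    (by simp only [size]; omega) fun _ h => h
  have hσ₁ := hσ.of_frame hf₁
  refine (runs_copy hσ₁).seq fun σ₂ hf₂ h₂ => .flat ?_
  have h_source : marked n (σ₂ SOURCE) = {v} := by rw [hf₂.eq SOURCE, h₁]
  have h_sink : marked n (σ₂ SINK) = S := (marked_congr h₂).trans hσ₁.marked_terminals
  have h_guess : σ₂ a 0 = r := by rw [hf₂ a ha'.2, hf₁ a ha'.1, hr]
  have h_root : σ₂ ROOT 0 = v := by rw [hf₂.eq ROOT, hf₁.eq ROOT, hroot]
  have h_terminal : σ₂ 3 v = if v ∈ (S : Set (Fin n)) then 1 else 0 := by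
    rw [(hσ₁.of_frame hf₂) 3 (by decide)]
    simp [inputStore, ← Fin.ext_iff]
  have h_act : (set GUESS (sc a) ⨾ set STATUS (.add (.get 3 (sc ROOT)) (.get 3 (sc ROOT)))).act
      σ₂ = (σ₂.write GUESS 0 r).write STATUS 0 (σ₂ 3 v + σ₂ 3 v) := by
    simp [Prog.act, set, sc, Expr.eval, h_guess, h_root]
  rw [h_act, h_terminal, candidate]
  split_ifs with hvS
  · exact .inr (.inr ⟨rfl, rfl⟩)
  · refine .inl ⟨rfl, ?_⟩
    have h_source' : marked n (((σ₂.write GUESS 0 r).write STATUS 0 (0 + 0)) SOURCE) = {v} :=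
      h_source
    have h_sink' : marked n (((σ₂.write GUESS 0 r).write STATUS 0 (0 + 0)) SINK) = S := h_sink
    rw [WillReturn, h_source', h_sink']
    exact ⟨rfl, ⟨.of_subsingleton⟩, Set.disjoint_singleton_left.2 hvS, rfl⟩

/-- Search from `ROOT[0]` with the guess `g`. In the end `STATUS[0]` is `1` if the search has found
a set, which is then in `SOURCE`. -/
def guess (g : Expr) : Prog :=
  initGuess g ⨾ forTo LEVEL (.add (sc DEPTH) (.lit 1)) (.cond (sc STATUS) .skip level)

theorem runs_guess {a : ℕ} (hadj : IsAdjList G adj) (hσ : HasInput adj k S σ) (ht : Tables p σ)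
    (hroot : σ ROOT 0 = v) (hr : σ a 0 = r) (ha : a ∉ (initGuess (.lit 0)).mods := by decide) :
    Runs (guess (sc a)) σ ((2 * p + 2) * ((p + 2) * (3000 * size adj))) fun σ' =>
      (σ' STATUS 0 = 1 ∧ candidate G p S v r = some (marked n (σ' SOURCE))) ∨
      (σ' STATUS 0 ≠ 1 ∧ candidate G p S v r = none) := by
  refine ((runs_initGuess (G := G) (p := p) hσ hroot hr ha).seq fun σ₁ hf₁ h₁ =>
    (Runs.forTo_const (m := 2 * p + 1) (c := (p + 2) * (2000 * size adj) + 4)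
      (I := fun j τ => ∃ L, j + L = 2 * p + 1 ∧ GuessState G p v (candidate G p S v r) L τ)
      (by decide) (fun τ hf => ?_) ?_ fun j hj τ hf hτ ⟨L, hL, h⟩ => ?_).mono le_rfl ?_).mono ?_
    fun _ h => h
  · have ht₁ : τ DEPTH 0 = 2 * p := by rw [hf.eq DEPTH, hf₁.eq DEPTH, ht.2.1]
    simp [Expr.eval, sc, ht₁]
  · exact ⟨_, Nat.zero_add _, h₁.congr rfl rfl rfl rfl⟩
  · obtain ⟨L, rfl⟩ : ∃ L', L = L' + 1 := ⟨L - 1, by omega⟩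
    refine (Runs.cond (T := 1) (T' := (p + 2) * (2000 * size adj)) (fun hb => .flat ?_)
      fun hb => ?_).mono (by simp only [sc, Expr.cost]; omega) fun _ h => h
    · exact ⟨L, by omega, .inr (h.resolve_left fun h' => hb h'.1)⟩
    · have h_status : τ STATUS 0 = 0 := hb
      obtain ⟨-, h⟩ := h.resolve_right (by omega)
      have hσ' := (hσ.of_frame (p := initGuess (.lit 0)) hf₁).of_frame hf (by decide +kernel)
      refine (runs_level hadj hσ' ((ht.of_frame hf₁).of_frame hf) ?_ (by omega) h_status h).mono
        le_rfl fun τ' h' => ⟨L, by omega, h'.congr rfl rfl rfl rfl⟩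
      rw [hf.eq ROOT, hf₁.eq ROOT, hroot]
  · rintro τ ⟨L, hL, h | h | h⟩
    · obtain rfl : L = 0 := by omega
      exact .inr ⟨by omega, h.2⟩
    · exact .inl h
    · exact .inr ⟨by omega, h.2⟩
  · have h_one : 1 ≤ size adj := Nat.le_add_left _ _
    have h_size : size adj ≤ (p + 2) * size adj := Nat.le_mul_of_pos_left _ (by omega)
    have h_le : p ≤ p * ((p + 2) * size adj) := Nat.le_mul_of_pos_right _ (by omega)
    simp only [sc, Expr.cost, Nat.mul_left_comm _ 2000, Nat.mul_left_comm _ 3000]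
    nlinarith

end Guess

section Main

variable {n : ℕ} {G : SimpleGraph (Fin n)} {adj : Fin n → List (Fin n)} {k : ℕ}
  {S : Finset (Fin n)} {σ τ : Store} {C : Set (Fin n)} {v : Fin n} {p : ℕ}

/-- Set up `BOUND`, `DEPTH` and `POWER`. -/
def tables : Prog :=
  set BOUND (.add (.get 0 (.lit 1)) (.add (.get 0 (.lit 1)) (.get 0 (.lit 1)))) ⨾
    set DEPTH (.add (sc BOUND) (sc BOUND)) ⨾ set POWER (.lit 1) ⨾
    forTo LEAF (sc DEPTH)
      (.assign POWER (.add (sc LEAF) (.lit 1)) (.add (.get POWER (sc LEAF)) (.get POWER (sc LEAF))))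

theorem runs_tables (hσ : HasInput adj k S σ) :
    Runs tables σ (200 * k + 50) (Tables (3 * k)) := by
  have h_bound : (Expr.add (.get 0 (.lit 1)) (.add (.get 0 (.lit 1)) (.get 0 (.lit 1)))).eval σ =
      3 * k := by
    simp only [Expr.eval, hσ.param]
    omega
  have h_depth : (Expr.add (sc BOUND) (sc BOUND)).eval (σ.write BOUND 0 (3 * k)) =
      2 * (3 * k) := by
    simp only [Expr.eval, sc, Store.write_same, Function.update_self]
    omega
  refine (Runs.flat_seq (Runs.flat_seq (Runs.flat_seq (T := 2 * (3 * k) * 24 + 9) ?_))).mono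
    (by simp only [set, sc, Expr.cost, Prog.time]; omega) fun _ h => h
  change Runs _ (((σ.write BOUND 0 (Expr.eval σ (.add _ _))).write DEPTH 0
    (Expr.eval (σ.write BOUND 0 (Expr.eval σ (.add _ _))) (.add _ _))).write POWER 0 1) _ _
  rw [h_bound, h_depth]
  refine ((Runs.forTo_const (m := 2 * (3 * k)) (c := 12)
    (I := fun j τ => ∀ i ≤ j, τ POWER i = 2 ^ i) (by decide) (fun τ hf => ?_) ?_
    fun j _ τ _ hτ h => .flat fun i hi => ?_).imp ?_ fun τ hf h => ⟨?_, ?_, h⟩)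
  · exact congrFun (hf.eq DEPTH) 0
  · intro i hi
    rw [Nat.le_zero.1 hi]
    rfl
  · simp only [Prog.act, sc, Expr.eval, hτ]
    rw [Store.write_ne _ _ _ (by decide), Store.write_same, Function.update_apply]
    split_ifs with h_eq
    · rw [h_eq, h j le_rfl, pow_succ, mul_two]
    · exact h i (by omega)
  · simp [sc, Expr.cost]
  · exact congrFun (hf.eq BOUND) 0
  · exact congrFun (hf.eq DEPTH) 0

/-- Tests whether the last search has found a set. -/
def isOk : Expr := .neg (.add (.sub (sc STATUS) (.lit 1)) (.sub (.lit 1) (sc STATUS)))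

theorem eval_isOk : isOk.eval σ ≠ 0 ↔ σ STATUS 0 = 1 := by
  simp only [isOk, Expr.neg, Expr.eval, sc]
  omega

/-- Bound for the number of steps of `guess` on an input of size `M`. -/
def guessTime (p M : ℕ) : ℕ := (2 * p + 2) * ((p + 2) * (3000 * M))

theorem IsLast.lt_iff {P : Fin n → Prop} {x : ℕ} (h : IsLast n P x) : x < n ↔ ∃ u, P u := by
  rcases h with ⟨rfl, h⟩ | ⟨u, rfl, h⟩
  · simpa using h
  · exact ⟨fun _ => ⟨u, h.1⟩, fun _ => u.2⟩

/-- Set `TOP[0]` to `0` if `CANDIDATE` is a proper subset of `SOURCE`. -/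
def compareSets : Prog :=
  find MISSING (.both (.get CANDIDATE (sc NUM_VERTEX)) (.neg (.get SOURCE (sc NUM_VERTEX)))) ⨾
    find EXTRA (.both (.get SOURCE (sc NUM_VERTEX)) (.neg (.get CANDIDATE (sc NUM_VERTEX)))) ⨾
    .cond (.both (.neg (.sub (sc 0) (sc MISSING))) (.sub (sc 0) (sc EXTRA))) (set TOP (.lit 0))
      .skip

theorem runs_find_sdiff {a b c : ℕ} (hσ : HasInput adj k S σ)
    (hb : b ∉ [a, NUM_VERTEX] := by decide) (hc : c ∉ [a, NUM_VERTEX] := by decide)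
    (ha : 4 ≤ a := by decide) (ha' : a ≠ NUM_VERTEX := by decide) :
    Runs (find a (.both (.get b (sc NUM_VERTEX)) (.neg (.get c (sc NUM_VERTEX))))) σ (n * 40 + 20)
      fun σ' => IsLast n (· ∈ marked n (σ b) \ marked n (σ c)) (σ' a 0) := by
  refine (runs_find hσ (fun u τ hf hu => ?_) ha ha').mono
    (by simp only [Expr.both, Expr.neg, sc, Expr.cost]; omega) fun _ h => h
  have h_frame (d : ℕ) (hd : d ∉ [a, NUM_VERTEX]) : τ d = σ d := hf d fun h => hd <| by
    simpa only [find, forVertex, forTo, set, Prog.mods, List.mem_append, List.mem_cons,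
      List.not_mem_nil, or_false, false_or, or_self, or_comm, or_left_comm, or_self_left] using h
  rw [Expr.eval_both, Expr.eval_neg, Expr.eval, Expr.eval, sc, Expr.eval, Expr.eval, hu,
    h_frame b hb, h_frame c hc, Set.mem_sdiff, mem_marked, mem_marked, not_not]

theorem runs_compareSets (hσ : HasInput adj k S σ) :
    Runs compareSets σ (150 * size adj) fun σ' =>
      (σ' TOP 0 ≠ 0 ↔ σ TOP 0 ≠ 0 ∧ ¬ marked n (σ CANDIDATE) ⊂ marked n (σ SOURCE)) := by
  refine ((runs_find_sdiff hσ).seq (T' := n * 40 + 20 + 30) fun σ₁ hf₁ h₁ => ?_).mono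
    (by simp only [size]; omega) fun _ h => h
  refine (runs_find_sdiff (hσ.of_frame hf₁)).seq fun σ₂ hf₂ h₂ => .flat ?_
  rw [hf₁.eq CANDIDATE, hf₁.eq SOURCE] at h₂
  have h_test : (Expr.both (.neg (.sub (sc 0) (sc MISSING))) (.sub (sc 0) (sc EXTRA))).eval σ₂ ≠ 0 ↔
      marked n (σ CANDIDATE) ⊂ marked n (σ SOURCE) := by
    rw [Expr.eval_both, Expr.eval_neg, Expr.eval, Expr.eval,
      ((hσ.of_frame hf₁).of_frame hf₂).eval_size, Nat.sub_ne_zero_iff_lt, ← not_ne_iff,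
      Nat.sub_ne_zero_iff_lt, Set.ssubset_def]
    refine and_congr ?_ (h₂.lt_iff.trans Set.not_subset.symm)
    refine Iff.trans (not_congr ?_) not_not
    rw [Set.not_subset, sc, Expr.eval, hf₂.eq MISSING]
    exact h₁.lt_iff.trans Iff.rfl
  have h_top : σ₂ TOP = σ TOP := by rw [hf₂.eq TOP, hf₁.eq TOP]
  by_cases h : marked n (σ CANDIDATE) ⊂ marked n (σ SOURCE)
  · simp [Prog.act, h_test.2 h, h, set, Expr.eval]
  · simp [Prog.act, not_ne_iff.1 (mt h_test.1 h), h, h_top]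

/-- Set `TOP[0]` to `0` if the search from `ROOT[0]` with guess `RIVAL[0]` returns a proper superset
of `CANDIDATE`. -/
def compare : Prog := guess (sc RIVAL) ⨾ .cond isOk compareSets .skip

theorem runs_compare (hadj : IsAdjList G adj) (hσ : HasInput adj k S σ) (ht : Tables p σ)
    (hroot : σ ROOT 0 = v) :
    Runs compare σ (guessTime p (size adj) + 200 * size adj) fun σ' => (σ' TOP 0 ≠ 0 ↔ σ TOP 0 ≠ 0 ∧
      ∀ C', candidate G p S v (σ RIVAL 0) = some C' → ¬ marked n (σ CANDIDATE) ⊂ C') := by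
  refine ((runs_guess (G := G) (p := p) hadj hσ ht hroot rfl).seq (T' := 200 * size adj)
    fun σ₁ hf₁ h₁ => ?_).mono le_rfl fun _ h => h
  refine (Runs.cond (T := 150 * size adj) (T' := 1) (fun hb => ?_) fun hb => .flat ?_).mono
    (by simp only [isOk, Expr.neg, sc, Expr.cost, size]; omega) fun _ h => h
  · have h_some := (h₁.resolve_right fun h => h.1 (eval_isOk.1 hb)).2
    refine (runs_compareSets (hσ.of_frame hf₁ (by decide +kernel))).mono le_rfl fun σ₂ h₂ => ?_
    rw [h₂, h_some, hf₁.eq TOP, hf₁.eq CANDIDATE]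
    simp only [Option.some.injEq, forall_eq']
  · have h_none := (h₁.resolve_left fun h => eval_isOk.2 h.1 hb).2
    simp [Prog.act, hf₁.eq TOP, h_none]

/-- None of the first `N` candidates for `v` properly contains `C`. -/
def IsTop (G : SimpleGraph (Fin n)) (p : ℕ) (S : Set (Fin n)) (v : Fin n) (C : Set (Fin n))
    (N : ℕ) : Prop :=
  ∀ r < N, ∀ D, candidate G p S v r = some D → ¬ C ⊂ D

/-- Set `TOP[0]` to a truth value: no candidate for `ROOT[0]` properly contains `CANDIDATE`. -/
def check : Prog := set TOP (.lit 1) ⨾ forTo RIVAL (.get POWER (sc DEPTH)) compare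

theorem Tables.eval_depth (ht : Tables p σ) :
    (Expr.get POWER (sc DEPTH)).eval σ = 2 ^ (2 * p) := by
  rw [Expr.eval, sc, Expr.eval, Expr.eval, ht.2.1, ht.2.2 _ le_rfl]

theorem runs_check (hadj : IsAdjList G adj) (hσ : HasInput adj k S σ) (ht : Tables p σ)
    (hroot : σ ROOT 0 = v) :
    Runs check σ (2 ^ (2 * p) * (guessTime p (size adj) + 300 * size adj)) fun σ' =>
      (σ' TOP 0 ≠ 0 ↔ IsTop G p S v (marked n (σ CANDIDATE)) (2 ^ (2 * p))) := by
  have hσ₁ : HasInput adj k S (σ.write TOP 0 1) := hσ.write (by decide)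
  have ht₁ : Tables p (σ.write TOP 0 1) := ht
  refine (Runs.flat_seq (Runs.forTo_const (σ := σ.write TOP 0 1) (m := 2 ^ (2 * p))
    (c := guessTime p (size adj) + 200 * size adj)
    (I := fun j τ => τ TOP 0 ≠ 0 ↔ IsTop G p S v (marked n (σ CANDIDATE)) j) (by decide)
    (fun τ hf => (ht₁.of_frame hf).eval_depth) ?_ fun j _ τ hf hτ h => ?_)).mono ?_
    fun _ h => h
  · exact ⟨fun _ r hr => absurd hr r.not_lt_zero, fun _ => one_ne_zero⟩
  · have h_root : τ ROOT 0 = v := (congrFun (hf.eq ROOT) 0).trans hroot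
    refine (runs_compare (G := G) hadj (hσ₁.of_frame hf (by decide +kernel)) (ht₁.of_frame hf)
      h_root).mono le_rfl fun τ' h' => ?_
    change τ' TOP 0 ≠ 0 ↔ _
    rw [h', h, hτ, hf.eq CANDIDATE]
    exact Nat.forall_lt_succ_right.symm
  · have h_one : 1 ≤ size adj := Nat.le_add_left _ _
    have h_pow : 1 ≤ 2 ^ (2 * p) := Nat.one_le_two_pow
    simp only [Prog.time, set, sc, Expr.cost]
    nlinarith

/-- Add `ROOT[0]` to `CHIPS` and the neighbours of `CANDIDATE` to `CUTS`. -/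
def record : Prog :=
  .assign CHIPS (sc ROOT) (.lit 1) ⨾ fill MEMBER (.get CANDIDATE (sc NUM_VERTEX)) ⨾ findNbhd ⨾
    fill CUTS (.add (.get CUTS (sc NUM_VERTEX)) (.get NBHD (sc NUM_VERTEX)))

theorem runs_record (hadj : IsAdjList G adj) (hσ : HasInput adj k S σ) (hroot : σ ROOT 0 = v)
    (hC : marked n (σ CANDIDATE) = C) :
    Runs record σ (300 * size adj) fun σ' =>
      marked n (σ' CHIPS) = insert v (marked n (σ CHIPS)) ∧
      marked n (σ' CUTS) = marked n (σ CUTS) ∪ nbhd G C := by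
  have h_act : (Prog.assign CHIPS (sc ROOT) (.lit 1)).act σ = σ.write CHIPS v 1 := by
    simp only [Prog.act, sc, Expr.eval, hroot]
  have hσ₁ : HasInput adj k S (σ.write CHIPS v 1) := hσ.write (by decide)
  have h_chips : marked n ((σ.write CHIPS v 1) CHIPS) = insert v (marked n (σ CHIPS)) := by
    rw [Store.write_same, marked_update one_ne_zero]
  refine (Runs.flat_seq (T := n * 23 + 20 + (150 * size adj + (n * 30 + 20))) (h_act ▸ ?_)).mono
    (by simp only [Prog.time, sc, Expr.cost, size]; omega) fun _ h => h
  refine (runs_copy hσ₁).seq fun σ₂ hf₂ h₂ => ?_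
  have hσ₂ := hσ₁.of_frame hf₂
  refine (runs_findNbhd hadj hσ₂).seq fun σ₃ hf₃ h₃ => ?_
  have h_nbhd : marked n (σ₃ NBHD) = nbhd G C := by rw [h₃, marked_congr h₂, ← hC]; rfl
  refine (runs_fill (f := fun u => σ₃ CUTS u + σ₃ NBHD u) (hσ₂.of_frame hf₃)
    fun u τ hf hu h_cuts => ?_).imp (by simp only [sc, Expr.cost]; omega)
    fun σ₄ hf₄ h₄ => ⟨?_, ?_⟩
  · simp only [Expr.eval, sc, hu, h_cuts, hf.eq NBHD]
  · rw [hf₄.eq CHIPS, hf₃.eq CHIPS, hf₂.eq CHIPS, h_chips]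
  · have h_cuts : σ₃ CUTS = σ CUTS := by
      rw [hf₃.eq CUTS, hf₂.eq CUTS, Store.write_ne _ _ _ (by decide)]
    ext u
    rw [mem_marked, h₄, h_cuts, Set.mem_union, ← h_nbhd, mem_marked, mem_marked]
    omega

/-- Record `SOURCE` if no candidate for `ROOT[0]` properly contains it. -/
def examineSet : Prog :=
  fill CANDIDATE (.get SOURCE (sc NUM_VERTEX)) ⨾ check ⨾ .cond (sc TOP) record .skip

theorem runs_examineSet (hadj : IsAdjList G adj) (hσ : HasInput adj k S σ) (ht : Tables p σ)
    (hroot : σ ROOT 0 = v) (hC : marked n (σ SOURCE) = C) :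
    Runs examineSet σ (2 ^ (2 * p) * (guessTime p (size adj) + 300 * size adj) + 400 * size adj)
      fun σ' =>
        marked n (σ' CHIPS) = marked n (σ CHIPS) ∪ {u | u = v ∧ IsTop G p S v C (2 ^ (2 * p))} ∧
        marked n (σ' CUTS) =
          marked n (σ CUTS) ∪ {x | IsTop G p S v C (2 ^ (2 * p)) ∧ x ∈ nbhd G C} := by
  refine ((runs_copy hσ).seq (T' := 2 ^ (2 * p) * (guessTime p (size adj) + 300 * size adj) +
    (4 + (300 * size adj + 1))) fun σ₁ hf₁ h₁ => ?_).mono (by simp only [size]; omega) fun _ h => h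
  have hσ₁ := hσ.of_frame hf₁
  have h_root : σ₁ ROOT 0 = v := by rw [hf₁.eq ROOT, hroot]
  have h_candidate : marked n (σ₁ CANDIDATE) = C := by rw [marked_congr h₁, hC]
  refine (runs_check (G := G) (v := v) hadj hσ₁ (ht.of_frame hf₁) h_root).seq fun σ₂ hf₂ h₂ => ?_
  rw [h_candidate] at h₂
  rw [← hf₁.eq CHIPS, ← hf₂.eq CHIPS, ← hf₁.eq CUTS, ← hf₂.eq CUTS]
  refine (Runs.cond (T := 300 * size adj) (T' := 1) (fun hb => ?_) fun hb => .flat ?_).mono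
    (by simp only [sc, Expr.cost]; omega) fun _ h => h
  · have h_top := h₂.1 hb
    refine (runs_record (v := v) (C := C) hadj (hσ₁.of_frame hf₂ (by decide +kernel)) ?_ ?_).mono
      le_rfl fun σ₃ h₃ => ⟨?_, ?_⟩
    · rw [hf₂.eq ROOT, h_root]
    · rw [hf₂.eq CANDIDATE, h_candidate]
    · simp [h₃.1, h_top]
    · simp [h₃.2, h_top]
  · simp [Prog.act, mt h₂.2 (not_ne_iff.2 hb)]

/-- Examine the candidate for `ROOT[0]` with guess `LEAF[0]`. -/
def examineGuess : Prog := guess (sc LEAF) ⨾ .cond isOk examineSet .skip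

/-- The candidate for `v` with guess `r` is `C`, and no other candidate for `v` properly contains
it. -/
def IsRecorded (G : SimpleGraph (Fin n)) (p : ℕ) (S : Set (Fin n)) (v : Fin n) (r : ℕ)
    (C : Set (Fin n)) : Prop :=
  candidate G p S v r = some C ∧ IsTop G p S v C (2 ^ (2 * p))

theorem examineGuess_time_le (N g : ℕ) {M : ℕ} (hN : 1 ≤ N) :
    g + (N * (g + 300 * M) + 450 * M) ≤ N * (2 * g + 800 * M) := by
  nlinarith [Nat.mul_le_mul_right g hN, Nat.mul_le_mul_right M hN]

theorem runs_examineGuess (hadj : IsAdjList G adj) (hσ : HasInput adj k S σ) (ht : Tables p σ)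
    (hroot : σ ROOT 0 = v) :
    Runs examineGuess σ (2 ^ (2 * p) * (2 * guessTime p (size adj) + 800 * size adj)) fun σ' =>
      marked n (σ' CHIPS) =
        marked n (σ CHIPS) ∪ {u | u = v ∧ ∃ C, IsRecorded G p S v (σ LEAF 0) C} ∧
      marked n (σ' CUTS) =
        marked n (σ CUTS) ∪ {x | ∃ C, IsRecorded G p S v (σ LEAF 0) C ∧ x ∈ nbhd G C} := by
  refine ((runs_guess (G := G) (p := p) hadj hσ ht hroot rfl).seq
    (T' := 2 ^ (2 * p) * (guessTime p (size adj) + 300 * size adj) + 450 * size adj)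
    fun σ₁ hf₁ h₁ => ?_).mono (examineGuess_time_le _ _ Nat.one_le_two_pow) fun _ h => h
  rw [← hf₁.eq CHIPS, ← hf₁.eq CUTS]
  refine (Runs.cond
    (T := 2 ^ (2 * p) * (guessTime p (size adj) + 300 * size adj) + 400 * size adj) (T' := 1)
    (fun hb => ?_) fun hb => .flat ?_).mono
    (by simp only [isOk, Expr.neg, sc, Expr.cost, size]; omega) fun _ h => h
  · have h_some := (h₁.resolve_right fun h => h.1 (eval_isOk.1 hb)).2
    have h_root : σ₁ ROOT 0 = v := by rw [hf₁.eq ROOT, hroot]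
    refine (runs_examineSet (G := G) (v := v) hadj (hσ.of_frame hf₁ (by decide +kernel))
      (ht.of_frame hf₁) h_root rfl).mono le_rfl fun σ₂ h₂ => ?_
    simpa only [IsRecorded, h_some, Option.some.injEq, and_assoc, exists_eq_left'] using h₂
  · have h_none := (h₁.resolve_left fun h => eval_isOk.2 h.1 hb).2
    simp [Prog.act, IsRecorded, h_none]

theorem candidate_eq_some {S : Set (Fin n)} {r : ℕ} (h : candidate G p S v r = some C) :
    v ∈ C ∧ IsPrechip G S p C := by
  rw [candidate, Option.ite_none_left_eq_some] at h
  have ⟨h_mem, h_pre⟩ := isPrechip_of_branch_eq_some ⟨.of_subsingleton⟩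
    (Set.disjoint_singleton_left.2 h.1) h.2
  exact ⟨h_mem rfl, h_pre⟩

theorem exists_candidate_eq_some {S : Set (Fin n)} (hC : Maximal (IsPrechip G S p) C) (hv : v ∈ C) :
    ∃ r < 2 ^ (2 * p), candidate G p S v r = some C := by
  obtain ⟨r, hr, h⟩ := exists_branch_eq_some hC hv
  exact ⟨r, hr, by rw [candidate, if_neg (hC.1.disjoint.notMem_of_mem_left hv), h]⟩

theorem exists_isRecorded_iff {S : Set (Fin n)} :
    (∃ r < 2 ^ (2 * p), IsRecorded G p S v r C) ↔ Maximal (IsPrechip G S p) C ∧ v ∈ C := by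
  constructor
  · rintro ⟨r, -, h, h_top⟩
    obtain ⟨hv, h_pre⟩ := candidate_eq_some h
    obtain ⟨D, hCD, hD⟩ := h_pre.exists_maximal
    obtain ⟨r', hr', h'⟩ := exists_candidate_eq_some hD (hCD hv)
    rw [hCD.eq_of_not_ssubset (h_top r' hr' D h')]
    exact ⟨hD, hCD hv⟩
  · rintro ⟨hC, hv⟩
    obtain ⟨r, hr, h⟩ := exists_candidate_eq_some hC hv
    exact ⟨r, hr, h, fun r' _ D hD => hC.not_gt (candidate_eq_some hD).2⟩

/-- `CHIPS` and `CUTS` contain the results for the pairs of a vertex and a guess in `D`. -/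
def HasRecorded (G : SimpleGraph (Fin n)) (p : ℕ) (S : Set (Fin n)) (D : Set (Fin n × ℕ))
    (τ : Store) : Prop :=
  marked n (τ CHIPS) = {u | ∃ q ∈ D, u = q.1 ∧ ∃ C, IsRecorded G p S q.1 q.2 C} ∧
  marked n (τ CUTS) = {x | ∃ q ∈ D, ∃ C, IsRecorded G p S q.1 q.2 C ∧ x ∈ nbhd G C}

/-- Bound for the number of steps spent on one vertex for an input of size `M`. -/
def vertexTime (p M : ℕ) : ℕ := 2 ^ (2 * p) * (2 ^ (2 * p) * (2 * guessTime p M + 900 * M))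

/-- Examine all candidates for `ROOT[0]`. -/
def examineVertex : Prog := forTo LEAF (.get POWER (sc DEPTH)) examineGuess

theorem runs_examineVertex (hadj : IsAdjList G adj) (hσ : HasInput adj k S σ) (ht : Tables p σ)
    (hroot : σ ROOT 0 = v) (h : HasRecorded G p S {q | q.1 < v ∧ q.2 < 2 ^ (2 * p)} σ) :
    Runs examineVertex σ (vertexTime p (size adj))
      (HasRecorded G p S {q | q.1 ≤ v ∧ q.2 < 2 ^ (2 * p)}) := by
  refine (Runs.forTo_const (m := 2 ^ (2 * p))
    (c := 2 ^ (2 * p) * (2 * guessTime p (size adj) + 800 * size adj))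
    (I := fun j => HasRecorded G p S
      ({q | q.1 < v ∧ q.2 < 2 ^ (2 * p)} ∪ {q | q.1 = v ∧ q.2 < j}))
    (by decide +kernel)
    (fun τ hf => (ht.of_frame hf (by decide +kernel) (by decide +kernel)
      (by decide +kernel)).eval_depth) ?_ fun j _ τ hf hτ h => ?_).mono ?_ fun τ h => ?_
  · have h_empty : {q : Fin n × ℕ | q.1 = v ∧ q.2 < 0} = ∅ := by simp
    rw [h_empty, Set.union_empty]
    exact h
  · have h_root : τ ROOT 0 = v := by rw [hf.eq ROOT (by decide +kernel), hroot]
    have h_insert : {q : Fin n × ℕ | q.1 = v ∧ q.2 < j + 1} =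
        insert (v, j) {q | q.1 = v ∧ q.2 < j} := by
      ext q
      simp only [Set.mem_insert_iff, Set.mem_ofPred_eq, Prod.ext_iff]
      omega
    refine (runs_examineGuess (G := G) hadj (hσ.of_frame hf (by decide +kernel))
      (ht.of_frame hf (by decide +kernel) (by decide +kernel) (by decide +kernel))
      h_root).mono le_rfl fun τ' ⟨h_chips, h_cuts⟩ => ?_
    rw [hτ, h.1] at h_chips
    rw [hτ, h.2] at h_cuts
    rw [h_insert, Set.union_insert]
    refine ⟨h_chips.trans ?_, h_cuts.trans ?_⟩
    · simp only [Set.mem_insert_iff, exists_eq_or_imp]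
      exact Set.union_comm _ _
    · simp only [Set.mem_insert_iff, exists_eq_or_imp]
      exact Set.union_comm _ _
  · have h_one : 1 ≤ size adj := Nat.le_add_left _ _
    have h_pow : 1 ≤ 2 ^ (2 * p) := Nat.one_le_two_pow
    have h_mul : 1 ≤ 2 ^ (2 * p) * size adj := Nat.mul_pos h_pow h_one
    simp only [sc, Expr.cost, vertexTime]
    nlinarith [Nat.mul_le_mul_left (2 ^ (2 * p)) h_mul]
  · convert h using 1
    ext q
    simp only [Set.mem_union, Set.mem_ofPred_eq, le_iff_lt_or_eq, or_and_right]

theorem HasRecorded.mem_chipBag_iff (h : HasRecorded G (3 * k) S {q | q.2 < 2 ^ (2 * (3 * k))} τ)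
    (u : Fin n) : u ∈ chipBag G k S ↔ τ CHIPS u = 0 ∨ τ CUTS u ≠ 0 := by
  have h_iff (u C) : (∃ r < 2 ^ (2 * (3 * k)), IsRecorded G (3 * k) S u r C) ↔
      C ∈ maxChips G k S ∧ u ∈ C := by
    rw [exists_isRecorded_iff, mem_maxChips_iff]
  have h_chips : τ CHIPS u ≠ 0 ↔ ∃ C ∈ maxChips G k S, u ∈ C := by
    simp only [← h_iff]
    rw [← mem_marked, h.1]
    simp only [Set.mem_ofPred_eq, Prod.exists]
    grind
  have h_cuts : τ CUTS u ≠ 0 ↔ ∃ C ∈ maxChips G k S, u ∈ nbhd G C := by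
    rw [← mem_marked, h.2]
    simp only [Set.mem_ofPred_eq, Prod.exists]
    constructor
    · rintro ⟨w, r, hr, C, hC, hu⟩
      exact ⟨C, ((h_iff w C).1 ⟨r, hr, hC⟩).1, hu⟩
    · rintro ⟨C, hC, hu⟩
      obtain ⟨-, w, hw, -⟩ := id hu
      obtain ⟨r, hr, h⟩ := (h_iff w C).2 ⟨hC, hw⟩
      exact ⟨w, r, hr, C, h, hu⟩
  rw [LocalDecomp.mem_chipBag_iff, ← h_cuts, ← not_ne_iff, h_chips]
  push Not
  rfl

/-- Examine all candidates for all vertices. -/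
def examineAll : Prog := forTo ROOT (sc 0) examineVertex

theorem runs_examineAll (hadj : IsAdjList G adj) (hσ : HasInput adj k S σ) (ht : Tables p σ)
    (h_chips : σ CHIPS = 0) (h_cuts : σ CUTS = 0) :
    Runs examineAll σ (n * (vertexTime p (size adj) + 12) + 9)
      (HasRecorded G p S {q | q.2 < 2 ^ (2 * p)}) := by
  have h_input {τ} (hf : Frame examineAll σ τ) : HasInput adj k S τ :=
    hσ.of_frame hf (by decide +kernel)
  refine (Runs.forTo_const (m := n) (c := vertexTime p (size adj))
    (I := fun i => HasRecorded G p S {q | q.1 < i ∧ q.2 < 2 ^ (2 * p)}) (by decide +kernel)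
    (fun τ hf => (h_input hf).eval_size) ?_ fun i hi τ hf hτ h => ?_).mono le_rfl
    fun τ h => by simpa using h
  · have h_marked : marked n 0 = ∅ := by simp [marked]
    simp [HasRecorded, Store.write_ne, h_chips, h_cuts, h_marked]
  · have h_lt (x : Fin n) : (x : ℕ) < i + 1 ↔ x ≤ ⟨i, hi⟩ := Nat.lt_succ_iff
    simp only [h_lt]
    exact runs_examineVertex (v := ⟨i, hi⟩) hadj (h_input hf)
      (ht.of_frame hf (by decide +kernel) (by decide +kernel) (by decide +kernel)) hτ h

/-- The program that computes `chipBag`. -/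
def main : Prog :=
  tables ⨾ examineAll ⨾
    fill 4 (.add (.neg (.get CHIPS (sc NUM_VERTEX))) (.get CUTS (sc NUM_VERTEX)))

/-- Bound for the number of steps of `main`. -/
def mainTime (k n M : ℕ) : ℕ :=
  200 * k + 50 + (n * (vertexTime (3 * k) M + 12) + 9 + (n * 40 + 20))

theorem runs_main (hadj : IsAdjList G adj) :
    Runs main (inputStore adj k S) (mainTime k n (size adj)) fun σ' =>
      outputSet n σ' = chipBag G k S := by
  have hσ : HasInput adj k S (inputStore adj k S) := fun _ _ => rfl
  refine (runs_tables hσ).seq fun σ₁ hf₁ ht => ?_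
  have hσ₁ := hσ.of_frame hf₁
  refine (runs_examineAll hadj hσ₁ ht (hf₁.eq CHIPS) (hf₁.eq CUTS)).seq fun σ₂ hf₂ h => ?_
  refine (runs_fill (f := fun u => (1 - σ₂ CHIPS u) + σ₂ CUTS u)
    (hσ₁.of_frame hf₂ (by decide +kernel)) fun u τ hf hu _ => ?_).mono
    (by simp only [Expr.neg, sc, Expr.cost]; omega) fun σ₃ h₃ => ?_
  · simp only [Expr.neg, Expr.eval, sc, hu, hf.eq CHIPS, hf.eq CUTS]
  · ext u
    rw [h.mem_chipBag_iff u, outputSet, Set.mem_ofPred_eq, h₃ u]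
    omega

theorem size_eq (hadj : IsAdjList G adj) : size adj = n + 2 * G.edgeSet.ncard + 1 := by
  classical
  have h_length (u : Fin n) : (adj u).length = G.degree u := by
    rw [← SimpleGraph.card_neighborFinset_eq_degree, ← List.toFinset_card_of_nodup (hadj u).1]
    congr 1
    ext w
    simp [(hadj u).2]
  rw [size]
  simp only [h_length]
  rw [SimpleGraph.sum_degrees_eq_twice_card_edges, Set.ncard_eq_toFinset_card',
    SimpleGraph.edgeFinset]

theorem guessTime_le (p M : ℕ) : guessTime p M ≤ 12000 * (2 ^ (2 * p) * M) := by
  have h_pow : p + 1 ≤ 2 ^ p := Nat.lt_two_pow_self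
  calc (2 * p + 2) * ((p + 2) * (3000 * M)) ≤ (2 * 2 ^ p) * ((2 * 2 ^ p) * (3000 * M)) := by
        gcongr <;> omega
    _ = 12000 * (2 ^ (2 * p) * M) := by ring

theorem vertexTime_le (p M : ℕ) : vertexTime p M ≤ 24900 * (2 ^ (6 * p) * M) := by
  have h_le : M ≤ 2 ^ (2 * p) * M := Nat.le_mul_of_pos_left _ Nat.one_le_two_pow
  have h_guess := guessTime_le p M
  calc vertexTime p M ≤ 2 ^ (2 * p) * (2 ^ (2 * p) * (24900 * (2 ^ (2 * p) * M))) := by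
        unfold vertexTime
        gcongr
        omega
    _ = 24900 * (2 ^ (6 * p) * M) := by ring

theorem mainTime_le (k : ℕ) {n m : ℕ} (hn : 1 ≤ n) (hm : n ≤ m + 1) :
    mainTime k n (n + 2 * m + 1) ≤ 1000000 * 2 ^ (1000000 * k) * (n * m + 1) := by
  have h_pow : k + 1 ≤ 2 ^ (6 * (3 * k)) :=
    Nat.lt_two_pow_self.trans_le (Nat.pow_le_pow_right two_pos (by omega))
  have h_exp : 2 ^ (6 * (3 * k)) ≤ 2 ^ (1000000 * k) := Nat.pow_le_pow_right two_pos (by omega)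
  have h_size : n * (n + 2 * m + 1) ≤ 5 * (n * m + 1) := by nlinarith
  have h_vertex : n * vertexTime (3 * k) (n + 2 * m + 1) ≤
      124500 * (2 ^ (6 * (3 * k)) * (n * m + 1)) := by
    calc _ ≤ n * (24900 * (2 ^ (6 * (3 * k)) * (n + 2 * m + 1))) := by
          gcongr
          exact vertexTime_le _ _
      _ = 24900 * (2 ^ (6 * (3 * k)) * (n * (n + 2 * m + 1))) := by ring
      _ ≤ 24900 * (2 ^ (6 * (3 * k)) * (5 * (n * m + 1))) := by gcongr
      _ = _ := by ring
  have h_param : k + 1 ≤ 2 ^ (6 * (3 * k)) * (n * m + 1) :=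
    h_pow.trans (Nat.le_mul_of_pos_right _ (by omega))
  have h_order : n ≤ 2 * (2 ^ (6 * (3 * k)) * (n * m + 1)) := by
    have : n * m + 1 ≤ 2 ^ (6 * (3 * k)) * (n * m + 1) :=
      Nat.le_mul_of_pos_left _ (by positivity)
    nlinarith
  calc mainTime k n (n + 2 * m + 1)
      = n * vertexTime (3 * k) (n + 2 * m + 1) + 52 * n + 200 * k + 79 := by
        rw [mainTime]
        ring
    _ ≤ 1000000 * (2 ^ (6 * (3 * k)) * (n * m + 1)) := by omega
    _ ≤ 1000000 * (2 ^ (1000000 * k) * (n * m + 1)) :=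
        Nat.mul_le_mul_left _ (Nat.mul_le_mul_right _ h_exp)
    _ = _ := by ring

end Main

end LocalDecomp

open LocalDecomp in
theorem theorem3p3 :
    ∃ (P : Prog) (c : ℕ),
      ∀ (n : ℕ) (G : SimpleGraph (Fin n)) (adj : Fin n → List (Fin n)) (k : ℕ)
        (S : Finset (Fin n)),
        G.Connected → IsAdjList G adj → IsUnbreakable G (2 * k) k (S : Set (Fin n)) →
        ∃ (t : ℕ) (σ : Store) (A : Set (Fin n)),
          Exec P (inputStore adj k S) t σ ∧
          t ≤ c * 2 ^ (c * k) * (n * G.edgeSet.ncard + 1) ∧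
          outputSet n σ = A ∧
          A = chipBag G k (S : Set (Fin n)) ∧
          (S : Set (Fin n)) ⊆ A ∧
          (∀ D : (G.induce Aᶜ).ConnectedComponent,
            (nbhd G (Subtype.val '' D.supp)).ncard ≤ eta k) ∧
          IsUnbreakable G (tau k) k A ∧
          (3 * k < S.card → (G.induce (S : Set (Fin n))ᶜ).Connected →
            nbhd G (S : Set (Fin n))ᶜ = (S : Set (Fin n)) → (S : Set (Fin n)) ≠ A) := by
  refine ⟨main, 1000000, fun n G adj k S hG hadj hS => ?_⟩
  obtain ⟨t, σ, h_exec, h_time, h_out⟩ := runs_main (k := k) (S := S) hadj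
  have h_pos : 1 ≤ n := Fin.pos_iff_nonempty.2 hG.nonempty
  have h_edges : n ≤ G.edgeSet.ncard + 1 := by
    simpa using hG.card_vert_le_card_edgeSet_add_one
  have h_chips := ncard_maxChips_mem_le G k (S : Set (Fin n))
  refine ⟨t, σ, _, h_exec, h_time.trans ?_, h_out, rfl, subset_chipBag,
    fun D => ncard_nbhd_component_le h_chips D,
    (isUnbreakable_chipBag h_chips hS).mono (le_tau k),
    fun h_card h_conn h_nbhd => ne_chipBag (by rwa [Set.ncard_coe_finset]) h_conn h_nbhd⟩
  rw [size_eq hadj]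
  exact mainTime_le k h_pos h_edges
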